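/- Let $(\mathsf E,\otimes,\mathbb 1)$ be a symmetric monoidal category. An *operad* means a small coloured symmetric operad enriched in $\mathsf E$: a set of colours $\mathrm{Ob}(\mathcal P)$, objects $\mathcal P(\underline c;c')\in\mathsf E$ for every finite word of colours $\underline c$ and colour $c'$, actions of permutations, units, and partial compositions $\mathcal P(\underline c';c_i)$ into the $i$-th input of $\mathcal P(\underline c;c)$, subject to the usual unit, associativity and equivariance axioms. The category $\mathsf{Operad}_{\mathsf E}$ of operads is symmetric monoidal for the Hadamard product $\mathcal P\otimes_{\mathbb H}\mathcal P'$, which has colours $\mathrm{Ob}(\mathcal P)\times\mathrm{Ob}(\mathcal P')$ and operations $\mathcal P(\underline x;x_0)\otimes\mathcal P'(\underline x';x_0')$; its unit $\mathrm{uCom}$ has one colour and all operation objects equal to $\mathbb 1$. Let $\mathcal C$ be a symmetric monoidal $\mathsf E$-enriched category, and let $\mathcal End(\mathcal C)$ be its coloured endomorphism operad, $\mathcal End(\mathcal C)(x_1,\dots,x_n;x)=\mathcal C(x_1\otimes\dots\otimes x_n,x)$. A $\mathcal P$-algebra in $\mathcal C$ is a morphism $A:\mathcal P\to\mathcal End(\mathcal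 C)$; a morphism of $\mathcal P$-algebras $A\to B$ is a family of morphisms $A(c)\to B(c)$ of $\mathcal C$ compatible with the operations of $\mathcal P$; a morphism of operads $f:\mathcal P\to\mathcal P'$ induces $f^*:\mathsf{Alg}_{\mathcal C}(\mathcal P')\to\mathsf{Alg}_{\mathcal C}(\mathcal P)$ by precomposition. Coalgebras are defined by $\mathsf{Cog}_{\mathcal C}(\mathcal P)=\mathsf{Alg}_{\mathcal C^{op}}(\mathcal P)^{op}$. Let $\mathsf{OpAlg}_{\mathcal C}$ be the category of pairs $(\mathcal P,A)$ of an operad and a $\mathcal P$-algebra in $\mathcal C$, a morphism $(\mathcal P,A)\to(\mathcal P',A')$ being a morphism of operads $f:\mathcal P\to\mathcal P'$ together with a morphism of $\mathcal P$-algebras $A\to f^*A'$. Let $\mathsf{OpCog}_{\mathcal C}$ be defined in the same way from the categories $\mathsf{Cog}_{\mathcal C}(\mathcal P)$. For algebras $A$ over $\mathcal P$ and $A'$ over $\mathcal P'$, let $A\lozenge A'$ be the $\mathcal P\otimes_{\mathbb H}\mathcal P'$-algebra given by $$\mathcal P\otimes_{\mathbb H}\mathcal P'\xrightarrow{A\otimes_{\mathbb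 H}A'}\mathcal End(\mathcal C)\otimes_{\mathbb H}\mathcal End(\mathcal C)\to\mathcal End(\mathcal C),$$ where the last map is induced by the tensor product of $\mathcal C$, so that $(A\lozenge A')(x,x')=A(x)\otimes A'(x')$. **Proposition.** The category $\mathsf{OpAlg}_{\mathcal C}$ has a symmetric monoidal structure whose tensor product is $(\mathcal P,A)\otimes(\mathcal P',A')=(\mathcal P\otimes_{\mathbb H}\mathcal P',A\lozenge A')$, whose unit is $(\mathrm{uCom},\mathbb 1_{\mathcal C})$ with $\mathbb 1_{\mathcal C}$ carrying its canonical algebra structure, and for which the tensor product of morphisms, the associator, the unitors and the symmetry are given by those of $\mathsf{Operad}_{\mathsf E}$ and, on the underlying families of objects of $\mathcal C$, by those of $\mathcal C$. With this structure the forgetful functor $\mathsf{OpAlg}_{\mathcal C}\to\mathsf{Operad}_{\mathsf E}$ is a symmetric monoidal cartesian fibration, that is: - it is a cartesian fibration; - it is a strict symmetric monoidal functor; - the tensor product of any two cartesian morphisms of $\mathsf{OpAlg}_{\mathcal C}$ is cartesian. The same holds for $\mathsf{OpCog}_{\mathcal C}\to\mathsf{Operad}_{\mathsf E}$, with $V\lozenge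 V'$ and the canonical structure on $\mathbb 1_{\mathcal C}$ formed in $\mathcal C^{op}$. -/

import Mathlib

open CategoryTheory MonoidalCategory Opposite Limits

universe u u₁ u₂ u₃ u₄ v w v' w'

noncomputable section

namespace ColouredOperads

/-! ### Tuples of colours -/

/-- When the `i`-th entry (out of `n`, counted from `0`) of a tuple is replaced by `m` new entries,
the entry in position `j ≠ i` moves to position `p`. -/
def OuterPos (i m j p : ℕ) : Prop :=
  (j < i ∧ p = j) ∨ (i < j ∧ p + 1 = j + m)

/-- `IsInsertion c i x c' r`: the `i`-th entry of the tuple `c` is `x`, and `r` is the tuple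
`c ◁ᵢ c' = (c₀, …, cᵢ₋₁, c'₀, …, c'ₘ₋₁, cᵢ₊₁, …, cₙ₋₁)` (so `r` is determined by `c`, `i`, `c'`). -/
structure IsInsertion {X : Type u} {n m k : ℕ} (c : Fin n → X) (i : Fin n) (x : X)
    (c' : Fin m → X) (r : Fin k → X) : Prop where
  colour : c i = x
  length : k + 1 = n + m
  outer : ∀ (j : Fin n) (p : Fin k), OuterPos i m j p → r p = c j
  inner : ∀ (l : Fin m) (p : Fin k), (p : ℕ) = i + l → r p = c' l

/-- The permutation `ρ` of the entries of `c ◁ᵢ c'` induced by a permutation `σ` of the entries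
of `c` and a permutation `τ` of the entries of `c'`. -/
structure IsInsertionPerm {n n' m m' k k' : ℕ} (i : Fin n') (σ : Fin n' ≃ Fin n)
    (τ : Fin m' ≃ Fin m) (ρ : Fin k' ≃ Fin k) : Prop where
  outer : ∀ (j : Fin n') (p : Fin k') (q : Fin k),
    OuterPos i m' j p → OuterPos (σ i) m (σ j) q → ρ p = q
  inner : ∀ (l : Fin m') (p : Fin k') (q : Fin k),
    (p : ℕ) = i + l → (q : ℕ) = σ i + τ l → ρ p = q

lemma IsInsertion.map {X : Type u₁} {Y : Type u₂} {n m k : ℕ} {c : Fin n → X} {i : Fin n} {x : X}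
    {c' : Fin m → X} {r : Fin k → X} (f : X → Y) (h : IsInsertion c i x c' r) :
    IsInsertion (fun j => f (c j)) i (f x) (fun j => f (c' j)) (fun j => f (r j)) where
  colour := congrArg f h.colour
  length := h.length
  outer j p hp := congrArg f (h.outer j p hp)
  inner l p hp := congrArg f (h.inner l p hp)

/-! ### Enriched coloured operads -/

section Operads

set_option linter.unusedSectionVars false

variable (E : Type w) [Category.{v} E] [MonoidalCategory E] [SymmetricCategory E]

/-- The operations of an enriched coloured operad, before the axioms are imposed.
A morphism `c ⟶ c'` of the groupoid of tuples of colours is a bijection `e : Fin m ≃ Fin n` of the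
index sets (so `m = n`) with `c = c' ∘ e`; it acts contravariantly by `act`. -/
structure OperadData where
  /-- the colours -/
  Ob : Type u
  /-- the object of operations with inputs `c` and output `d` -/
  ops : ∀ {n : ℕ}, (Fin n → Ob) → Ob → E
  /-- the action of permutations -/
  act : ∀ {m n : ℕ} {c : Fin m → Ob} {c' : Fin n → Ob} (e : Fin m ≃ Fin n)
    (_ : ∀ j, c j = c' (e j)) (d : Ob), ops c' d ⟶ ops c d
  /-- the units -/
  unit : ∀ x : Ob, 𝟙_ E ⟶ ops (fun _ : Fin 1 => x) x
  /-- the partial compositions `γᵢ : P(c; d) ⊗ P(c'; cᵢ) ⟶ P(c ◁ᵢ c'; d)` -/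
  comp : ∀ {n m k : ℕ} {c : Fin n → Ob} {i : Fin n} {x : Ob} {c' : Fin m → Ob} {r : Fin k → Ob}
    (_ : IsInsertion c i x c' r) (d : Ob), ops c d ⊗ ops c' x ⟶ ops r d

/-- An enriched coloured (symmetric) operad. -/
structure Operad extends OperadData.{u} E where
  act_refl : ∀ {n : ℕ} (c : Fin n → Ob) (d : Ob),
    act (Equiv.refl (Fin n)) (fun j => (rfl : c j = c j)) d = 𝟙 (ops c d)
  act_trans : ∀ {l m n : ℕ} {b : Fin l → Ob} {c : Fin m → Ob} {c' : Fin n → Ob}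
    (e : Fin l ≃ Fin m) (e' : Fin m ≃ Fin n) (h : ∀ j, b j = c (e j)) (h' : ∀ j, c j = c' (e' j))
    (h'' : ∀ j, b j = c' ((e.trans e') j)) (d : Ob),
    act e' h' d ≫ act e h d = act (e.trans e') h'' d
  unit_comp : ∀ {n : ℕ} (c : Fin n → Ob) (x : Ob)
    (h : IsInsertion (fun _ : Fin 1 => x) 0 x c c),
    unit x ▷ ops c x ≫ comp h x = (λ_ (ops c x)).hom
  comp_unit : ∀ {n : ℕ} (c : Fin n → Ob) (i : Fin n) (x d : Ob)
    (h : IsInsertion c i x (fun _ : Fin 1 => x) c),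
    ops c d ◁ unit x ≫ comp h d = (ρ_ (ops c d)).hom
  /-- sequential associativity: `(a ∘ᵢ b) ∘ᵢ₊ⱼ e = a ∘ᵢ (b ∘ⱼ e)` -/
  comp_assoc : ∀ {n m l k k' t : ℕ} {c : Fin n → Ob} {c' : Fin m → Ob} {c'' : Fin l → Ob}
    {r : Fin k → Ob} {s : Fin k' → Ob} {z : Fin t → Ob} {i : Fin n} {j : Fin m} {p : Fin k}
    {x y : Ob} (d : Ob) (_ : (p : ℕ) = i + j)
    (h₁ : IsInsertion c i x c' r) (h₂ : IsInsertion r p y c'' z)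
    (h₃ : IsInsertion c' j y c'' s) (h₄ : IsInsertion c i x s z),
    comp h₁ d ▷ ops c'' y ≫ comp h₂ d =
      (α_ _ _ _).hom ≫ ops c d ◁ comp h₃ x ≫ comp h₄ d
  /-- parallel associativity: for `i ≠ j`, inserting `b` in position `i` and then `e` in (the new
  position of) `j` is the same as inserting `e` first and then `b` -/
  comp_comm : ∀ {n m l k k' t : ℕ} {c : Fin n → Ob} {c' : Fin m → Ob} {c'' : Fin l → Ob}
    {r : Fin k → Ob} {s : Fin k' → Ob} {z : Fin t → Ob} {i j : Fin n} {p : Fin k} {q : Fin k'}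
    {x y : Ob} (d : Ob) (_ : OuterPos i m j p) (_ : OuterPos j l i q)
    (h₁ : IsInsertion c i x c' r) (h₂ : IsInsertion r p y c'' z)
    (h₃ : IsInsertion c j y c'' s) (h₄ : IsInsertion s q x c' z),
    comp h₁ d ▷ ops c'' y ≫ comp h₂ d =
      (α_ _ _ _).hom ≫ ops c d ◁ (β_ (ops c' x) (ops c'' y)).hom ≫ (α_ _ _ _).inv ≫
        comp h₃ d ▷ ops c' x ≫ comp h₄ d
  /-- equivariance of the partial compositions -/
  act_comp : ∀ {n n' m m' k k' : ℕ} {c : Fin n → Ob} {b : Fin n' → Ob} {c' : Fin m → Ob}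
    {b' : Fin m' → Ob} {r : Fin k → Ob} {s : Fin k' → Ob} {i : Fin n'} {x : Ob} (d : Ob)
    (σ : Fin n' ≃ Fin n) (τ : Fin m' ≃ Fin m) (ρ : Fin k' ≃ Fin k)
    (_ : IsInsertionPerm i σ τ ρ)
    (hσ : ∀ j, b j = c (σ j)) (hτ : ∀ j, b' j = c' (τ j)) (hρ : ∀ j, s j = r (ρ j))
    (h : IsInsertion c (σ i) x c' r) (h' : IsInsertion b i x b' s),
    (act σ hσ d ⊗ₘ act τ hτ x) ≫ comp h' d = comp h d ≫ act ρ hρ d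

variable {E}

/-- A function on colours together with maps between objects of operations, not required to respect
any structure. -/
@[ext]
structure OperadData.Map (P : OperadData.{u₁} E) (Q : OperadData.{u₂} E) where
  obj : P.Ob → Q.Ob
  map : ∀ {n : ℕ} (c : Fin n → P.Ob) (d : P.Ob), P.ops c d ⟶ Q.ops (fun j => obj (c j)) (obj d)

/-- The composite of two maps. -/
abbrev OperadData.Map.comp {P : OperadData.{u₁} E} {Q : OperadData.{u₂} E} {R : OperadData.{u₃} E}
    (f : P.Map Q) (g : Q.Map R) : P.Map R where
  obj x := g.obj (f.obj x)
  map c d := f.map c d ≫ g.map _ _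

/-- Compatibility of a map with the permutations, units and partial compositions. -/
structure OperadData.Map.IsMorphism {P : OperadData.{u₁} E} {Q : OperadData.{u₂} E}
    (f : P.Map Q) : Prop where
  act_map : ∀ {m n : ℕ} {c : Fin m → P.Ob} {c' : Fin n → P.Ob} (e : Fin m ≃ Fin n)
    (h : ∀ j, c j = c' (e j)) (d : P.Ob),
    P.act e h d ≫ f.map c d = f.map c' d ≫ Q.act e (fun j => congrArg f.obj (h j)) (f.obj d)
  unit_map : ∀ x : P.Ob, P.unit x ≫ f.map _ x = Q.unit (f.obj x)
  comp_map : ∀ {n m k : ℕ} {c : Fin n → P.Ob} {i : Fin n} {x : P.Ob} {c' : Fin m → P.Ob}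
    {r : Fin k → P.Ob} (h : IsInsertion c i x c' r) (d : P.Ob),
    P.comp h d ≫ f.map r d = (f.map c d ⊗ₘ f.map c' x) ≫ Q.comp (h.map f.obj) (f.obj d)

lemma OperadData.Map.IsMorphism.comp {P : OperadData.{u₁} E} {Q : OperadData.{u₂} E}
    {R : OperadData.{u₃} E} {f : P.Map Q} {g : Q.Map R} (hf : f.IsMorphism) (hg : g.IsMorphism) :
    (f.comp g).IsMorphism where
  act_map e h d := by
    dsimp only
    rw [← Category.assoc, hf.act_map, Category.assoc, hg.act_map, Category.assoc]
  unit_map x := by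
    dsimp only
    rw [← Category.assoc, hf.unit_map, hg.unit_map]
  comp_map h d := by
    dsimp only
    rw [← Category.assoc, hf.comp_map, Category.assoc, hg.comp_map, ← Category.assoc,
      tensorHom_comp_tensorHom]

/-- Morphisms of enriched coloured operads. -/
@[ext]
structure OperadData.Hom (P : OperadData.{u₁} E) (Q : OperadData.{u₂} E) extends P.Map Q where
  isMorphism : toMap.IsMorphism

/-- The composite of two morphisms of operads. -/
abbrev OperadData.Hom.comp {P : OperadData.{u₁} E} {Q : OperadData.{u₂} E} {R : OperadData.{u₃} E}
    (f : P.Hom Q) (g : Q.Hom R) : P.Hom R where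
  toMap := f.toMap.comp g.toMap
  isMorphism := f.isMorphism.comp g.isMorphism

/-- The identity morphism. -/
abbrev OperadData.Hom.id (P : OperadData.{u} E) : P.Hom P where
  obj x := x
  map _ _ := 𝟙 _
  isMorphism := ⟨by simp, by simp, by simp⟩

/-- The category of (small) enriched coloured operads. -/
instance : Category (Operad.{u} E) where
  Hom P Q := P.toOperadData.Hom Q.toOperadData
  id P := OperadData.Hom.id P.toOperadData
  comp f g := f.comp g
  id_comp _ := by
    refine OperadData.Hom.ext rfl (heq_of_eq ?_)
    dsimp only
    simp only [Category.id_comp]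
  comp_id _ := by
    refine OperadData.Hom.ext rfl (heq_of_eq ?_)
    dsimp only
    simp only [Category.comp_id]
  assoc _ _ _ := by
    refine OperadData.Hom.ext rfl (heq_of_eq ?_)
    dsimp only
    simp only [Category.assoc]

lemma OperadData.Hom.ext_map {P : OperadData.{u₁} E} {Q : OperadData.{u₂} E} (f g : P.Hom Q)
    (o : P.Ob → Q.Ob)
    (m m' : ∀ {n : ℕ} (c : Fin n → P.Ob) (d : P.Ob), P.ops c d ⟶ Q.ops (fun j => o (c j)) (o d))
    (hf : f.toMap = ⟨o, m⟩) (hg : g.toMap = ⟨o, m'⟩)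
    (h : ∀ (n : ℕ) (c : Fin n → P.Ob) (d : P.Ob), m c d = m' c d) : f = g := by
  obtain ⟨f, _⟩ := f
  obtain ⟨g, _⟩ := g
  subst hf hg
  have : @m = @m' := by
    funext n c d
    exact h n c d
  subst this
  rfl

/-! ### The Hadamard tensor product -/

/-- The tensor product of symmetric monoidal categories is compatible with braidings. -/
lemma tensorμ_braiding (X₁ X₂ Y₁ Y₂ : E) :
    tensorμ X₁ X₂ Y₁ Y₂ ≫ ((β_ X₁ Y₁).hom ⊗ₘ (β_ X₂ Y₂).hom) =
      (β_ (X₁ ⊗ X₂) (Y₁ ⊗ Y₂)).hom ≫ tensorμ Y₁ Y₂ X₁ X₂ := by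
  have h : (β_ X₁ Y₂).hom ▷ X₂ ≫ (β_ Y₂ X₁).hom ▷ X₂ = 𝟙 _ := by
    rw [← comp_whiskerRight, SymmetricCategory.symmetry, id_whiskerRight]
  simp only [tensorμ, MonoidalCategory.tensorHom_def, BraidedCategory.braiding_tensor_left_hom,
    BraidedCategory.braiding_tensor_right_hom, Category.assoc, MonoidalCategory.whiskerLeft_comp, comp_whiskerRight]
  have h' := congrArg (fun f => Y₁ ◁ f) h
  simp only [MonoidalCategory.whiskerLeft_comp, MonoidalCategory.whiskerLeft_id] at h'
  simp [reassoc_of% h']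

lemma tensorμ_braiding_assoc {X₁ X₂ Y₁ Y₂ Z : E} (f : (Y₁ ⊗ X₁) ⊗ Y₂ ⊗ X₂ ⟶ Z) :
    tensorμ X₁ X₂ Y₁ Y₂ ≫ ((β_ X₁ Y₁).hom ⊗ₘ (β_ X₂ Y₂).hom) ≫ f =
      (β_ (X₁ ⊗ X₂) (Y₁ ⊗ Y₂)).hom ≫ tensorμ Y₁ Y₂ X₁ X₂ ≫ f := by
  rw [← Category.assoc, tensorμ_braiding, Category.assoc]

lemma tensorμ_swap (X₁ X₂ Y₁ Y₂ Z₁ Z₂ : E) :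
    (tensorμ X₁ X₂ Y₁ Y₂ ▷ (Z₁ ⊗ Z₂)) ≫ tensorμ (X₁ ⊗ Y₁) (X₂ ⊗ Y₂) Z₁ Z₂ ≫
        (((α_ X₁ Y₁ Z₁).hom ≫ X₁ ◁ (β_ Y₁ Z₁).hom ≫ (α_ X₁ Z₁ Y₁).inv) ⊗ₘ
          ((α_ X₂ Y₂ Z₂).hom ≫ X₂ ◁ (β_ Y₂ Z₂).hom ≫ (α_ X₂ Z₂ Y₂).inv)) =
      (α_ (X₁ ⊗ X₂) (Y₁ ⊗ Y₂) (Z₁ ⊗ Z₂)).hom ≫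
          (X₁ ⊗ X₂) ◁ (β_ (Y₁ ⊗ Y₂) (Z₁ ⊗ Z₂)).hom ≫
            (α_ (X₁ ⊗ X₂) (Z₁ ⊗ Z₂) (Y₁ ⊗ Y₂)).inv ≫
        (tensorμ X₁ X₂ Z₁ Z₂ ▷ (Y₁ ⊗ Y₂)) ≫ tensorμ (X₁ ⊗ Z₁) (X₂ ⊗ Z₂) Y₁ Y₂ := by
  have h := tensor_associativity X₁ X₂ Z₁ Z₂ Y₁ Y₂
  rw [← cancel_mono ((α_ X₁ Z₁ Y₁).hom ⊗ₘ (α_ X₂ Z₂ Y₂).hom)]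
  simp only [Category.assoc, h, tensorHom_comp_tensorHom, Iso.inv_hom_id, Category.comp_id, Iso.inv_hom_id_assoc]
  rw [← tensorHom_comp_tensorHom, tensor_associativity_assoc, ← tensorμ_natural_right,
   ← MonoidalCategory.whiskerLeft_comp_assoc,← MonoidalCategory.whiskerLeft_comp_assoc, tensorμ_braiding]

namespace OperadData

/-- The Hadamard tensor product, on operations. -/
abbrev hadamard (P : OperadData.{u₁} E) (Q : OperadData.{u₂} E) : OperadData.{max u₁ u₂} E where
  Ob := P.Ob × Q.Ob
  ops c d := P.ops (fun j => (c j).1) d.1 ⊗ Q.ops (fun j => (c j).2) d.2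
  act e h d :=
    P.act e (fun j => congrArg Prod.fst (h j)) d.1 ⊗ₘ Q.act e (fun j => congrArg Prod.snd (h j)) d.2
  unit x := (λ_ (𝟙_ E)).inv ≫ (P.unit x.1 ⊗ₘ Q.unit x.2)
  comp h d := tensorμ _ _ _ _ ≫ (P.comp (h.map Prod.fst) d.1 ⊗ₘ Q.comp (h.map Prod.snd) d.2)

/-- The Hadamard tensor product of maps. -/
abbrev Map.hadamard {P : OperadData.{u₁} E} {P' : OperadData.{u₂} E} {Q : OperadData.{u₃} E}
    {Q' : OperadData.{u₄} E} (f : P.Map P') (g : Q.Map Q') :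
    (P.hadamard Q).Map (P'.hadamard Q') where
  obj x := (f.obj x.1, g.obj x.2)
  map c d := f.map (fun j => (c j).1) d.1 ⊗ₘ g.map (fun j => (c j).2) d.2

lemma Map.IsMorphism.hadamard {P : OperadData.{u₁} E} {P' : OperadData.{u₂} E}
    {Q : OperadData.{u₃} E} {Q' : OperadData.{u₄} E} {f : P.Map P'} {g : Q.Map Q'}
    (hf : f.IsMorphism) (hg : g.IsMorphism) : (f.hadamard g).IsMorphism where
  act_map e h d := by
    dsimp only
    rw [tensorHom_comp_tensorHom, tensorHom_comp_tensorHom, hf.act_map, hg.act_map]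
  unit_map x := by
    dsimp only
    rw [Category.assoc, tensorHom_comp_tensorHom, hf.unit_map, hg.unit_map]
  comp_map h d := by
    dsimp only
    rw [Category.assoc, tensorHom_comp_tensorHom, hf.comp_map, hg.comp_map, tensorμ_natural_assoc,
      tensorHom_comp_tensorHom]

variable (E) in
/-- The operad `uCom` of unital commutative algebras, on operations. -/
abbrev uCom : OperadData.{u} E where
  Ob := PUnit
  ops _ _ := 𝟙_ E
  act _ _ _ := 𝟙 _
  unit _ := 𝟙 _
  comp _ _ := (λ_ (𝟙_ E)).hom

end OperadData

namespace Operad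

/-- The Hadamard tensor product of two operads. -/
abbrev hadamard (P : Operad.{u₁} E) (Q : Operad.{u₂} E) : Operad.{max u₁ u₂} E where
  toOperadData := P.toOperadData.hadamard Q.toOperadData
  act_refl c d := by
    dsimp only
    rw [P.act_refl, Q.act_refl, id_tensorHom_id]
  act_trans e e' h h' h'' d := by
    dsimp only
    rw [tensorHom_comp_tensorHom, P.act_trans, Q.act_trans]
  unit_comp c x h := by
    dsimp only
    rw [comp_whiskerRight_assoc, tensorμ_natural_left_assoc, tensorHom_comp_tensorHom,
      P.unit_comp, Q.unit_comp, tensor_left_unitality]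
  comp_unit c i x d h := by
    dsimp only
    rw [MonoidalCategory.whiskerLeft_comp_assoc, tensorμ_natural_right_assoc,
      tensorHom_comp_tensorHom, P.comp_unit, Q.comp_unit, tensor_right_unitality]
  comp_assoc d hp h₁ h₂ h₃ h₄ := by
    dsimp only
    rw [comp_whiskerRight_assoc, tensorμ_natural_left_assoc, tensorHom_comp_tensorHom,
      P.comp_assoc d.1 hp (h₁.map Prod.fst) (h₂.map Prod.fst) (h₃.map Prod.fst) (h₄.map Prod.fst),
      Q.comp_assoc d.2 hp (h₁.map Prod.snd) (h₂.map Prod.snd) (h₃.map Prod.snd) (h₄.map Prod.snd),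
      ← tensorHom_comp_tensorHom, ← tensorHom_comp_tensorHom,
      MonoidalCategory.whiskerLeft_comp_assoc, tensorμ_natural_right_assoc,
      tensor_associativity_assoc, tensorHom_comp_tensorHom]
  comp_comm d hp hq h₁ h₂ h₃ h₄ := by
    dsimp only
    rw [comp_whiskerRight_assoc, tensorμ_natural_left_assoc, tensorHom_comp_tensorHom,
      P.comp_comm d.1 hp hq (h₁.map Prod.fst) (h₂.map Prod.fst) (h₃.map Prod.fst)
        (h₄.map Prod.fst),
      Q.comp_comm d.2 hp hq (h₁.map Prod.snd) (h₂.map Prod.snd) (h₃.map Prod.snd)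
        (h₄.map Prod.snd),
      comp_whiskerRight_assoc, tensorμ_natural_left_assoc, tensorHom_comp_tensorHom]
    have := tensorμ_swap (E := E)
    simp only [← Category.assoc, ← tensorHom_comp_tensorHom] at this ⊢
    rw [this]
  act_comp d σ τ ρ hs hσ hτ hρ h h' := by
    dsimp only
    rw [tensorμ_natural_assoc, tensorHom_comp_tensorHom, Category.assoc, tensorHom_comp_tensorHom,
      P.act_comp d.1 σ τ ρ hs _ _ (fun j => congrArg Prod.fst (hρ j)) (h.map Prod.fst),
      Q.act_comp d.2 σ τ ρ hs _ _ (fun j => congrArg Prod.snd (hρ j)) (h.map Prod.snd)]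

variable (E) in
/-- The operad `uCom` of unital commutative algebras. -/
abbrev uCom : Operad.{u} E where
  toOperadData := OperadData.uCom E
  act_refl _ _ := rfl
  act_trans _ _ _ _ _ _ := Category.id_comp _
  unit_comp _ _ _ := by simp
  comp_unit _ _ _ _ _ := by simp [unitors_equal]
  comp_assoc _ _ _ _ _ _ := by simp [unitors_equal]
  comp_comm _ _ _ _ _ _ _ := by
    dsimp only
    rw [braiding_tensorUnit_left]
    simp [unitors_equal]
  act_comp _ _ _ _ _ _ _ _ _ _ := by simp

end Operad

/-- An invertible map of operads. -/
abbrev Operad.mkIso {P Q : Operad.{u} E} (f : P.toOperadData.Hom Q.toOperadData)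
    (g : Q.toOperadData.Hom P.toOperadData)
    (h : f.comp g = OperadData.Hom.id P.toOperadData)
    (h' : g.comp f = OperadData.Hom.id Q.toOperadData) : P ≅ Q where
  hom := f
  inv := g
  hom_inv_id := h
  inv_hom_id := h'

lemma assoc_unit {A B D : E} (a : 𝟙_ E ⟶ A) (b : 𝟙_ E ⟶ B) (d : 𝟙_ E ⟶ D) :
    ((λ_ (𝟙_ E)).inv ≫ ((λ_ (𝟙_ E)).inv ≫ (a ⊗ₘ b) ⊗ₘ d)) ≫ (α_ A B D).hom =
      (λ_ (𝟙_ E)).inv ≫ (a ⊗ₘ (λ_ (𝟙_ E)).inv ≫ (b ⊗ₘ d)) := by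
  have h : (λ_ (𝟙_ E)).inv ≫ (λ_ (𝟙_ E)).inv ▷ 𝟙_ E ≫ (α_ _ _ _).hom =
    (λ_ (𝟙_ E)).inv ≫ 𝟙_ E ◁ (λ_ (𝟙_ E)).inv := by monoidal
  have h₁ : (λ_ (𝟙_ E)).inv ≫ (a ⊗ₘ b) ⊗ₘ d = (λ_ (𝟙_ E)).inv ▷ 𝟙_ E ≫ ((a ⊗ₘ b) ⊗ₘ d) := by
    rw [← tensorHom_id, tensorHom_comp_tensorHom, Category.id_comp]
  have h₂ : a ⊗ₘ (λ_ (𝟙_ E)).inv ≫ (b ⊗ₘ d) = 𝟙_ E ◁ (λ_ (𝟙_ E)).inv ≫ (a ⊗ₘ (b ⊗ₘ d)) := by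
    rw [← id_tensorHom, tensorHom_comp_tensorHom, Category.id_comp]
  rw [h₁, h₂, Category.assoc, Category.assoc, associator_naturality, ← Category.assoc (_ ▷ _),
    ← Category.assoc, h, Category.assoc]

lemma assoc_comp {X₁ X₂ X₃ Y₁ Y₂ Y₃ A B D : E} (a : X₁ ⊗ Y₁ ⟶ A) (b : X₂ ⊗ Y₂ ⟶ B)
    (d : X₃ ⊗ Y₃ ⟶ D) :
    (tensorμ (X₁ ⊗ X₂) X₃ (Y₁ ⊗ Y₂) Y₃ ≫ (tensorμ X₁ X₂ Y₁ Y₂ ≫ (a ⊗ₘ b) ⊗ₘ d)) ≫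
      (α_ A B D).hom =
    ((α_ X₁ X₂ X₃).hom ⊗ₘ (α_ Y₁ Y₂ Y₃).hom) ≫ tensorμ X₁ (X₂ ⊗ X₃) Y₁ (Y₂ ⊗ Y₃) ≫
      (a ⊗ₘ tensorμ X₂ X₃ Y₂ Y₃ ≫ (b ⊗ₘ d)) := by
  have h₁ : tensorμ X₁ X₂ Y₁ Y₂ ≫ (a ⊗ₘ b) ⊗ₘ d =
      tensorμ X₁ X₂ Y₁ Y₂ ▷ (X₃ ⊗ Y₃) ≫ ((a ⊗ₘ b) ⊗ₘ d) := by
    rw [← tensorHom_id, tensorHom_comp_tensorHom, Category.id_comp]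
  have h₂ : a ⊗ₘ tensorμ X₂ X₃ Y₂ Y₃ ≫ (b ⊗ₘ d) =
      (X₁ ⊗ Y₁) ◁ tensorμ X₂ X₃ Y₂ Y₃ ≫ (a ⊗ₘ (b ⊗ₘ d)) := by
    rw [← id_tensorHom, tensorHom_comp_tensorHom, Category.id_comp]
  rw [h₁, h₂, Category.assoc, Category.assoc, associator_naturality, associator_monoidal_assoc]

lemma leftUnitor_comp {X Y A : E} (a : X ⊗ Y ⟶ A) :
    (tensorμ (𝟙_ E) X (𝟙_ E) Y ≫ ((λ_ (𝟙_ E)).hom ⊗ₘ a)) ≫ (λ_ A).hom =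
      ((λ_ X).hom ⊗ₘ (λ_ Y).hom) ≫ a := by
  rw [leftUnitor_monoidal, Category.assoc, MonoidalCategory.tensorHom_def, Category.assoc, leftUnitor_naturality]
  simp only [Category.assoc]

lemma rightUnitor_comp {X Y A : E} (a : X ⊗ Y ⟶ A) :
    (tensorμ X (𝟙_ E) Y (𝟙_ E) ≫ (a ⊗ₘ (λ_ (𝟙_ E)).hom)) ≫ (ρ_ A).hom =
      ((ρ_ X).hom ⊗ₘ (ρ_ Y).hom) ≫ a := by
  rw [rightUnitor_monoidal, Category.assoc, MonoidalCategory.tensorHom_def', Category.assoc, rightUnitor_naturality]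
  simp only [Category.assoc]

lemma braiding_comp {X₁ X₂ Y₁ Y₂ A B : E} (a : X₁ ⊗ Y₁ ⟶ A) (b : X₂ ⊗ Y₂ ⟶ B) :
    (tensorμ X₁ X₂ Y₁ Y₂ ≫ (a ⊗ₘ b)) ≫ (β_ A B).hom =
      ((β_ X₁ X₂).hom ⊗ₘ (β_ Y₁ Y₂).hom) ≫ tensorμ X₂ X₁ Y₂ Y₁ ≫ (b ⊗ₘ a) := by
  rw [Category.assoc, BraidedCategory.braiding_naturality, ← Category.assoc, ← Category.assoc]
  congr 1
  simp [tensorμ, SymmetricCategory.braiding_swap_eq_inv_braiding Y₁ X₂, MonoidalCategory.tensorHom_def]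

lemma inv_of_hom {X X' Y Y' Z Z' : E} (f : X ≅ X') (g : Y ≅ Y') (h : Z ≅ Z') {m : X ⊗ Y ⟶ Z}
    {m' : X' ⊗ Y' ⟶ Z'} (H : m ≫ h.hom = (f.hom ⊗ₘ g.hom) ≫ m') :
    m' ≫ h.inv = (f.inv ⊗ₘ g.inv) ≫ m := by
  rw [Iso.comp_inv_eq, Category.assoc, H, tensorHom_comp_tensorHom_assoc]
  simp

lemma pentagon_tensorHom (W X Y Z : E) :
    ((α_ W X Y).hom ⊗ₘ 𝟙 Z) ≫ (α_ W (X ⊗ Y) Z).hom ≫ (𝟙 W ⊗ₘ (α_ X Y Z).hom) =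
      (α_ (W ⊗ X) Y Z).hom ≫ (α_ W X (Y ⊗ Z)).hom := by
  simp

lemma triangle_tensorHom (X Y : E) :
    (α_ X (𝟙_ E) Y).hom ≫ (𝟙 X ⊗ₘ (λ_ Y).hom) = (ρ_ X).hom ⊗ₘ 𝟙 Y := by
  simp

lemma hexagon_forward_tensorHom (X Y Z : E) :
    (α_ X Y Z).hom ≫ (β_ X (Y ⊗ Z)).hom ≫ (α_ Y Z X).hom =
      ((β_ X Y).hom ⊗ₘ 𝟙 Z) ≫ (α_ Y X Z).hom ≫ (𝟙 Y ⊗ₘ (β_ X Z).hom) := by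
  simp

lemma hexagon_reverse_tensorHom (X Y Z : E) :
    (α_ X Y Z).inv ≫ (β_ (X ⊗ Y) Z).hom ≫ (α_ Z X Y).inv =
      (𝟙 X ⊗ₘ (β_ Y Z).hom) ≫ (α_ X Z Y).inv ≫ ((β_ X Z).hom ⊗ₘ 𝟙 Y) := by
  simp

/-- The Hadamard tensor product as a symmetric monoidal structure on the category of operads, with
structure isomorphisms given by those of sets and of `E`. -/
instance : MonoidalCategoryStruct (Operad.{u} E) where
  tensorObj P Q := P.hadamard Q
  tensorUnit := Operad.uCom E
  tensorHom {P P' Q Q'} f g :=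
    (⟨OperadData.Map.hadamard (OperadData.Hom.toMap f) (OperadData.Hom.toMap g),
      (OperadData.Hom.isMorphism f).hadamard (OperadData.Hom.isMorphism g)⟩ :
      OperadData.Hom (P.hadamard Q).toOperadData (P'.hadamard Q').toOperadData)
  whiskerLeft P Q Q' g :=
    (⟨OperadData.Map.hadamard (OperadData.Hom.toMap (𝟙 P)) (OperadData.Hom.toMap g),
      (OperadData.Hom.isMorphism (𝟙 P)).hadamard (OperadData.Hom.isMorphism g)⟩ :
      OperadData.Hom (P.hadamard Q).toOperadData (P.hadamard Q').toOperadData)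
  whiskerRight {P P'} f Q :=
    (⟨OperadData.Map.hadamard (OperadData.Hom.toMap f) (OperadData.Hom.toMap (𝟙 Q)),
      (OperadData.Hom.isMorphism f).hadamard (OperadData.Hom.isMorphism (𝟙 Q))⟩ :
      OperadData.Hom (P.hadamard Q).toOperadData (P'.hadamard Q).toOperadData)
  associator P Q R := Operad.mkIso
    (P := (P.hadamard Q).hadamard R) (Q := P.hadamard (Q.hadamard R))
    { obj := fun x => (x.1.1, x.1.2, x.2)
      map := fun c d => (α_ _ _ _).hom
      isMorphism :=
        { act_map := fun _ _ _ => associator_naturality _ _ _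
          unit_map := fun _ => assoc_unit _ _ _
          comp_map := fun _ _ => assoc_comp _ _ _ } }
    { obj := fun x => ((x.1, x.2.1), x.2.2)
      map := fun c d => (α_ _ _ _).inv
      isMorphism :=
        { act_map := fun _ _ _ => associator_inv_naturality _ _ _
          unit_map := fun _ => (Iso.comp_inv_eq _).2 (assoc_unit _ _ _).symm
          comp_map := fun _ _ => inv_of_hom (α_ _ _ _) (α_ _ _ _) (α_ _ _ _) (assoc_comp _ _ _) } }
    (OperadData.Hom.ext_map _ _ (fun x => x) _ _ rfl rfl fun _ _ _ => Iso.hom_inv_id _)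
    (OperadData.Hom.ext_map _ _ (fun x => x) _ _ rfl rfl fun _ _ _ => Iso.inv_hom_id _)
  leftUnitor P := Operad.mkIso
    (P := (Operad.uCom E).hadamard P) (Q := P)
    { obj := fun x => x.2
      map := fun c d => (λ_ _).hom
      isMorphism :=
        { act_map := fun _ _ _ =>
            (congrArg (· ≫ _) (id_tensorHom _ _)).trans (leftUnitor_naturality _)
          unit_map := fun _ => by
            dsimp only
            simp
          comp_map := fun _ _ => leftUnitor_comp _ } }
    { obj := fun x => (⟨⟩, x)
      map := fun c d => (λ_ _).inv
      isMorphism :=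
        { act_map := fun _ _ _ =>
            (leftUnitor_inv_naturality _).trans (congrArg (_ ≫ ·) (id_tensorHom _ _).symm)
          unit_map := fun _ => by
            dsimp only
            simp
          comp_map := fun _ _ => inv_of_hom (λ_ _) (λ_ _) (λ_ _) (leftUnitor_comp _) } }
    (OperadData.Hom.ext_map _ _ (fun x => x) _ _ rfl rfl fun _ _ _ => Iso.hom_inv_id _)
    (OperadData.Hom.ext_map _ _ (fun x => x) _ _ rfl rfl fun _ _ _ => Iso.inv_hom_id _)
  rightUnitor P := Operad.mkIso
    (P := P.hadamard (Operad.uCom E)) (Q := P)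
    { obj := fun x => x.1
      map := fun c d => (ρ_ _).hom
      isMorphism :=
        { act_map := fun _ _ _ =>
            (congrArg (· ≫ _) (tensorHom_id _ _)).trans (rightUnitor_naturality _)
          unit_map := fun _ => by
            dsimp only
            simp [← unitors_equal]
          comp_map := fun _ _ => rightUnitor_comp _ } }
    { obj := fun x => (x, ⟨⟩)
      map := fun c d => (ρ_ _).inv
      isMorphism :=
        { act_map := fun _ _ _ =>
            (rightUnitor_inv_naturality _).trans (congrArg (_ ≫ ·) (tensorHom_id _ _).symm)
          unit_map := fun _ => by
            dsimp only
            simp [← unitors_equal]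
          comp_map := fun _ _ => inv_of_hom (ρ_ _) (ρ_ _) (ρ_ _) (rightUnitor_comp _) } }
    (OperadData.Hom.ext_map _ _ (fun x => x) _ _ rfl rfl fun _ _ _ => Iso.hom_inv_id _)
    (OperadData.Hom.ext_map _ _ (fun x => x) _ _ rfl rfl fun _ _ _ => Iso.inv_hom_id _)

instance : MonoidalCategory (Operad.{u} E) := MonoidalCategory.ofTensorHom
  (id_tensorHom_id := fun P Q => OperadData.Hom.ext_map _ _ (fun x => x) _ _ rfl rfl
    fun _ _ _ => MonoidalCategory.id_tensorHom_id _ _)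
  (id_tensorHom := fun _ _ _ _ => rfl)
  (tensorHom_id := fun _ _ => rfl)
  (tensorHom_comp_tensorHom := fun _ _ _ _ => OperadData.Hom.ext_map _ _ _ _ _ rfl rfl
    fun _ _ _ => MonoidalCategory.tensorHom_comp_tensorHom _ _ _ _)
  (associator_naturality := fun _ _ _ => OperadData.Hom.ext_map _ _ _ _ _ rfl rfl
    fun _ _ _ => MonoidalCategory.associator_naturality _ _ _)
  (leftUnitor_naturality := fun _ => OperadData.Hom.ext_map _ _ _ _ _ rfl rfl
    fun _ _ _ => by
      exact (congrArg (· ≫ _) (MonoidalCategory.id_tensorHom _ _)).trans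
        (MonoidalCategory.leftUnitor_naturality _))
  (rightUnitor_naturality := fun _ => OperadData.Hom.ext_map _ _ _ _ _ rfl rfl
    fun _ _ _ => by
      exact (congrArg (· ≫ _) (MonoidalCategory.tensorHom_id _ _)).trans
        (MonoidalCategory.rightUnitor_naturality _))
  (pentagon := fun _ _ _ _ => OperadData.Hom.ext_map _ _ _ _ _ rfl rfl
    fun _ _ _ => pentagon_tensorHom (E := E) _ _ _ _)
  (triangle := fun _ _ => OperadData.Hom.ext_map _ _ _ _ _ rfl rfl
    fun _ _ _ => triangle_tensorHom (E := E) _ _)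

instance : SymmetricCategory (Operad.{u} E) where
  braiding P Q := Operad.mkIso
    (P := P.hadamard Q) (Q := Q.hadamard P)
    { obj := fun x => (x.2, x.1)
      map := fun c d => (β_ _ _).hom
      isMorphism :=
        { act_map := fun _ _ _ => BraidedCategory.braiding_naturality _ _
          unit_map := fun _ => by
            dsimp only
            simp [← unitors_equal]
          comp_map := fun _ _ => braiding_comp _ _ } }
    { obj := fun x => (x.2, x.1)
      map := fun c d => (β_ _ _).hom
      isMorphism :=
        { act_map := fun _ _ _ => BraidedCategory.braiding_naturality _ _
          unit_map := fun _ => by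
            dsimp only
            simp [← unitors_equal]
          comp_map := fun _ _ => braiding_comp _ _ } }
    (OperadData.Hom.ext_map _ _ (fun x => x) _ _ rfl rfl
      fun _ _ _ => SymmetricCategory.symmetry _ _)
    (OperadData.Hom.ext_map _ _ (fun x => x) _ _ rfl rfl
      fun _ _ _ => SymmetricCategory.symmetry _ _)
  braiding_naturality_right _ _ _ _ := OperadData.Hom.ext_map _ _ _ _ _ rfl rfl
    fun _ _ _ => BraidedCategory.braiding_naturality _ _
  braiding_naturality_left _ _ := OperadData.Hom.ext_map _ _ _ _ _ rfl rfl
    fun _ _ _ => BraidedCategory.braiding_naturality _ _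
  hexagon_forward _ _ _ := OperadData.Hom.ext_map _ _ _ _ _ rfl rfl
    fun _ _ _ => hexagon_forward_tensorHom (E := E) _ _ _
  hexagon_reverse _ _ _ := OperadData.Hom.ext_map _ _ _ _ _ rfl rfl
    fun _ _ _ => hexagon_reverse_tensorHom (E := E) _ _ _
  symmetry _ _ := OperadData.Hom.ext_map _ _ (fun x => x) _ _ rfl rfl
    fun _ _ _ => SymmetricCategory.symmetry _ _

end Operads

/-! ### Symmetric monoidal enriched categories -/

/-- A symmetric monoidal category enriched over `E`: an enriched category `C` whose underlying
category is symmetric monoidal, with an enriched refinement of the tensor product, for which the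
associator, the unitors and the braiding are enriched natural. -/
class SymmetricMonoidalEnriched (E : Type w) [Category.{v} E] [MonoidalCategory E]
    [SymmetricCategory E] (C : Type w') [Category.{v'} C] [MonoidalCategory C]
    [SymmetricCategory C] [EnrichedOrdinaryCategory E C] where
  /-- the tensor product on hom-objects -/
  eTensor (E) (x x' y y' : C) : (x ⟶[E] x') ⊗ (y ⟶[E] y') ⟶ ((x ⊗ y : C) ⟶[E] (x' ⊗ y' : C))
  eTensor_id (x y : C) :
    (λ_ (𝟙_ E)).inv ≫ (eId E x ⊗ₘ eId E y) ≫ eTensor x x y y = eId E (x ⊗ y)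
  eTensor_comp (x x' x'' y y' y'' : C) :
    (eTensor x x' y y' ⊗ₘ eTensor x' x'' y' y'') ≫ eComp E (x ⊗ y) (x' ⊗ y') (x'' ⊗ y'') =
      tensorμ (x ⟶[E] x') (y ⟶[E] y') (x' ⟶[E] x'') (y' ⟶[E] y'') ≫
        (eComp E x x' x'' ⊗ₘ eComp E y y' y'') ≫ eTensor x x'' y y''
  /-- the underlying functor of the enriched tensor product is the tensor product of `C` -/
  eHomEquiv_tensorHom {x x' y y' : C} (f : x ⟶ x') (g : y ⟶ y') :
    eHomEquiv E (f ⊗ₘ g) =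
      (λ_ (𝟙_ E)).inv ≫ (eHomEquiv E f ⊗ₘ eHomEquiv E g) ≫ eTensor x x' y y'
  associator_enatural (x x' y y' z z' : C) :
    eTensor x x' y y' ▷ (z ⟶[E] z') ≫ eTensor (x ⊗ y) (x' ⊗ y') z z' ≫
        eHomWhiskerLeft E ((x ⊗ y) ⊗ z) (α_ x' y' z').hom =
      (α_ (x ⟶[E] x') (y ⟶[E] y') (z ⟶[E] z')).hom ≫ (x ⟶[E] x') ◁ eTensor y y' z z' ≫
        eTensor x x' (y ⊗ z) (y' ⊗ z') ≫ eHomWhiskerRight E (α_ x y z).hom (x' ⊗ y' ⊗ z')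
  leftUnitor_enatural (x x' : C) :
    eId E (𝟙_ C) ▷ (x ⟶[E] x') ≫ eTensor (𝟙_ C) (𝟙_ C) x x' ≫
        eHomWhiskerLeft E (𝟙_ C ⊗ x) (λ_ x').hom =
      (λ_ (x ⟶[E] x')).hom ≫ eHomWhiskerRight E (λ_ x).hom x'
  rightUnitor_enatural (x x' : C) :
    (x ⟶[E] x') ◁ eId E (𝟙_ C) ≫ eTensor x x' (𝟙_ C) (𝟙_ C) ≫
        eHomWhiskerLeft E (x ⊗ 𝟙_ C) (ρ_ x').hom =
      (ρ_ (x ⟶[E] x')).hom ≫ eHomWhiskerRight E (ρ_ x).hom x'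
  braiding_enatural (x x' y y' : C) :
    eTensor x x' y y' ≫ eHomWhiskerLeft E (x ⊗ y) (β_ x' y').hom =
      (β_ (x ⟶[E] x') (y ⟶[E] y')).hom ≫ eTensor y y' x x' ≫
        eHomWhiskerRight E (β_ x y).hom (y' ⊗ x')

open SymmetricMonoidalEnriched (eTensor)

section Opposite

variable {E : Type w} [Category.{v} E] [MonoidalCategory E] [SymmetricCategory E]
  {C : Type w'} [Category.{v'} C] [EnrichedOrdinaryCategory E C]

lemma eHomWhiskerRight_op {x x' : Cᵒᵖ} (f : x ⟶ x') (y : Cᵒᵖ) :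
    eHomWhiskerRight E f y = eHomWhiskerLeft E y.unop f.unop := by
  change (λ_ (y.unop ⟶[E] x'.unop)).inv ≫ eHomEquiv E f.unop ▷ (y.unop ⟶[E] x'.unop) ≫
    (β_ (x'.unop ⟶[E] x.unop) (y.unop ⟶[E] x'.unop)).hom ≫
      eComp E y.unop x'.unop x.unop = _
  rw [BraidedCategory.braiding_naturality_left_assoc, eHomWhiskerLeft,
    braiding_tensorUnit_left]
  simp

lemma eHomWhiskerLeft_op (x : Cᵒᵖ) {y y' : Cᵒᵖ} (f : y ⟶ y') :
    eHomWhiskerLeft E x f = eHomWhiskerRight E f.unop x.unop := by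
  change (ρ_ (y.unop ⟶[E] x.unop)).inv ≫ (y.unop ⟶[E] x.unop) ◁ eHomEquiv E f.unop ≫
    (β_ (y.unop ⟶[E] x.unop) (y'.unop ⟶[E] y.unop)).hom ≫
      eComp E y'.unop y.unop x.unop = _
  rw [BraidedCategory.braiding_naturality_right_assoc, eHomWhiskerRight,
    braiding_tensorUnit_right]
  simp

variable [MonoidalCategory C] [SymmetricCategory C] [SymmetricMonoidalEnriched E C]

instance : SymmetricCategory Cᵒᵖ where
  symmetry _ _ := Quiver.Hom.unop_inj (SymmetricCategory.symmetry _ _)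

/-- The opposite of a symmetric monoidal enriched category. -/
instance : SymmetricMonoidalEnriched E Cᵒᵖ where
  eTensor x x' y y' := eTensor E x'.unop x.unop y'.unop y.unop
  eTensor_id x y := SymmetricMonoidalEnriched.eTensor_id x.unop y.unop
  eTensor_comp x x' x'' y y' y'' := by
    change (eTensor E x'.unop x.unop y'.unop y.unop ⊗ₘ
        eTensor E x''.unop x'.unop y''.unop y'.unop) ≫ (β_ _ _).hom ≫
          eComp E (x''.unop ⊗ y''.unop) (x'.unop ⊗ y'.unop) (x.unop ⊗ y.unop) =
      tensorμ _ _ _ _ ≫ ((β_ _ _).hom ≫ eComp E x''.unop x'.unop x.unop ⊗ₘ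
        (β_ _ _).hom ≫ eComp E y''.unop y'.unop y.unop) ≫
          eTensor E x''.unop x.unop y''.unop y.unop
    rw [BraidedCategory.braiding_naturality_assoc, SymmetricMonoidalEnriched.eTensor_comp,
      ← tensorHom_comp_tensorHom, Category.assoc, tensorμ_braiding_assoc]
  eHomEquiv_tensorHom f g := SymmetricMonoidalEnriched.eHomEquiv_tensorHom f.unop g.unop
  associator_enatural x x' y y' z z' := by
    rw [eHomWhiskerLeft_op, eHomWhiskerRight_op]
    have h := SymmetricMonoidalEnriched.associator_enatural (E := E) x'.unop x.unop y'.unop y.unop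
      z'.unop z.unop
    have h' := congrArg (· ≫ eHomWhiskerRight E (α_ x'.unop y'.unop z'.unop).inv _ ≫
      eHomWhiskerLeft E _ (α_ x.unop y.unop z.unop).inv) h
    simp only [Category.assoc] at h'
    rw [← eHom_whisker_exchange, ← eHomWhiskerLeft_comp_assoc, Iso.hom_inv_id,
      eHomWhiskerLeft_id, Category.id_comp, eHom_whisker_exchange,
      ← eHomWhiskerRight_comp_assoc, Iso.inv_hom_id, eHomWhiskerRight_id, Category.id_comp] at h'
    exact h'
  leftUnitor_enatural x x' := by
    rw [eHomWhiskerLeft_op, eHomWhiskerRight_op]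
    have h := SymmetricMonoidalEnriched.leftUnitor_enatural (E := E) x'.unop x.unop
    have h' := congrArg (· ≫ eHomWhiskerRight E (λ_ x'.unop).inv _ ≫
      eHomWhiskerLeft E _ (λ_ x.unop).inv) h
    simp only [Category.assoc] at h'
    rw [← eHom_whisker_exchange, ← eHomWhiskerLeft_comp_assoc, Iso.hom_inv_id,
      eHomWhiskerLeft_id, Category.id_comp, eHom_whisker_exchange,
      ← eHomWhiskerRight_comp_assoc, Iso.inv_hom_id, eHomWhiskerRight_id, Category.id_comp] at h'
    exact h'
  rightUnitor_enatural x x' := by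
    rw [eHomWhiskerLeft_op, eHomWhiskerRight_op]
    have h := SymmetricMonoidalEnriched.rightUnitor_enatural (E := E) x'.unop x.unop
    have h' := congrArg (· ≫ eHomWhiskerRight E (ρ_ x'.unop).inv _ ≫
      eHomWhiskerLeft E _ (ρ_ x.unop).inv) h
    simp only [Category.assoc] at h'
    rw [← eHom_whisker_exchange, ← eHomWhiskerLeft_comp_assoc, Iso.hom_inv_id,
      eHomWhiskerLeft_id, Category.id_comp, eHom_whisker_exchange,
      ← eHomWhiskerRight_comp_assoc, Iso.inv_hom_id, eHomWhiskerRight_id, Category.id_comp] at h'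
    exact h'
  braiding_enatural x x' y y' := by
    rw [eHomWhiskerLeft_op, eHomWhiskerRight_op]
    have h := SymmetricMonoidalEnriched.braiding_enatural (E := E) y'.unop y.unop x'.unop x.unop
    have h' := congrArg (fun f => (β_ (x'.unop ⟶[E] x.unop) (y'.unop ⟶[E] y.unop)).hom ≫ f) h
    rw [SymmetricCategory.symmetry_assoc] at h'
    exact h'.symm

end Opposite

/-! ### Iterated tensor products -/

section Tensor

set_option linter.unusedSectionVars false

variable {C : Type w'} [Category.{v'} C] [MonoidalCategory C]

/-- The iterated tensor product `x₀ ⊗ (x₁ ⊗ (⋯ ⊗ xₙ₋₁))`: the empty tensor product is the unit and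
the tensor product of one object `x` is `x`. -/
def tpow : {n : ℕ} → (Fin n → C) → C
  | 0, _ => 𝟙_ C
  | 1, x => x 0
  | _ + 2, x => x 0 ⊗ tpow (fun j => x j.succ)

/-- The canonical isomorphism `x₀ ⊗ (x₁ ⊗ ⋯ ⊗ xₙ) ≅ x₀ ⊗ x₁ ⊗ ⋯ ⊗ xₙ`. -/
def tcons : {n : ℕ} → (x : Fin (n + 1) → C) → (x 0 ⊗ tpow (fun j => x j.succ) ≅ tpow x)
  | 0, x => ρ_ (x 0)
  | _ + 1, _ => Iso.refl _

/-- The iterated tensor product of morphisms. -/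
def tpowMap : {n : ℕ} → {x y : Fin n → C} → (∀ j, x j ⟶ y j) → (tpow x ⟶ tpow y)
  | 0, _, _, _ => 𝟙 _
  | 1, _, _, f => f 0
  | _ + 2, _, _, f => f 0 ⊗ₘ tpowMap (fun j => f j.succ)

/-- Equal tuples have equal tensor products. -/
lemma tpow_congr {m n : ℕ} (h : m = n) {x : Fin m → C} {y : Fin n → C}
    (hxy : ∀ (j : Fin m) (k : Fin n), (j : ℕ) = k → x j = y k) : tpow x = tpow y := by
  subst h
  exact congrArg tpow (funext fun j => hxy j j rfl)

/-- The canonical isomorphism `(a₀ ⊗ ⋯ ⊗ aₘ₋₁) ⊗ (b₀ ⊗ ⋯ ⊗ bₙ₋₁) ≅ r₀ ⊗ ⋯ ⊗ rₘ₊ₙ₋₁`, where `r` is the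
concatenation of `a` and `b`, built from the associator and the left unitor. -/
def tappend : {m n k : ℕ} → (a : Fin m → C) → (b : Fin n → C) → (r : Fin k → C) → (k = m + n) →
    (∀ (l : Fin m) (p : Fin k), (p : ℕ) = l → r p = a l) →
    (∀ (l : Fin n) (p : Fin k), (p : ℕ) = m + l → r p = b l) → (tpow a ⊗ tpow b ≅ tpow r)
  | 0, n, k, _, b, r, h, _, hb =>
      λ_ (tpow b) ≪≫ eqToIso (tpow_congr (by omega) fun j p e => (hb j p (by omega)).symm)
  | m + 1, n, 0, _, _, _, h, _, _ => absurd h (by omega)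
  | m + 1, n, k + 1, a, b, r, h, ha, hb =>
      whiskerRightIso (tcons a).symm (tpow b) ≪≫ α_ (a 0) (tpow fun j => a j.succ) (tpow b) ≪≫
        (eqToIso (ha 0 0 rfl).symm ⊗ᵢ
          tappend (fun j => a j.succ) b (fun j => r j.succ) (by omega)
            (fun l p e => ha l.succ p.succ (by simp [e]))
            (fun l p e => hb l p.succ (by simp [e]; omega))) ≪≫ tcons r

variable [SymmetricCategory C]

/-- The isomorphism `xᵢ ⊗ (x₀ ⊗ ⋯ ⊗ xᵢ₋₁ ⊗ xᵢ₊₁ ⊗ ⋯ ⊗ xₙ) ≅ x₀ ⊗ ⋯ ⊗ xₙ` moving the object `xᵢ` to its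
place past `x₀, …, xᵢ₋₁`; here `y` is the tuple `x` without its `i`-th entry. -/
def tinsert : {n : ℕ} → (x : Fin (n + 1) → C) → (i : Fin (n + 1)) → (y : Fin n → C) →
    (∀ j, y j = x (i.succAbove j)) → (x i ⊗ tpow y ≅ tpow x)
  | _, x, ⟨0, _⟩, y, h =>
      whiskerLeftIso (x 0) (eqToIso (congrArg tpow (funext fun j => (h j).trans (by simp)))) ≪≫
        tcons x
  | 0, _, ⟨_ + 1, hi⟩, _, _ => absurd hi (by omega)
  | _ + 1, x, ⟨i + 1, hi⟩, y, h =>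
      whiskerLeftIso (x ⟨i + 1, hi⟩) (tcons y).symm ≪≫
        ((α_ _ _ _).symm ≪≫ whiskerRightIso (β_ (x ⟨i + 1, hi⟩) (y 0)) (tpow fun j => y j.succ) ≪≫
          α_ _ _ _) ≪≫
        (eqToIso ((h 0).trans (congrArg x (Fin.succ_succAbove_zero ⟨i, by omega⟩))) ⊗ᵢ
          tinsert (fun j => x j.succ) ⟨i, by omega⟩ (fun j => y j.succ) (fun j =>
            (h j.succ).trans (congrArg x (Fin.succ_succAbove_succ ⟨i, by omega⟩ j)))) ≪≫
        tcons x

/-- The bijection obtained from `e` by removing `0` from the source and `e 0` from the target. -/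
def tailEquiv {m n : ℕ} (e : Fin (m + 1) ≃ Fin (n + 1)) : Fin m ≃ Fin n :=
  Equiv.removeNone
    (((finSuccEquiv' (0 : Fin (m + 1))).symm.trans e).trans (finSuccEquiv' (e 0)))

lemma succAbove_tailEquiv {m n : ℕ} (e : Fin (m + 1) ≃ Fin (n + 1)) (j : Fin m) :
    (e 0).succAbove (tailEquiv e j) = e j.succ := by
  have h : some (tailEquiv e j) = finSuccEquiv' (e 0) (e j.succ) := by
    have hne : e j.succ ≠ e 0 := fun h => Fin.succ_ne_zero j (e.injective h)
    obtain ⟨k, hk⟩ := Fin.exists_succAbove_eq hne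
    rw [tailEquiv, Equiv.removeNone_some _ ⟨k, by simp [← hk]⟩]
    simp
  rw [← finSuccEquiv'_symm_some, h, Equiv.symm_apply_apply]

/-- The isomorphism `y₀ ⊗ ⋯ ⊗ yₙ₋₁ ≅ x₀ ⊗ ⋯ ⊗ xₙ₋₁` given by the symmetry of `C`, where
`yⱼ = x_{e(j)}` for a permutation `e`: the factors `y₁, …, yₙ₋₁` are permuted first, and then `y₀` is
moved to its place `e(0)`. -/
def tpermute : {m n : ℕ} → (y : Fin m → C) → (x : Fin n → C) → (e : Fin m ≃ Fin n) →
    (∀ j, y j = x (e j)) → (tpow y ≅ tpow x)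
  | 0, 0, _, _, _, _ => Iso.refl _
  | 0, _ + 1, _, _, e, _ => (e.symm 0).elim0
  | _ + 1, 0, _, _, e, _ => (e 0).elim0
  | _ + 1, _ + 1, y, x, e, h =>
      (tcons y).symm ≪≫
        (eqToIso (h 0) ⊗ᵢ
          tpermute (fun j => y j.succ) (fun j => x ((e 0).succAbove j)) (tailEquiv e)
            (fun j => (h j.succ).trans (congrArg x (succAbove_tailEquiv e j).symm))) ≪≫
        tinsert x (e 0) (fun j => x ((e 0).succAbove j)) (fun _ => rfl)

/-- The interchange `(x₀ ⊗ y₀) ⊗ ⋯ ⊗ (xₙ₋₁ ⊗ yₙ₋₁) ⟶ (x₀ ⊗ ⋯ ⊗ xₙ₋₁) ⊗ (y₀ ⊗ ⋯ ⊗ yₙ₋₁)`. -/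
def tshuffle : {n : ℕ} → (x y : Fin n → C) → (tpow (fun j => x j ⊗ y j) ⟶ tpow x ⊗ tpow y)
  | 0, _, _ => (λ_ (𝟙_ C)).inv
  | 1, _, _ => 𝟙 _
  | _ + 2, x, y =>
      (x 0 ⊗ y 0) ◁ tshuffle (fun j => x j.succ) (fun j => y j.succ) ≫ tensorμ (x 0) (y 0) _ _

variable (C) in
/-- The canonical map `𝟙 ⊗ ⋯ ⊗ 𝟙 ⟶ 𝟙`. -/
def tunit : (n : ℕ) → (tpow (fun _ : Fin n => 𝟙_ C) ⟶ 𝟙_ C)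
  | 0 => 𝟙 _
  | 1 => 𝟙 _
  | n + 2 => (λ_ _).hom ≫ tunit (n + 1)

lemma tpowMap_id : {n : ℕ} → (x : Fin n → C) → tpowMap (fun j => 𝟙 (x j)) = 𝟙 (tpow x)
  | 0, _ => rfl
  | 1, _ => rfl
  | _ + 2, x => (congrArg (𝟙 (x 0) ⊗ₘ ·) (tpowMap_id fun j => x j.succ)).trans
      (id_tensorHom_id _ _)

lemma tpowMap_comp : {n : ℕ} → {x y z : Fin n → C} → (f : ∀ j, x j ⟶ y j) → (g : ∀ j, y j ⟶ z j) →
    tpowMap (fun j => f j ≫ g j) = tpowMap f ≫ tpowMap g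
  | 0, _, _, _, _, _ => (Category.comp_id _).symm
  | 1, _, _, _, _, _ => rfl
  | _ + 2, _, _, _, f, g =>
      (congrArg (f 0 ≫ g 0 ⊗ₘ ·) (tpowMap_comp (fun j => f j.succ) (fun j => g j.succ))).trans
        (tensorHom_comp_tensorHom _ _ _ _).symm

end Tensor

/-! ### The endomorphism operad -/

section Endomorphisms

variable (E : Type w) [Category.{v} E] [MonoidalCategory E] [SymmetricCategory E]
  {C : Type w'} [Category.{v'} C] [MonoidalCategory C] [SymmetricCategory C]
  [EnrichedOrdinaryCategory E C] [SymmetricMonoidalEnriched E C]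

/-- The map `- ⊗ z` on hom-objects. -/
def eWhiskerRight (x y z : C) : (x ⟶[E] y) ⟶ ((x ⊗ z : C) ⟶[E] (y ⊗ z : C)) :=
  (ρ_ _).inv ≫ (x ⟶[E] y) ◁ eId E z ≫ eTensor E x y z z

/-- The map `z ⊗ -` on hom-objects. -/
def eWhiskerLeft (z x y : C) : (x ⟶[E] y) ⟶ ((z ⊗ x : C) ⟶[E] (z ⊗ y : C)) :=
  (λ_ _).inv ≫ eId E z ▷ (x ⟶[E] y) ≫ eTensor E z z x y

lemma IsInsertion.tail {X : Type u} {n m k i : ℕ} {hi : i + 1 < n + 1} {c : Fin (n + 1) → X} {x : X}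
    {c' : Fin m → X} {r : Fin (k + 1) → X} (h : IsInsertion c ⟨i + 1, hi⟩ x c' r) :
    IsInsertion (fun j => c j.succ) ⟨i, by omega⟩ x c' (fun j => r j.succ) where
  colour := h.colour
  length := by have := h.length; omega
  outer j p hp := h.outer j.succ p.succ (by
    simp only [OuterPos, Fin.val_succ] at hp ⊢
    omega)
  inner l p hp := h.inner l p.succ (by
    simp only [Fin.val_succ] at hp ⊢
    omega)

/-- The map `b ↦ id ⊗ ⋯ ⊗ id ⊗ b ⊗ id ⊗ ⋯ ⊗ id`, with `b : ⨂ c' ⟶ cᵢ` in position `i`, from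
`C(⨂ c', cᵢ)` to `C(⨂ (c ◁ᵢ c'), ⨂ c)`. -/
def tevalAt : {n m k : ℕ} → (c : Fin n → C) → (i : Fin n) → (x : C) → (c' : Fin m → C) →
    (r : Fin k → C) → IsInsertion c i x c' r → ((tpow c' ⟶[E] x) ⟶ (tpow r ⟶[E] tpow c))
  | 0, _, _, _, i, _, _, _, _ => i.elim0
  | _ + 1, _, _, c, ⟨0, _⟩, x, c', r, h =>
      eWhiskerRight E (tpow c') x (tpow fun j => c j.succ) ≫
        eHomWhiskerLeft E _ (eqToHom h.colour.symm ▷ (tpow fun j => c j.succ) ≫ (tcons c).hom) ≫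
        eHomWhiskerRight E
          (tappend c' (fun j => c j.succ) r (by have := h.length; omega)
            (fun l p e => h.inner l p (by simpa using e))
            (fun l p e => h.outer l.succ p (Or.inr ⟨by simp, by simp [e]; omega⟩))).inv _
  | n + 1, m, 0, _, ⟨_ + 1, _⟩, _, _, _, h => absurd h.length (by omega)
  | _ + 1, _, _ + 1, c, ⟨i + 1, hi⟩, x, c', r, h =>
      tevalAt (fun j => c j.succ) ⟨i, by omega⟩ x c' (fun j => r j.succ) h.tail ≫
        eWhiskerLeft E (c 0) _ _ ≫ eHomWhiskerLeft E _ (tcons c).hom ≫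
        eHomWhiskerRight E
          ((tcons r).inv ≫ eqToHom (h.outer 0 0 (Or.inl ⟨by simp, rfl⟩)) ▷ _) _

variable (C) in
/-- The endomorphism operad of a symmetric monoidal enriched category `C`: its colours are the
objects of `C`, and `End(C)(x₀, …, xₙ₋₁; x) = C(x₀ ⊗ ⋯ ⊗ xₙ₋₁, x)`. -/
abbrev EndOperad : OperadData.{w'} E where
  Ob := C
  ops c d := tpow c ⟶[E] d
  act {_ _ c c'} e h d := eHomWhiskerRight E (tpermute c c' e h).hom d
  unit x := eId E x
  comp {_ _ _ c i x c' r} h d :=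
    (β_ _ _).hom ≫ tevalAt E c i x c' r h ▷ (tpow c ⟶[E] d) ≫ eComp E (tpow r) (tpow c) d

variable (C) in
/-- The map `End(C) ⊗ End(C) ⟶ End(C)` induced by the tensor product of `C`. -/
abbrev endTensor : ((EndOperad E C).hadamard (EndOperad E C)).Map (EndOperad E C) where
  obj x := x.1 ⊗ x.2
  map c d := eTensor E _ _ _ _ ≫
    eHomWhiskerRight E (tshuffle (fun j => (c j).1) (fun j => (c j).2)) (d.1 ⊗ d.2)

variable (C) in
/-- The map `uCom ⟶ End(C)` giving the commutative algebra structure on the unit of `C`. -/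
abbrev endUnit : (OperadData.uCom.{u} E).Map (EndOperad E C) where
  obj _ := 𝟙_ C
  map {n} _ _ := eHomEquiv E (tunit C n)

/-! ### Algebras and coalgebras -/

variable {E}

variable (C) in
/-- `P`-algebras in `C` are morphisms of operads from `P` to `End(C)`. -/
abbrev Algebra (P : Operad.{u} E) := P.toOperadData.Hom (EndOperad E C)

/-- A morphism of `P`-algebras from `A` to `B` is a 2-morphism of operads, that is a family of
morphisms `A(x) ⟶ B(x)` of `C`, which commutes with the action of all operations of `P`. -/
@[ext]
structure Algebra.Hom {P : Operad.{u} E} (A B : Algebra C P) where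
  app : ∀ x : P.Ob, A.obj x ⟶ B.obj x
  naturality : ∀ {n : ℕ} (c : Fin n → P.Ob) (d : P.Ob),
    A.map c d ≫ eHomWhiskerLeft E (tpow fun j => A.obj (c j)) (app d) =
      B.map c d ≫ eHomWhiskerRight E (tpowMap fun j => app (c j)) (B.obj d)

/-- The category of `P`-algebras in `C`. -/
instance (P : Operad.{u} E) : Category (Algebra C P) where
  Hom A B := Algebra.Hom A B
  id A :=
    { app := fun _ => 𝟙 _
      naturality := fun c d => by
        rw [tpowMap_id, eHomWhiskerLeft_id, eHomWhiskerRight_id] }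
  comp f g :=
    { app := fun x => f.app x ≫ g.app x
      naturality := fun c d => by
        rw [tpowMap_comp, eHomWhiskerLeft_comp, eHomWhiskerRight_comp, ← Category.assoc,
          f.naturality, Category.assoc, ← eHom_whisker_exchange, ← Category.assoc, g.naturality,
          Category.assoc] }
  id_comp _ := Algebra.Hom.ext (funext fun _ => Category.id_comp _)
  comp_id _ := Algebra.Hom.ext (funext fun _ => Category.comp_id _)
  assoc _ _ _ := Algebra.Hom.ext (funext fun _ => Category.assoc _ _ _)

variable (C) in
/-- The functor `f^*` from `Q`-algebras to `P`-algebras induced by a morphism `f : P ⟶ Q`. -/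
abbrev Algebra.pullback {P Q : Operad.{u} E} (f : P ⟶ Q) : Algebra C Q ⥤ Algebra C P where
  obj A := OperadData.Hom.comp f A
  map g :=
    { app := fun x => Algebra.Hom.app g (OperadData.Hom.toMap f |>.obj x)
      naturality := fun c d => by
        dsimp only
        rw [Category.assoc, Category.assoc, Algebra.Hom.naturality g] }
  map_id _ := rfl
  map_comp _ _ := rfl

variable (C) in
/-- `P`-coalgebras in `C`: the opposite of the category of `P`-algebras in `Cᵒᵖ`. -/
abbrev Coalgebra (P : Operad.{u} E) := (Algebra Cᵒᵖ P)ᵒᵖ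

variable (C) in
/-- The functor `f^*` from `Q`-coalgebras to `P`-coalgebras induced by a morphism `f : P ⟶ Q`. -/
abbrev Coalgebra.pullback {P Q : Operad.{u} E} (f : P ⟶ Q) : Coalgebra C Q ⥤ Coalgebra C P :=
  (Algebra.pullback Cᵒᵖ f).op

/-! ### The Grothendieck constructions -/

variable (E C)

/-- Pairs of a small operad `P` and a `P`-algebra in `C`. -/
structure OpAlg where
  operad : Operad.{u} E
  alg : Algebra C operad

/-- Pairs of a small operad `P` and a `P`-coalgebra in `C`. -/
structure OpCog where
  operad : Operad.{u} E
  cog : Coalgebra C operad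

variable {E C}

/-- A morphism `(P, A) ⟶ (P', A')` is a morphism of operads `f : P ⟶ P'` together with a morphism of
`P`-algebras `A ⟶ f^* A'`. -/
structure OpAlg.Hom (X Y : OpAlg.{u} E C) where
  base : X.operad ⟶ Y.operad
  fiber : X.alg ⟶ (Algebra.pullback C base).obj Y.alg

/-- A morphism `(P, V) ⟶ (P', V')` is a morphism of operads `f : P ⟶ P'` together with a morphism of
`P`-coalgebras `V ⟶ f^* V'`. -/
structure OpCog.Hom (X Y : OpCog.{u} E C) where
  base : X.operad ⟶ Y.operad
  fiber : X.cog ⟶ (Coalgebra.pullback C base).obj Y.cog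

/-- The colours of an operad. -/
abbrev OpAlg.Ob (X : OpAlg.{u} E C) : Type u := X.operad.Ob

/-- The colours of an operad. -/
abbrev OpCog.Ob (X : OpCog.{u} E C) : Type u := X.operad.Ob

/-- The underlying objects of `C` of an algebra. -/
abbrev OpAlg.carrier (X : OpAlg.{u} E C) (x : X.Ob) : C := X.alg.obj x

/-- The underlying objects of `C` of a coalgebra. -/
abbrev OpCog.carrier (X : OpCog.{u} E C) (x : X.Ob) : C := (X.cog.unop.obj x).unop

/-- The function on colours underlying a morphism. -/
abbrev OpAlg.Hom.onOb {X Y : OpAlg.{u} E C} (φ : X.Hom Y) : X.Ob → Y.Ob :=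
  (OperadData.Hom.toMap φ.base).obj

/-- The function on colours underlying a morphism. -/
abbrev OpCog.Hom.onOb {X Y : OpCog.{u} E C} (φ : X.Hom Y) : X.Ob → Y.Ob :=
  (OperadData.Hom.toMap φ.base).obj

/-- The morphisms of `C` underlying a morphism. -/
abbrev OpAlg.Hom.app {X Y : OpAlg.{u} E C} (φ : X.Hom Y) (x : X.Ob) :
    X.carrier x ⟶ Y.carrier (φ.onOb x) :=
  Algebra.Hom.app φ.fiber x

/-- The morphisms of `C` underlying a morphism. -/
abbrev OpCog.Hom.app {X Y : OpCog.{u} E C} (φ : X.Hom Y) (x : X.Ob) :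
    X.carrier x ⟶ Y.carrier (φ.onOb x) :=
  (Algebra.Hom.app φ.fiber.unop x).unop

lemma OpAlg.Hom.ext {X Y : OpAlg.{u} E C} {φ ψ : X.Hom Y} (h : φ.base = ψ.base)
    (h' : ∀ x, φ.app x ≫ eqToHom (by rw [OpAlg.Hom.onOb, h]) = ψ.app x) : φ = ψ := by
  obtain ⟨f, g⟩ := φ
  obtain ⟨f', g'⟩ := ψ
  obtain rfl : f = f' := h
  have : g = g' := Algebra.Hom.ext (funext fun x => by simpa using h' x)
  rw [this]

lemma OpCog.Hom.ext {X Y : OpCog.{u} E C} {φ ψ : X.Hom Y} (h : φ.base = ψ.base)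
    (h' : ∀ x, φ.app x ≫ eqToHom (by rw [OpCog.Hom.onOb, h]) = ψ.app x) : φ = ψ := by
  obtain ⟨f, g⟩ := φ
  obtain ⟨f', g'⟩ := ψ
  obtain rfl : f = f' := h
  have : g = g' := Quiver.Hom.unop_inj
    (Algebra.Hom.ext (funext fun x => Quiver.Hom.unop_inj (by simpa using h' x)))
  rw [this]

/-- The category of pairs of a small operad and an algebra over it in `C`. -/
instance : Category (OpAlg.{u} E C) where
  Hom := OpAlg.Hom
  id X :=
    { base := 𝟙 X.operad
      fiber :=
        { app := fun x => 𝟙 (X.carrier x)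
          naturality := fun c d =>
            (Algebra.Hom.naturality (𝟙 X.alg) c d).trans
              (congrArg (· ≫ _) (Category.id_comp _).symm) } }
  comp φ ψ :=
    { base := φ.base ≫ ψ.base
      fiber :=
        { app := fun x => φ.app x ≫ ψ.app (φ.onOb x)
          naturality := fun c d =>
            (Algebra.Hom.naturality
              (φ.fiber ≫ (Algebra.pullback C φ.base).map ψ.fiber) c d).trans
              (congrArg (· ≫ _) (Category.assoc _ _ _).symm) } }
  id_comp _ := OpAlg.Hom.ext (Category.id_comp _) fun _ =>
    (Category.comp_id _).trans (Category.id_comp _)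
  comp_id _ := OpAlg.Hom.ext (Category.comp_id _) fun _ =>
    (Category.comp_id _).trans (Category.comp_id _)
  assoc _ _ _ := OpAlg.Hom.ext (Category.assoc _ _ _) fun _ =>
    (Category.comp_id _).trans (Category.assoc _ _ _)

/-- The category of pairs of a small operad and a coalgebra over it in `C`. -/
instance : Category (OpCog.{u} E C) where
  Hom := OpCog.Hom
  id X :=
    { base := 𝟙 X.operad
      fiber := Quiver.Hom.op
        { app := fun x => 𝟙 (X.cog.unop.obj x)
          naturality := fun c d =>
            (congrArg (· ≫ _) (Category.id_comp _)).trans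
              (Algebra.Hom.naturality (𝟙 X.cog.unop) c d) } }
  comp φ ψ :=
    { base := φ.base ≫ ψ.base
      fiber := Quiver.Hom.op
        { app := fun x => (φ.app x ≫ ψ.app (φ.onOb x)).op
          naturality := fun c d =>
            (congrArg (· ≫ _) (Category.assoc _ _ _)).trans (Algebra.Hom.naturality
              ((Algebra.pullback Cᵒᵖ φ.base).map ψ.fiber.unop ≫ φ.fiber.unop) c d) } }
  id_comp _ := OpCog.Hom.ext (Category.id_comp _) fun _ =>
    (Category.comp_id _).trans (Category.id_comp _)
  comp_id _ := OpCog.Hom.ext (Category.comp_id _) fun _ =>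
    (Category.comp_id _).trans (Category.comp_id _)
  assoc _ _ _ := OpCog.Hom.ext (Category.assoc _ _ _) fun _ =>
    (Category.comp_id _).trans (Category.assoc _ _ _)

variable (E C)

/-- The forgetful functor from pairs `(P, A)` to operads. -/
abbrev OpAlg.forget : OpAlg.{u} E C ⥤ Operad.{u} E where
  obj X := X.operad
  map φ := φ.base

/-- The forgetful functor from pairs `(P, V)` to operads. -/
abbrev OpCog.forget : OpCog.{u} E C ⥤ Operad.{u} E where
  obj X := X.operad
  map φ := φ.base

/-- The forgetful functor which sends `(P, A)` to the family of objects `A(x)` of `C` indexed by the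
colours of `P`. -/
abbrev OpAlg.family : OpAlg.{u} E C ⥤ FormalCoproduct.{u} C where
  obj X := ⟨X.Ob, X.carrier⟩
  map φ := ⟨φ.onOb, φ.app⟩

/-- The forgetful functor which sends `(P, V)` to the family of objects `V(x)` of `C` indexed by the
colours of `P`. -/
abbrev OpCog.family : OpCog.{u} E C ⥤ FormalCoproduct.{u} C where
  obj X := ⟨X.Ob, X.carrier⟩
  map φ := ⟨φ.onOb, φ.app⟩

variable {E C}

/-- The external tensor product `A ◇ A'`, as the composite
`P ⊗ P' ⟶ End(C) ⊗ End(C) ⟶ End(C)` of maps. -/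
abbrev diamond {P P' : Operad.{u} E} (A : Algebra C P) (A' : Algebra C P') :
    (P.hadamard P').toOperadData.Map (EndOperad E C) :=
  (A.toMap.hadamard A'.toMap).comp (endTensor E C)

end Endomorphisms

/-! ### Families of objects of a symmetric monoidal category -/

section Families

variable {C : Type w'} [Category.{v'} C] [MonoidalCategory C] [SymmetricCategory C]

/-- The tensor product of families of objects, `(A(x))ₓ ⊗ (B(y))_y = (A(x) ⊗ B(y))_{(x, y)}`. -/
instance : MonoidalCategoryStruct (FormalCoproduct.{u} C) where
  tensorObj A B := ⟨A.I × B.I, fun x => A.obj x.1 ⊗ B.obj x.2⟩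
  tensorUnit := ⟨PUnit, fun _ => 𝟙_ C⟩
  tensorHom f g := ⟨fun x => (f.f x.1, g.f x.2), fun x => f.φ x.1 ⊗ₘ g.φ x.2⟩
  whiskerLeft A _ _ g := ⟨fun x => (x.1, g.f x.2), fun x => A.obj x.1 ◁ g.φ x.2⟩
  whiskerRight f B := ⟨fun x => (f.f x.1, x.2), fun x => f.φ x.1 ▷ B.obj x.2⟩
  associator A B D :=
    { hom := ⟨fun x => (x.1.1, x.1.2, x.2), fun _ => (α_ _ _ _).hom⟩
      inv := ⟨fun x => ((x.1, x.2.1), x.2.2), fun _ => (α_ _ _ _).inv⟩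
      hom_inv_id := FormalCoproduct.hom_ext rfl (by simp)
      inv_hom_id := FormalCoproduct.hom_ext rfl (by simp) }
  leftUnitor A :=
    { hom := ⟨fun x => x.2, fun _ => (λ_ _).hom⟩
      inv := ⟨fun x => (⟨⟩, x), fun _ => (λ_ _).inv⟩
      hom_inv_id := FormalCoproduct.hom_ext rfl (by simp)
      inv_hom_id := FormalCoproduct.hom_ext rfl (by simp) }
  rightUnitor A :=
    { hom := ⟨fun x => x.1, fun _ => (ρ_ _).hom⟩
      inv := ⟨fun x => (x, ⟨⟩), fun _ => (ρ_ _).inv⟩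
      hom_inv_id := FormalCoproduct.hom_ext rfl (by simp)
      inv_hom_id := FormalCoproduct.hom_ext rfl (by simp) }

instance : MonoidalCategory (FormalCoproduct.{u} C) := MonoidalCategory.ofTensorHom
  (id_tensorHom_id := fun _ _ => FormalCoproduct.hom_ext rfl fun _ =>
    (Category.comp_id _).trans (id_tensorHom_id _ _))
  (id_tensorHom := fun _ _ _ _ => FormalCoproduct.hom_ext rfl fun _ =>
    (Category.comp_id _).trans (id_tensorHom _ _))
  (tensorHom_id := fun _ _ => FormalCoproduct.hom_ext rfl fun _ =>
    (Category.comp_id _).trans (tensorHom_id _ _))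
  (tensorHom_comp_tensorHom := fun _ _ _ _ => FormalCoproduct.hom_ext rfl fun _ =>
    (Category.comp_id _).trans (tensorHom_comp_tensorHom _ _ _ _))
  (associator_naturality := fun _ _ _ => FormalCoproduct.hom_ext rfl fun _ =>
    (Category.comp_id _).trans (associator_naturality _ _ _))
  (leftUnitor_naturality := fun _ => FormalCoproduct.hom_ext rfl fun _ =>
    (Category.comp_id _).trans
      ((congrArg (· ≫ _) (id_tensorHom _ _)).trans (leftUnitor_naturality _)))
  (rightUnitor_naturality := fun _ => FormalCoproduct.hom_ext rfl fun _ =>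
    (Category.comp_id _).trans
      ((congrArg (· ≫ _) (tensorHom_id _ _)).trans (rightUnitor_naturality _)))
  (pentagon := fun _ _ _ _ => FormalCoproduct.hom_ext rfl fun _ =>
    (Category.comp_id _).trans (pentagon_tensorHom (E := C) _ _ _ _))
  (triangle := fun _ _ => FormalCoproduct.hom_ext rfl fun _ =>
    (Category.comp_id _).trans (triangle_tensorHom (E := C) _ _))

instance : SymmetricCategory (FormalCoproduct.{u} C) where
  braiding _ _ :=
    { hom := ⟨fun x => (x.2, x.1), fun _ => (β_ _ _).hom⟩
      inv := ⟨fun x => (x.2, x.1), fun _ => (β_ _ _).hom⟩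
      hom_inv_id := FormalCoproduct.hom_ext rfl fun _ =>
        (Category.comp_id _).trans (SymmetricCategory.symmetry _ _)
      inv_hom_id := FormalCoproduct.hom_ext rfl fun _ =>
        (Category.comp_id _).trans (SymmetricCategory.symmetry _ _) }
  braiding_naturality_right _ _ _ _ := FormalCoproduct.hom_ext rfl fun _ =>
    (Category.comp_id _).trans (BraidedCategory.braiding_naturality_right _ _)
  braiding_naturality_left _ _ := FormalCoproduct.hom_ext rfl fun _ =>
    (Category.comp_id _).trans (BraidedCategory.braiding_naturality_left _ _)
  hexagon_forward _ _ _ := FormalCoproduct.hom_ext rfl fun _ =>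
    (Category.comp_id _).trans (BraidedCategory.hexagon_forward _ _ _)
  hexagon_reverse _ _ _ := FormalCoproduct.hom_ext rfl fun _ =>
    (Category.comp_id _).trans (BraidedCategory.hexagon_reverse _ _ _)
  symmetry _ _ := FormalCoproduct.hom_ext rfl fun _ =>
    (Category.comp_id _).trans (SymmetricCategory.symmetry _ _)

end Families

/-! ### Symmetric monoidal fibrations -/

section Fibrations

variable {X : Type u₁} [Category.{v} X] [MonoidalCategory X] [SymmetricCategory X]
  {B : Type u₂} [Category.{v'} B] [MonoidalCategory B] [SymmetricCategory B]

/-- A strict symmetric monoidal functor: a symmetric monoidal functor whose structure morphisms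
`F(a) ⊗ F(b) ⟶ F(a ⊗ b)` and `𝟙 ⟶ F(𝟙)` are identities. -/
def IsStrictSymmetricMonoidal (F : X ⥤ B) : Prop :=
  ∃ _ : F.Braided,
    (∃ h : 𝟙_ B = F.obj (𝟙_ X), Functor.LaxMonoidal.ε F = eqToHom h) ∧
    ∀ a b : X, ∃ h : F.obj a ⊗ F.obj b = F.obj (a ⊗ b), Functor.LaxMonoidal.μ F a b = eqToHom h

/-- A symmetric monoidal cartesian fibration: a cartesian fibration which is a strict symmetric
monoidal functor, such that the tensor product of two cartesian morphisms is cartesian. -/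
structure IsSymmetricMonoidalFibration (p : X ⥤ B) : Prop where
  isFibered : p.IsFibered
  isStrict : IsStrictSymmetricMonoidal p
  tensor_cartesian : ∀ {a b a' b' : X} (φ : a ⟶ b) (ψ : a' ⟶ b'),
    p.IsStronglyCartesian (p.map φ) φ → p.IsStronglyCartesian (p.map ψ) ψ →
      p.IsStronglyCartesian (p.map (φ ⊗ₘ ψ)) (φ ⊗ₘ ψ)

end Fibrations

end ColouredOperads
end

open ColouredOperads

/-!
# The symmetric monoidal fibrations of algebras and coalgebras over operads

A tensor product `A ◇ B` of algebras over different operads exists because the tensor product of `C`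
is a morphism of operads `End(C) ⊗ End(C) ⟶ End(C)` (`endTensor_isMorphism`), and it has a unit
because the unit of `C` is a morphism `uCom ⟶ End(C)` (`endUnit_isMorphism`). The map `endTensor`
tensors two operations and then reorders their inputs by the shuffle
`⨂ⱼ (xⱼ ⊗ yⱼ) ⟶ (⨂ⱼ xⱼ) ⊗ (⨂ⱼ yⱼ)`. Everything therefore rests on two kinds of facts.

* Coherence in `C`: the shuffle is natural, is compatible with the associator, the unitors and the
  symmetry of `C` (`tshuffle_associator`, `tshuffle_leftUnitor`, `tshuffle_rightUnitor`,
  `tshuffle_braiding`), with the permutations of the factors (`tpermute_tshuffle`) and with the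
  concatenation of tuples (`tappend_tshuffle`). All are proved by induction on the length, from the
  fact that a shuffle of `n + 1` pairs is a shuffle of `n` pairs followed by a middle interchange
  `tensorμ`, and from the coherence theorems for `tensorμ`.
* Enriched naturality: equations between composites in `E` of the form "transport along `t'` after
  `φ` equals transport along `t` after `ψ`" are commutative squares `EnrichedSquare φ ψ t t'` with
  two sides parametrised by an object of `E`. They can be pasted, inverted and tensored, so that an
  equation between composites of enriched operations reduces to an equation between their vertical
  sides, which is one of the coherence facts in `C`.

A morphism of algebras is a family of such squares. Hence the associator, the unitors and the
symmetry of `C` give morphisms of algebras (`Algebra.associator_square` and its companions), and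
these lie over the structure morphisms of the category of operads by construction. The axioms of a
symmetric monoidal category then hold in `OpAlg` because they hold for operads and in `C`. For
coalgebras the same squares are used in `Cᵒᵖ`, read backwards, since a morphism of coalgebras is a
morphism of algebras in `Cᵒᵖ` in the opposite direction.

Finally a morphism of `OpAlg` or `OpCog` is cartesian if and only if all the morphisms of `C` which
underlie it are invertible (`OpAlg.isStronglyCartesian_of_isIso`,
`OpAlg.isIso_of_isStronglyCartesian`), and tensor products of isomorphisms are isomorphisms.
-/

noncomputable section

namespace ColouredOperads

/-! ### Coherence of the iterated tensor product -/

section Coherence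

set_option linter.unusedSectionVars false

variable {C : Type w'} [Category.{v'} C] [MonoidalCategory C]

lemma eqToHom_tensorHom {x x' y y' : C} (h : x ⊗ y = x' ⊗ y') (hx : x = x') (hy : y = y') :
    eqToHom h = eqToHom hx ⊗ₘ eqToHom hy := by
  subst hx hy
  simp

/-- The iterated tensor product distinguishes the lengths `0`, `1` and `n + 2`. Composing with
`tcons` gives this recursion, uniform in the length, for `tpowMap`; the next lemmas do so for the
other maps. -/
lemma tcons_tpowMap {n : ℕ} {x y : Fin (n + 1) → C} (f : ∀ j, x j ⟶ y j) :
    (tcons x).hom ≫ tpowMap f = (f 0 ⊗ₘ tpowMap fun j => f j.succ) ≫ (tcons y).hom := by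
  cases n with
  | zero =>
    change (ρ_ _).hom ≫ f 0 = (f 0 ⊗ₘ 𝟙 _) ≫ (ρ_ _).hom
    simp
  | succ n => exact (Category.id_comp _).trans (Category.comp_id _).symm

lemma tcons_tunit (n : ℕ) :
    (tcons fun _ : Fin (n + 1) => 𝟙_ C).hom ≫ tunit C (n + 1) =
      (𝟙 (𝟙_ C) ⊗ₘ tunit C n) ≫ (λ_ _).hom := by
  cases n with
  | zero =>
    change (ρ_ _).hom ≫ 𝟙 _ = (𝟙 _ ⊗ₘ 𝟙 _) ≫ (λ_ _).hom
    simp [unitors_equal]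
  | succ n =>
    change 𝟙 _ ≫ (λ_ _).hom ≫ _ = _
    simp

variable [SymmetricCategory C]

/-- The shuffle of `n + 1` pairs is the shuffle of the last `n` pairs followed by a middle
interchange. -/
lemma tcons_tshuffle {n : ℕ} (x y : Fin (n + 1) → C) :
    (tcons fun j => x j ⊗ y j).hom ≫ tshuffle x y =
      (𝟙 _ ⊗ₘ tshuffle (fun j => x j.succ) fun j => y j.succ) ≫ tensorμ _ _ _ _ ≫
        ((tcons x).hom ⊗ₘ (tcons y).hom) := by
  cases n with
  | zero =>
    refine (Category.comp_id _).trans ((tensor_right_unitality (x 0) (y 0)).trans ?_)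
    rw [← id_tensorHom]
    rfl
  | succ n =>
    change 𝟙 _ ≫ _ ◁ _ ≫ tensorμ _ _ _ _ = _ ≫ _ ≫ (𝟙 _ ⊗ₘ 𝟙 _)
    simp

lemma tpowMap_tshuffle : ∀ {n : ℕ} {x x' y y' : Fin n → C} (f : ∀ j, x j ⟶ x' j)
    (g : ∀ j, y j ⟶ y' j),
    tpowMap (fun j => f j ⊗ₘ g j) ≫ tshuffle x' y' = tshuffle x y ≫ (tpowMap f ⊗ₘ tpowMap g)
  | 0, x, x', y, y', f, g => by
    change 𝟙 _ ≫ (λ_ _).inv = (λ_ _).inv ≫ (𝟙 _ ⊗ₘ 𝟙 _)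
    simp
  | n + 1, x, x', y, y', f, g => by
    rw [← cancel_epi (tcons _).hom, reassoc_of% tcons_tpowMap, tcons_tshuffle,
      reassoc_of% tcons_tshuffle, tensorHom_comp_tensorHom, tcons_tpowMap, tcons_tpowMap,
      ← tensorHom_comp_tensorHom, ← tensorμ_natural_assoc, tensorHom_comp_tensorHom_assoc,
      tensorHom_comp_tensorHom_assoc, tpowMap_tshuffle, Category.comp_id, Category.id_comp]

/-- This coherence between the shuffle and the associator makes external tensor products of algebras
associative; the next lemmas play the same role for the unitors and the symmetry. -/
lemma tshuffle_associator : ∀ {n : ℕ} (x y z : Fin n → C),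
    tshuffle (fun j => x j ⊗ y j) z ≫ (tshuffle x y ⊗ₘ 𝟙 _) ≫ (α_ _ _ _).hom =
      tpowMap (fun j => (α_ (x j) (y j) (z j)).hom) ≫ tshuffle x (fun j => y j ⊗ z j) ≫
        (𝟙 _ ⊗ₘ tshuffle y z)
  | 0, x, y, z => by
    change (λ_ _).inv ≫ ((λ_ _).inv ⊗ₘ 𝟙 _) ≫ (α_ _ _ _).hom =
      𝟙 _ ≫ (λ_ _).inv ≫ (𝟙 _ ⊗ₘ (λ_ _).inv)
    monoidal
  | n + 1, x, y, z => by
    have h := associator_monoidal (x 0) (y 0) (z 0) (tpow fun j => x j.succ)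
      (tpow fun j => y j.succ) (tpow fun j => z j.succ)
    rw [← tensorHom_id, ← id_tensorHom] at h
    rw [← cancel_epi (tcons _).hom, reassoc_of% tcons_tshuffle, reassoc_of% tcons_tpowMap,
      reassoc_of% tcons_tshuffle, tensorHom_comp_tensorHom_assoc, tensorHom_comp_tensorHom,
      tcons_tshuffle, tcons_tshuffle, Category.comp_id, Category.comp_id]
    -- The middle interchanges are separated from the shuffles of the tails, to apply
    -- `associator_monoidal` to the former and the induction hypothesis to the latter.
    have e₁ : ((𝟙 (x 0 ⊗ y 0) ⊗ₘ tshuffle (fun j => x j.succ) fun j => y j.succ) ≫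
        tensorμ _ _ _ _ ≫ ((tcons x).hom ⊗ₘ (tcons y).hom)) ⊗ₘ (tcons z).hom =
        ((𝟙 (x 0 ⊗ y 0) ⊗ₘ tshuffle (fun j => x j.succ) fun j => y j.succ) ⊗ₘ (𝟙 (z 0) ⊗ₘ 𝟙 _)) ≫
        (tensorμ _ _ _ _ ⊗ₘ 𝟙 _) ≫ (((tcons x).hom ⊗ₘ (tcons y).hom) ⊗ₘ (tcons z).hom) := by
      simp only [tensorHom_comp_tensorHom, id_tensorHom_id, Category.id_comp]
    have e₂ : (tcons x).hom ⊗ₘ ((𝟙 (y 0 ⊗ z 0) ⊗ₘ tshuffle (fun j => y j.succ) fun j => z j.succ) ≫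
        tensorμ _ _ _ _ ≫ ((tcons y).hom ⊗ₘ (tcons z).hom)) =
        ((𝟙 (x 0) ⊗ₘ 𝟙 _) ⊗ₘ (𝟙 (y 0 ⊗ z 0) ⊗ₘ tshuffle (fun j => y j.succ) fun j => z j.succ)) ≫
        (𝟙 _ ⊗ₘ tensorμ _ _ _ _) ≫ ((tcons x).hom ⊗ₘ ((tcons y).hom ⊗ₘ (tcons z).hom)) := by
      simp only [tensorHom_comp_tensorHom, id_tensorHom_id, Category.id_comp]
    rw [e₁, e₂, Category.assoc, Category.assoc, associator_naturality, ← tensorμ_natural_assoc,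
      ← tensorμ_natural_assoc, reassoc_of% h]
    simp only [tensorHom_comp_tensorHom_assoc, id_tensorHom_id, Category.comp_id, Category.id_comp,
      tshuffle_associator]

lemma tshuffle_leftUnitor : ∀ {n : ℕ} (x : Fin n → C),
    tshuffle (fun _ => 𝟙_ C) x ≫ (tunit C n ⊗ₘ 𝟙 _) ≫ (λ_ _).hom =
      tpowMap fun j => (λ_ (x j)).hom
  | 0, x => by
    change (λ_ _).inv ≫ (𝟙 _ ⊗ₘ 𝟙 _) ≫ (λ_ _).hom = 𝟙 _
    simp
  | n + 1, x => by
    rw [← cancel_epi (tcons _).hom, reassoc_of% tcons_tshuffle, tcons_tpowMap,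
      tensorHom_comp_tensorHom_assoc, tcons_tunit, Category.comp_id]
    have e₁ : (((𝟙 (𝟙_ C) ⊗ₘ tunit C n) ≫ (λ_ _).hom) ⊗ₘ (tcons x).hom) =
        ((𝟙 (𝟙_ C) ⊗ₘ tunit C n) ⊗ₘ (𝟙 (x 0) ⊗ₘ 𝟙 _)) ≫ ((λ_ _).hom ▷ _) ≫
          (_ ◁ (tcons x).hom) := by
      simp only [← tensorHom_id, ← id_tensorHom, tensorHom_comp_tensorHom, id_tensorHom_id,
        Category.id_comp, Category.comp_id]
    rw [e₁, Category.assoc, Category.assoc, leftUnitor_naturality,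
      ← tensorμ_natural_assoc, ← leftUnitor_monoidal_assoc]
    simp only [tensorHom_comp_tensorHom_assoc, id_tensorHom_id, Category.id_comp,
      tshuffle_leftUnitor]

lemma tshuffle_rightUnitor : ∀ {n : ℕ} (x : Fin n → C),
    tshuffle x (fun _ => 𝟙_ C) ≫ (𝟙 _ ⊗ₘ tunit C n) ≫ (ρ_ _).hom =
      tpowMap fun j => (ρ_ (x j)).hom
  | 0, x => by
    change (λ_ _).inv ≫ (𝟙 _ ⊗ₘ 𝟙 _) ≫ (ρ_ _).hom = 𝟙 _
    simp [unitors_inv_equal]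
  | n + 1, x => by
    rw [← cancel_epi (tcons _).hom, reassoc_of% tcons_tshuffle, tcons_tpowMap,
      tensorHom_comp_tensorHom_assoc, tcons_tunit, Category.comp_id]
    have e₁ : ((tcons x).hom ⊗ₘ ((𝟙 (𝟙_ C) ⊗ₘ tunit C n) ≫ (λ_ _).hom)) =
        ((𝟙 (x 0) ⊗ₘ 𝟙 _) ⊗ₘ (𝟙 (𝟙_ C) ⊗ₘ tunit C n)) ≫ (_ ◁ (λ_ _).hom) ≫
          ((tcons x).hom ▷ _) := by
      simp only [← tensorHom_id, ← id_tensorHom, tensorHom_comp_tensorHom, id_tensorHom_id,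
        Category.id_comp, Category.comp_id]
    rw [e₁, Category.assoc, Category.assoc, rightUnitor_naturality,
      ← tensorμ_natural_assoc, ← rightUnitor_monoidal_assoc]
    simp only [tensorHom_comp_tensorHom_assoc, id_tensorHom_id, Category.id_comp,
      tshuffle_rightUnitor]

lemma tensorμ_braiding_tensorHom (X₁ X₂ Y₁ Y₂ : C) :
    tensorμ X₁ X₂ Y₁ Y₂ ≫ (β_ (X₁ ⊗ Y₁) (X₂ ⊗ Y₂)).hom =
      ((β_ X₁ X₂).hom ⊗ₘ (β_ Y₁ Y₂).hom) ≫ tensorμ X₂ X₁ Y₂ Y₁ := by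
  have h := braiding_comp (𝟙 (X₁ ⊗ Y₁)) (𝟙 (X₂ ⊗ Y₂))
  simpa using h

lemma tshuffle_braiding : ∀ {n : ℕ} (x y : Fin n → C),
    tshuffle x y ≫ (β_ _ _).hom = tpowMap (fun j => (β_ (x j) (y j)).hom) ≫ tshuffle y x
  | 0, x, y => by
    change (λ_ _).inv ≫ (β_ (𝟙_ C) (𝟙_ C)).hom = 𝟙 _ ≫ (λ_ _).inv
    simp [unitors_inv_equal]
  | n + 1, x, y => by
    rw [← cancel_epi (tcons _).hom, reassoc_of% tcons_tshuffle, reassoc_of% tcons_tpowMap,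
      tcons_tshuffle, BraidedCategory.braiding_naturality,
      reassoc_of% tensorμ_braiding_tensorHom]
    simp only [tensorHom_comp_tensorHom_assoc, Category.comp_id, Category.id_comp,
      tshuffle_braiding]

/-- The isomorphism `X ⊗ (A ⊗ R) ≅ A ⊗ (X ⊗ R)` exchanging the first two factors. -/
abbrev leftComm (X A R : C) : X ⊗ (A ⊗ R) ≅ A ⊗ (X ⊗ R) :=
  (α_ _ _ _).symm ≪≫ whiskerRightIso (β_ X A) R ≪≫ α_ _ _ _

lemma leftComm_tensorμ (X₁ X₂ A₁ A₂ R₁ R₂ : C) :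
    (leftComm (X₁ ⊗ X₂) (A₁ ⊗ A₂) (R₁ ⊗ R₂)).hom ≫ (𝟙 _ ⊗ₘ tensorμ X₁ X₂ R₁ R₂) ≫
        tensorμ A₁ A₂ (X₁ ⊗ R₁) (X₂ ⊗ R₂) =
      (𝟙 _ ⊗ₘ tensorμ A₁ A₂ R₁ R₂) ≫ tensorμ X₁ X₂ (A₁ ⊗ R₁) (A₂ ⊗ R₂) ≫
        ((leftComm X₁ A₁ R₁).hom ⊗ₘ (leftComm X₂ A₂ R₂).hom) := by
  have h₁ := tensor_associativity X₁ X₂ A₁ A₂ R₁ R₂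
  have h₂ := tensor_associativity A₁ A₂ X₁ X₂ R₁ R₂
  simp only [leftComm, Iso.trans_hom, Iso.symm_hom, whiskerRightIso_hom, Category.assoc,
    id_tensorHom]
  rw [← h₂, ← cancel_epi (α_ (X₁ ⊗ X₂) (A₁ ⊗ A₂) (R₁ ⊗ R₂)).hom, Iso.hom_inv_id_assoc,
    ← reassoc_of% h₁, ← comp_whiskerRight_assoc, ← tensorμ_braiding, comp_whiskerRight_assoc,
    tensorμ_natural_left_assoc]
  simp only [tensorHom_comp_tensorHom, Iso.hom_inv_id_assoc]

lemma leftComm_tunit (X R : C) :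
    (leftComm (𝟙_ C) X R).hom ≫ (𝟙 X ⊗ₘ (λ_ R).hom) = (λ_ _).hom := by
  simp [leftComm, braiding_tensorUnit_left]

lemma leftComm_naturality {X X' A A' R R' : C} (f : X ⟶ X') (g : A ⟶ A') (h : R ⟶ R') :
    (f ⊗ₘ g ⊗ₘ h) ≫ (leftComm X' A' R').hom = (leftComm X A R).hom ≫ (g ⊗ₘ f ⊗ₘ h) := by
  simp only [leftComm, Iso.trans_hom, Iso.symm_hom, whiskerRightIso_hom, Category.assoc,
    ← tensorHom_id, associator_inv_naturality_assoc, tensorHom_comp_tensorHom_assoc,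
    BraidedCategory.braiding_naturality, Category.comp_id]
  rw [← associator_naturality, tensorHom_comp_tensorHom_assoc, Category.id_comp]

/-- The exchange `leftComm` followed by maps `t`, `t'` out of the last two factors is compatible
with the middle interchange. -/
lemma leftComm_tensorμ_tensorHom {X X' A A' B B' R R' S S' P Q : C} (e : A ⟶ B) (e' : A' ⟶ B')
    (t : X ⊗ R ⟶ S) (t' : X' ⊗ R' ⟶ S') (σ : P ⟶ R ⊗ R') (T : (X ⊗ X') ⊗ P ⟶ Q)
    (τ : Q ⟶ S ⊗ S') (h : T ≫ τ = (𝟙 _ ⊗ₘ σ) ≫ tensorμ _ _ _ _ ≫ (t ⊗ₘ t')) :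
    (leftComm (X ⊗ X') (A ⊗ A') P).hom ≫ ((e ⊗ₘ e') ⊗ₘ T) ≫ (𝟙 _ ⊗ₘ τ) ≫ tensorμ _ _ _ _ =
      (𝟙 _ ⊗ₘ ((𝟙 _ ⊗ₘ σ) ≫ tensorμ _ _ _ _)) ≫ tensorμ _ _ _ _ ≫
        (((leftComm X A R).hom ≫ (e ⊗ₘ t)) ⊗ₘ ((leftComm X' A' R').hom ≫ (e' ⊗ₘ t'))) := by
  have e₁ : ((e ⊗ₘ e') ⊗ₘ ((𝟙 (X ⊗ X') ⊗ₘ σ) ≫ tensorμ _ _ _ _ ≫ (t ⊗ₘ t'))) =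
      (𝟙 (A ⊗ A') ⊗ₘ (𝟙 (X ⊗ X') ⊗ₘ σ)) ≫ (𝟙 _ ⊗ₘ tensorμ _ _ _ _) ≫
        ((e ⊗ₘ e') ⊗ₘ (t ⊗ₘ t')) := by
    simp only [tensorHom_comp_tensorHom, Category.id_comp]
  rw [tensorHom_comp_tensorHom_assoc, h, Category.comp_id, e₁, Category.assoc, Category.assoc,
    tensorμ_natural, ← reassoc_of% leftComm_naturality, reassoc_of% leftComm_tensorμ,
    tensorHom_comp_tensorHom, tensorHom_comp_tensorHom_assoc, Category.id_comp]

lemma tcons_inv_tshuffle {n : ℕ} (x y : Fin (n + 1) → C) :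
    (tcons fun j => x j ⊗ y j).inv ≫ (𝟙 _ ⊗ₘ tshuffle (fun j => x j.succ) fun j => y j.succ) ≫
        tensorμ _ _ _ _ = tshuffle x y ≫ ((tcons x).inv ⊗ₘ (tcons y).inv) := by
  rw [Iso.inv_comp_eq, reassoc_of% tcons_tshuffle, tensorHom_comp_tensorHom]
  simp

lemma tinsert_zero {n : ℕ} (x : Fin (n + 1) → C) (h₀ : 0 < n + 1) (y : Fin n → C)
    (h : ∀ j, y j = x (Fin.succAbove ⟨0, h₀⟩ j)) :
    (tinsert x ⟨0, h₀⟩ y h).hom =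
      (𝟙 _ ⊗ₘ eqToHom (congrArg tpow (funext fun j => (h j).trans (by simp)))) ≫
        (tcons x).hom := by
  cases n <;> simp [tinsert]

lemma tinsert_succ {n i : ℕ} (x : Fin (n + 2) → C) (hi : i + 1 < n + 2) (y : Fin (n + 1) → C)
    (h : ∀ j, y j = x (Fin.succAbove ⟨i + 1, hi⟩ j)) :
    (tinsert x ⟨i + 1, hi⟩ y h).hom =
      (𝟙 _ ⊗ₘ (tcons y).inv) ≫ (leftComm _ _ _).hom ≫
        (eqToHom ((h 0).trans (congrArg x (Fin.succ_succAbove_zero ⟨i, by omega⟩))) ⊗ₘ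
          (tinsert (fun j => x j.succ) ⟨i, by omega⟩ (fun j => y j.succ) (fun j =>
            (h j.succ).trans (congrArg x (Fin.succ_succAbove_succ ⟨i, by omega⟩ j)))).hom) ≫
        (tcons x).hom := by
  simp [tinsert]

/-- The shuffle is compatible with moving the first factor to position `i`, which is the recursive
step in the definition of the action of permutations. -/
lemma tinsert_tshuffle : ∀ {n : ℕ} (x x' : Fin (n + 1) → C) (i : Fin (n + 1)) (y y' : Fin n → C)
    (h : ∀ j, y j = x (i.succAbove j)) (h' : ∀ j, y' j = x' (i.succAbove j))
    (H : ∀ j, y j ⊗ y' j = x (i.succAbove j) ⊗ x' (i.succAbove j)),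
    (tinsert (fun j => x j ⊗ x' j) i (fun j => y j ⊗ y' j) H).hom ≫ tshuffle x x' =
      (𝟙 _ ⊗ₘ tshuffle y y') ≫ tensorμ _ _ _ _ ≫
        ((tinsert x i y h).hom ⊗ₘ (tinsert x' i y' h').hom)
  | n, x, x', ⟨0, h₀⟩, y, y', h, h', H => by
    obtain rfl : y = fun j => x j.succ := funext h
    obtain rfl : y' = fun j => x' j.succ := funext h'
    simp only [tinsert_zero, eqToHom_refl, id_tensorHom_id, Category.id_comp]
    exact tcons_tshuffle x x'
  | 0, _, _, ⟨i + 1, hi⟩, _, _, _, _, _ => absurd hi (by omega)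
  | n + 1, x, x', ⟨i + 1, hi⟩, y, y', h, h', H => by
    have ih := tinsert_tshuffle (fun j => x j.succ) (fun j => x' j.succ) ⟨i, by omega⟩
      (fun j => y j.succ) (fun j => y' j.succ)
      (fun j => (h j.succ).trans (congrArg x (Fin.succ_succAbove_succ ⟨i, by omega⟩ j)))
      (fun j => (h' j.succ).trans (congrArg x' (Fin.succ_succAbove_succ ⟨i, by omega⟩ j)))
      (fun j => (H j.succ).trans (congrArg (fun k => x k ⊗ x' k)
        (Fin.succ_succAbove_succ ⟨i, by omega⟩ j)))
    rw [tinsert_succ, tinsert_succ, tinsert_succ]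
    simp only [Category.assoc]
    rw [tcons_tshuffle, eqToHom_tensorHom _
      ((h 0).trans (congrArg x (Fin.succ_succAbove_zero ⟨i, by omega⟩)))
      ((h' 0).trans (congrArg x' (Fin.succ_succAbove_zero ⟨i, by omega⟩))),
      reassoc_of% leftComm_tensorμ_tensorHom _ _ _ _ _ _ _ ih,
      tensorHom_comp_tensorHom_assoc, tcons_inv_tshuffle, tensorHom_comp_tensorHom]
    have e₁ (X X' : C) : 𝟙 (X ⊗ X') ≫ 𝟙 _ ⊗ₘ
        tshuffle y y' ≫ ((tcons y).inv ⊗ₘ (tcons y').inv) =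
        (𝟙 _ ⊗ₘ tshuffle y y') ≫ ((𝟙 X ⊗ₘ 𝟙 X') ⊗ₘ ((tcons y).inv ⊗ₘ (tcons y').inv)) := by
      simp only [tensorHom_comp_tensorHom, id_tensorHom_id, Category.id_comp]
    rw [e₁, Category.assoc, tensorμ_natural_assoc, tensorHom_comp_tensorHom]
    simp only [Category.assoc]
    rfl

lemma tinsert_tunit : ∀ {n : ℕ} (i : Fin (n + 1)) (h : ∀ _ : Fin n, 𝟙_ C = 𝟙_ C),
    (tinsert (fun _ => 𝟙_ C) i (fun _ => 𝟙_ C) h).hom ≫ tunit C (n + 1) =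
      (𝟙 _ ⊗ₘ tunit C n) ≫ (λ_ _).hom
  | n, ⟨0, h₀⟩, h => by
    rw [tinsert_zero, eqToHom_refl, id_tensorHom_id, Category.id_comp, tcons_tunit]
  | 0, ⟨i + 1, hi⟩, _ => absurd hi (by omega)
  | n + 1, ⟨i + 1, hi⟩, h => by
    have ih := tinsert_tunit (n := n) ⟨i, by omega⟩ (fun _ => rfl)
    rw [tinsert_succ]
    simp only [Category.assoc, eqToHom_refl]
    rw [tcons_tunit, tensorHom_comp_tensorHom_assoc, ih, Category.comp_id]
    have e₁ : 𝟙 (𝟙_ C) ⊗ₘ ((𝟙 (𝟙_ C) ⊗ₘ tunit C n) ≫ (λ_ (𝟙_ C)).hom) =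
        (𝟙 (𝟙_ C) ⊗ₘ (𝟙 (𝟙_ C) ⊗ₘ tunit C n)) ≫ (𝟙 _ ⊗ₘ (λ_ (𝟙_ C)).hom) := by
      simp only [tensorHom_comp_tensorHom, Category.id_comp]
    rw [e₁, Category.assoc, ← reassoc_of% leftComm_naturality, reassoc_of% leftComm_tunit,
      tensorHom_comp_tensorHom_assoc, ← cancel_epi (𝟙 (𝟙_ C) ⊗ₘ (tcons fun _ => 𝟙_ C).hom),
      tensorHom_comp_tensorHom_assoc, tensorHom_comp_tensorHom_assoc, tcons_tunit,
      Iso.hom_inv_id_assoc]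
    simp

lemma tpermute_succ {m n : ℕ} (y : Fin (m + 1) → C) (x : Fin (n + 1) → C)
    (e : Fin (m + 1) ≃ Fin (n + 1)) (h : ∀ j, y j = x (e j)) :
    (tpermute y x e h).hom = (tcons y).inv ≫ (eqToHom (h 0) ⊗ₘ
      (tpermute (fun j => y j.succ) (fun j => x ((e 0).succAbove j)) (tailEquiv e)
        (fun j => (h j.succ).trans (congrArg x (succAbove_tailEquiv e j).symm))).hom) ≫
      (tinsert x (e 0) (fun j => x ((e 0).succAbove j)) (fun _ => rfl)).hom := by
  simp [tpermute]

/-- The shuffle is compatible with permutations of the factors, so that `endTensor` is equivariant.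
-/
lemma tpermute_tshuffle : ∀ {m n : ℕ} (y y' : Fin m → C) (x x' : Fin n → C) (e : Fin m ≃ Fin n)
    (h : ∀ j, y j = x (e j)) (h' : ∀ j, y' j = x' (e j))
    (H : ∀ j, y j ⊗ y' j = x (e j) ⊗ x' (e j)),
    (tpermute (fun j => y j ⊗ y' j) (fun j => x j ⊗ x' j) e H).hom ≫ tshuffle x x' =
      tshuffle y y' ≫ ((tpermute y x e h).hom ⊗ₘ (tpermute y' x' e h').hom)
  | 0, 0, _, _, _, _, _, _, _, _ => by
    change 𝟙 _ ≫ (λ_ _).inv = (λ_ _).inv ≫ (𝟙 _ ⊗ₘ 𝟙 _)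
    simp
  | 0, _ + 1, _, _, _, _, e, _, _, _ => (e.symm 0).elim0
  | _ + 1, 0, _, _, _, _, e, _, _, _ => (e 0).elim0
  | m + 1, n + 1, y, y', x, x', e, h, h', H => by
    have ih := tpermute_tshuffle (fun j => y j.succ) (fun j => y' j.succ)
      (fun j => x ((e 0).succAbove j)) (fun j => x' ((e 0).succAbove j)) (tailEquiv e)
      (fun j => (h j.succ).trans (congrArg x (succAbove_tailEquiv e j).symm))
      (fun j => (h' j.succ).trans (congrArg x' (succAbove_tailEquiv e j).symm))
      (fun j => (H j.succ).trans (congrArg (fun k => x k ⊗ x' k) (succAbove_tailEquiv e j).symm))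
    rw [tpermute_succ, tpermute_succ y, tpermute_succ y', Category.assoc, Category.assoc,
      tinsert_tshuffle x x' (e 0) _ _ (fun _ => rfl) (fun _ => rfl),
      tensorHom_comp_tensorHom_assoc, ih, eqToHom_tensorHom _ (h 0) (h' 0), Category.comp_id]
    have e₁ {P Q : C} (p : (tpow fun j => y j.succ) ⟶ P) (q : (tpow fun j => y' j.succ) ⟶ Q) :
        (eqToHom (h 0) ⊗ₘ eqToHom (h' 0)) ⊗ₘ
          (tshuffle (fun j => y j.succ) (fun j => y' j.succ) ≫ (p ⊗ₘ q)) =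
        (𝟙 _ ⊗ₘ tshuffle (fun j => y j.succ) (fun j => y' j.succ)) ≫
          ((eqToHom (h 0) ⊗ₘ eqToHom (h' 0)) ⊗ₘ (p ⊗ₘ q)) := by
      rw [tensorHom_comp_tensorHom, Category.id_comp]
    rw [e₁, Category.assoc, tensorμ_natural_assoc, reassoc_of% tcons_inv_tshuffle]
    simp only [tensorHom_comp_tensorHom]

lemma tpermute_tunit : ∀ {m n : ℕ} (e : Fin m ≃ Fin n) (h : ∀ _ : Fin m, 𝟙_ C = 𝟙_ C),
    (tpermute (fun _ => 𝟙_ C) (fun _ => 𝟙_ C) e h).hom ≫ tunit C n = tunit C m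
  | 0, 0, _, _ => Category.id_comp _
  | 0, _ + 1, e, _ => (e.symm 0).elim0
  | _ + 1, 0, e, _ => (e 0).elim0
  | m + 1, n + 1, e, h => by
    have ih := tpermute_tunit (tailEquiv e) (fun _ => rfl)
    rw [tpermute_succ, Category.assoc, Category.assoc, tinsert_tunit,
      tensorHom_comp_tensorHom_assoc, ih, eqToHom_refl, Category.comp_id, ← tcons_tunit,
      Iso.inv_hom_id_assoc]

lemma eqToHom_tshuffle {m n : ℕ} (h : m = n) {x x' : Fin m → C} {y y' : Fin n → C}
    (hx : ∀ (j : Fin m) (k : Fin n), (j : ℕ) = k → x j = y k)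
    (hx' : ∀ (j : Fin m) (k : Fin n), (j : ℕ) = k → x' j = y' k)
    (H : tpow (fun j => x j ⊗ x' j) = tpow (fun j => y j ⊗ y' j)) :
    eqToHom H ≫ tshuffle y y' =
      tshuffle x x' ≫ (eqToHom (tpow_congr h hx) ⊗ₘ eqToHom (tpow_congr h hx')) := by
  subst h
  obtain rfl : x = y := funext fun j => hx j j rfl
  obtain rfl : x' = y' := funext fun j => hx' j j rfl
  simp

lemma eqToHom_tunit {m n : ℕ} (h : m = n)
    (H : tpow (fun _ : Fin m => 𝟙_ C) = tpow (fun _ : Fin n => 𝟙_ C)) :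
    eqToHom H ≫ tunit C n = tunit C m := by
  subst h
  simp

lemma tappend_zero {n k : ℕ} (a : Fin 0 → C) (b : Fin n → C) (r : Fin k → C) (h : k = 0 + n)
    (ha : ∀ (l : Fin 0) (p : Fin k), (p : ℕ) = l → r p = a l)
    (hb : ∀ (l : Fin n) (p : Fin k), (p : ℕ) = 0 + l → r p = b l) :
    (tappend a b r h ha hb).hom = (λ_ (tpow b)).hom ≫
      eqToHom (tpow_congr (by omega) fun j p e => (hb j p (by omega)).symm) := by
  cases k <;> rfl

lemma tappend_succ {m n k : ℕ} (a : Fin (m + 1) → C) (b : Fin n → C) (r : Fin (k + 1) → C)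
    (h : k + 1 = m + 1 + n) (ha : ∀ (l : Fin (m + 1)) (p : Fin (k + 1)), (p : ℕ) = l → r p = a l)
    (hb : ∀ (l : Fin n) (p : Fin (k + 1)), (p : ℕ) = m + 1 + l → r p = b l) :
    (tappend a b r h ha hb).hom = ((tcons a).inv ⊗ₘ 𝟙 (tpow b)) ≫
      (α_ (a 0) (tpow fun j => a j.succ) (tpow b)).hom ≫
        (eqToHom (ha 0 0 rfl).symm ⊗ₘ
          (tappend (fun j => a j.succ) b (fun j => r j.succ) (by omega)
            (fun l p e => ha l.succ p.succ (by simp [e]))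
            (fun l p e => hb l p.succ (by simp [e]; omega))).hom) ≫ (tcons r).hom := by
  simp [tappend]

/-- The shuffle is compatible with concatenation, which is how the inputs of an inserted operation
are joined to the other inputs. -/
lemma tappend_tshuffle : ∀ {m n k : ℕ} (a a' : Fin m → C) (b b' : Fin n → C) (r r' : Fin k → C)
    (h : k = m + n) (ha : ∀ (l : Fin m) (p : Fin k), (p : ℕ) = l → r p = a l)
    (hb : ∀ (l : Fin n) (p : Fin k), (p : ℕ) = m + l → r p = b l)
    (ha' : ∀ (l : Fin m) (p : Fin k), (p : ℕ) = l → r' p = a' l)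
    (hb' : ∀ (l : Fin n) (p : Fin k), (p : ℕ) = m + l → r' p = b' l)
    (Ha : ∀ (l : Fin m) (p : Fin k), (p : ℕ) = l → r p ⊗ r' p = a l ⊗ a' l)
    (Hb : ∀ (l : Fin n) (p : Fin k), (p : ℕ) = m + l → r p ⊗ r' p = b l ⊗ b' l),
    (tappend (fun j => a j ⊗ a' j) (fun j => b j ⊗ b' j) (fun j => r j ⊗ r' j) h Ha Hb).hom ≫
        tshuffle r r' =
      (tshuffle a a' ⊗ₘ tshuffle b b') ≫ tensorμ _ _ _ _ ≫
        ((tappend a b r h ha hb).hom ⊗ₘ (tappend a' b' r' h ha' hb').hom)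
  | 0, n, k, a, a', b, b', r, r', h, ha, hb, ha', hb', Ha, Hb => by
    rw [tappend_zero, tappend_zero, tappend_zero]
    change ((λ_ (tpow fun j => b j ⊗ b' j)).hom ≫ eqToHom _) ≫ tshuffle r r' =
      ((λ_ (𝟙_ C)).inv ⊗ₘ tshuffle b b') ≫ tensorμ (𝟙_ C) (𝟙_ C) (tpow b) (tpow b') ≫
        ((λ_ (tpow b)).hom ≫ eqToHom _ ⊗ₘ (λ_ (tpow b')).hom ≫ eqToHom _)
    rw [Category.assoc, eqToHom_tshuffle (by omega) (fun j p e => (hb j p (by omega)).symm)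
        (fun j p e => (hb' j p (by omega)).symm), ← tensorHom_comp_tensorHom,
      MonoidalCategory.tensorHom_def' (λ_ (𝟙_ C)).inv, Category.assoc,
      ← tensor_left_unitality_assoc, leftUnitor_naturality_assoc]
  | m + 1, n, 0, _, _, _, _, _, _, h, _, _, _, _, _, _ => absurd h (by omega)
  | m + 1, n, k + 1, a, a', b, b', r, r', h, ha, hb, ha', hb', Ha, Hb => by
    have ih := tappend_tshuffle (fun j => a j.succ) (fun j => a' j.succ) b b'
      (fun j => r j.succ) (fun j => r' j.succ) (by omega)
      (fun l p e => ha l.succ p.succ (by simp [e]))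
      (fun l p e => hb l p.succ (by simp [e]; omega))
      (fun l p e => ha' l.succ p.succ (by simp [e]))
      (fun l p e => hb' l p.succ (by simp [e]; omega))
      (fun l p e => Ha l.succ p.succ (by simp [e]))
      (fun l p e => Hb l p.succ (by simp [e]; omega))
    have hα := tensor_associativity (a 0) (a' 0) (tpow fun j => a j.succ) (tpow fun j => a' j.succ)
      (tpow b) (tpow b')
    rw [tappend_succ, tappend_succ a, tappend_succ a']
    simp only [Category.assoc]
    rw [tcons_tshuffle, tensorHom_comp_tensorHom_assoc, ih,
      eqToHom_tensorHom _ (ha 0 0 rfl).symm (ha' 0 0 rfl).symm, Category.comp_id]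
    have e₁ {P Q : C} (p : (tpow fun j => a j.succ) ⊗ tpow b ⟶ P)
        (q : (tpow fun j => a' j.succ) ⊗ tpow b' ⟶ Q) :
        (eqToHom (ha 0 0 rfl).symm ⊗ₘ eqToHom (ha' 0 0 rfl).symm) ⊗ₘ
          ((tshuffle (fun j => a j.succ) (fun j => a' j.succ) ⊗ₘ tshuffle b b') ≫
            tensorμ _ _ _ _ ≫ (p ⊗ₘ q)) =
        (𝟙 _ ⊗ₘ (tshuffle (fun j => a j.succ) (fun j => a' j.succ) ⊗ₘ tshuffle b b')) ≫
          (𝟙 _ ⊗ₘ tensorμ _ _ _ _) ≫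
          ((eqToHom (ha 0 0 rfl).symm ⊗ₘ eqToHom (ha' 0 0 rfl).symm) ⊗ₘ (p ⊗ₘ q)) := by
      simp only [tensorHom_comp_tensorHom, Category.id_comp]
    have e₂ : tshuffle a a' ≫ ((tcons a).inv ⊗ₘ (tcons a').inv) ⊗ₘ tshuffle b b' =
        (tshuffle a a' ⊗ₘ tshuffle b b') ≫
          (((tcons a).inv ⊗ₘ (tcons a').inv) ⊗ₘ (𝟙 (tpow b) ⊗ₘ 𝟙 (tpow b'))) := by
      rw [tensorHom_comp_tensorHom, id_tensorHom_id, Category.comp_id]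
    rw [← tensorHom_id, ← id_tensorHom] at hα
    rw [e₁, Category.assoc, Category.assoc, ← associator_naturality_assoc, tensorμ_natural_assoc,
      ← reassoc_of% hα, tensorHom_comp_tensorHom_assoc, tensorHom_comp_tensorHom_assoc,
      Category.id_comp, Category.comp_id, Category.assoc, tcons_inv_tshuffle, e₂, Category.assoc,
      tensorμ_natural_assoc]
    simp only [tensorHom_comp_tensorHom]

lemma tappend_tunit : ∀ {m n k : ℕ} (h : k = m + n)
    (ha : ∀ (l : Fin m) (p : Fin k), (p : ℕ) = l → 𝟙_ C = 𝟙_ C)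
    (hb : ∀ (l : Fin n) (p : Fin k), (p : ℕ) = m + l → 𝟙_ C = 𝟙_ C),
    (tappend (fun _ => 𝟙_ C) (fun _ => 𝟙_ C) (fun _ => 𝟙_ C) h ha hb).hom ≫ tunit C k =
      (tunit C m ⊗ₘ tunit C n) ≫ (λ_ _).hom
  | 0, n, k, h, ha, hb => by
    rw [tappend_zero]
    change ((λ_ (tpow fun _ => 𝟙_ C)).hom ≫ eqToHom _) ≫ tunit C k =
      (𝟙 (𝟙_ C) ⊗ₘ tunit C n) ≫ (λ_ (𝟙_ C)).hom
    rw [Category.assoc, eqToHom_tunit (by omega)]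
    simp
  | m + 1, n, 0, h, _, _ => absurd h (by omega)
  | m + 1, n, k + 1, h, ha, hb => by
    have ih := tappend_tunit (m := m) (n := n) (k := k) (by omega)
      (fun _ _ _ => rfl) (fun _ _ _ => rfl)
    rw [tappend_succ]
    simp only [Category.assoc, eqToHom_refl]
    rw [tcons_tunit, tensorHom_comp_tensorHom_assoc, ih, Category.comp_id]
    have e₁ : 𝟙 (𝟙_ C) ⊗ₘ ((tunit C m ⊗ₘ tunit C n) ≫ (λ_ (𝟙_ C)).hom) =
        (𝟙 (𝟙_ C) ⊗ₘ (tunit C m ⊗ₘ tunit C n)) ≫ (𝟙 _ ⊗ₘ (λ_ (𝟙_ C)).hom) := by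
      rw [tensorHom_comp_tensorHom, Category.id_comp]
    have e₂ : (α_ (𝟙_ C) (𝟙_ C) (𝟙_ C)).hom ≫ (𝟙 _ ⊗ₘ (λ_ (𝟙_ C)).hom) =
        (λ_ (𝟙_ C)).hom ⊗ₘ 𝟙 _ := by
      rw [triangle_tensorHom, unitors_equal]
    rw [e₁, Category.assoc, ← associator_naturality_assoc, reassoc_of% e₂,
      tensorHom_comp_tensorHom_assoc, tensorHom_comp_tensorHom_assoc, Category.id_comp,
      Category.comp_id, Category.assoc, ← tcons_tunit, Iso.inv_hom_id_assoc]

end Coherence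

/-! ### Squares of parametrised morphisms -/

section EnrichedSquares

set_option linter.unusedSectionVars false

open SymmetricMonoidalEnriched

variable {E : Type w} [Category.{v} E] [MonoidalCategory E] [SymmetricCategory E]
  {C : Type w'} [Category.{v'} C] [MonoidalCategory C] [SymmetricCategory C]
  [EnrichedOrdinaryCategory E C]

/-- A commutative square in a category enriched over `E` whose horizontal sides `φ` and `ψ` are
morphisms parametrised by an object `W` of `E`, and whose vertical sides `t` and `t'` are morphisms
of the underlying category. -/
def EnrichedSquare {W : E} {g g' h h' : C} (φ : W ⟶ (g ⟶[E] g')) (ψ : W ⟶ (h ⟶[E] h'))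
    (t : g ⟶ h) (t' : g' ⟶ h') : Prop :=
  φ ≫ eHomWhiskerLeft E g t' = ψ ≫ eHomWhiskerRight E t h'

/-- Composing on the right of the middle object is the same as composing on its left. -/
lemma eHomWhiskerRight_eComp {x y y' z : C} (f : y ⟶ y') :
    ((x ⟶[E] y) ◁ eHomWhiskerRight E f z) ≫ eComp E x y z =
      (eHomWhiskerLeft E x f ▷ (y' ⟶[E] z)) ≫ eComp E x y' z := by
  simp only [eHomWhiskerLeft, eHomWhiskerRight, MonoidalCategory.whiskerLeft_comp,
    comp_whiskerRight, Category.assoc]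
  rw [← e_assoc, whisker_assoc_assoc]
  simp

lemma eHomEquiv_eHomWhiskerLeft {x y z : C} (f : x ⟶ y) (g : y ⟶ z) :
    eHomEquiv E f ≫ eHomWhiskerLeft E x g = eHomEquiv E (f ≫ g) := by
  rw [eHomWhiskerLeft, rightUnitor_inv_naturality_assoc, eHomEquiv_comp,
    MonoidalCategory.tensorHom_def, unitors_inv_equal, Category.assoc]

lemma eHomEquiv_eHomWhiskerRight {x y z : C} (f : x ⟶ y) (g : y ⟶ z) :
    eHomEquiv E g ≫ eHomWhiskerRight E f z = eHomEquiv E (f ≫ g) := by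
  rw [eHomWhiskerRight, leftUnitor_inv_naturality_assoc, eHomEquiv_comp,
    MonoidalCategory.tensorHom_def', Category.assoc]

namespace EnrichedSquare

lemma refl {W : E} {g g' : C} (φ : W ⟶ (g ⟶[E] g')) : EnrichedSquare φ φ (𝟙 g) (𝟙 g') := by
  simp [EnrichedSquare]

/-- Squares can be pasted along a common parametrised side. -/
lemma trans {W : E} {g g' h h' k k' : C} {φ : W ⟶ (g ⟶[E] g')} {ψ : W ⟶ (h ⟶[E] h')}
    {χ : W ⟶ (k ⟶[E] k')} {t : g ⟶ h} {t' : g' ⟶ h'} {s : h ⟶ k} {s' : h' ⟶ k'}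
    (H : EnrichedSquare φ ψ t t') (K : EnrichedSquare ψ χ s s') :
    EnrichedSquare φ χ (t ≫ s) (t' ≫ s') := by
  unfold EnrichedSquare at *
  rw [eHomWhiskerLeft_comp, eHomWhiskerRight_comp, reassoc_of% H, ← eHom_whisker_exchange,
    reassoc_of% K]

lemma symm {W : E} {g g' h h' : C} {φ : W ⟶ (g ⟶[E] g')} {ψ : W ⟶ (h ⟶[E] h')}
    {t : g ≅ h} {t' : g' ≅ h'} (H : EnrichedSquare φ ψ t.hom t'.hom) :
    EnrichedSquare ψ φ t.inv t'.inv := by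
  unfold EnrichedSquare at *
  have h₁ : ψ = φ ≫ eHomWhiskerLeft E g t'.hom ≫ eHomWhiskerRight E t.inv h' := by
    rw [reassoc_of% H, ← eHomWhiskerRight_comp]
    simp
  rw [h₁, Category.assoc, Category.assoc, ← eHom_whisker_exchange, ← eHomWhiskerLeft_comp_assoc]
  simp

lemma precomp {V W : E} {g g' h h' : C} {φ : W ⟶ (g ⟶[E] g')} {ψ : W ⟶ (h ⟶[E] h')}
    {t : g ⟶ h} {t' : g' ⟶ h'} (H : EnrichedSquare φ ψ t t') (w : V ⟶ W) :
    EnrichedSquare (w ≫ φ) (w ≫ ψ) t t' := by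
  unfold EnrichedSquare at *
  rw [Category.assoc, Category.assoc, H]

/-- The square which defines the transport of `ψ` along `t`. -/
lemma whiskerRight {W : E} {g h h' : C} (ψ : W ⟶ (h ⟶[E] h')) (t : g ⟶ h) :
    EnrichedSquare (ψ ≫ eHomWhiskerRight E t h') ψ t (𝟙 h') := by
  simp [EnrichedSquare]

/-- Replacement of the four sides of a square by equal ones. -/
lemma of_eq {W : E} {g g' h h' : C} {φ φ' : W ⟶ (g ⟶[E] g')} {ψ ψ' : W ⟶ (h ⟶[E] h')}
    {s t : g ⟶ h} {s' t' : g' ⟶ h'} (H : EnrichedSquare φ ψ t t') (hφ : φ' = φ) (hψ : ψ' = ψ)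
    (hs : s = t) (hs' : s' = t') : EnrichedSquare φ' ψ' s s' := by
  subst hφ hψ hs hs'
  exact H

lemma homEquiv {g g' h h' : C} {f : g ⟶ g'} {f' : h ⟶ h'} {t : g ⟶ h} {t' : g' ⟶ h'}
    (H : f ≫ t' = t ≫ f') : EnrichedSquare (eHomEquiv E f) (eHomEquiv E f') t t' := by
  rw [EnrichedSquare, eHomEquiv_eHomWhiskerLeft, eHomEquiv_eHomWhiskerRight, H]

end EnrichedSquare

variable [SymmetricMonoidalEnriched E C]

/-- The tensor product of two parametrised morphisms. -/
abbrev eTensorHom {V W : E} {x x' y y' : C} (φ : V ⟶ (x ⟶[E] x')) (ψ : W ⟶ (y ⟶[E] y')) :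
    V ⊗ W ⟶ ((x ⊗ y : C) ⟶[E] (x' ⊗ y' : C)) :=
  (φ ⊗ₘ ψ) ≫ eTensor E x x' y y'

lemma eHomWhiskerRight_eTensor {x₁ x₂ y₁ y₂ z₁ z₂ : C} (f : x₁ ⟶ y₁) (g : x₂ ⟶ y₂) :
    (eHomWhiskerRight E f z₁ ⊗ₘ eHomWhiskerRight E g z₂) ≫ eTensor E x₁ z₁ x₂ z₂ =
      eTensor E y₁ z₁ y₂ z₂ ≫ eHomWhiskerRight E (f ⊗ₘ g) (z₁ ⊗ z₂) := by
  have h : (λ_ ((y₁ ⟶[E] z₁) ⊗ (y₂ ⟶[E] z₂))).inv ≫ ((λ_ (𝟙_ E)).inv ▷ _) ≫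
      tensorμ (𝟙_ E) (𝟙_ E) (y₁ ⟶[E] z₁) (y₂ ⟶[E] z₂) = (λ_ _).inv ⊗ₘ (λ_ _).inv := by
    rw [Iso.inv_comp_eq, tensor_left_unitality]
    simp [tensorHom_comp_tensorHom]
  have e : (_ ◁ eTensor E y₁ z₁ y₂ z₂) ≫ (((λ_ (𝟙_ E)).inv ≫ (eHomEquiv E f ⊗ₘ eHomEquiv E g) ≫
        eTensor E x₁ y₁ x₂ y₂) ▷ _) =
      ((λ_ (𝟙_ E)).inv ▷ _) ≫ ((eHomEquiv E f ⊗ₘ eHomEquiv E g) ⊗ₘ (𝟙 _ ⊗ₘ 𝟙 _)) ≫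
        (eTensor E x₁ y₁ x₂ y₂ ⊗ₘ eTensor E y₁ z₁ y₂ z₂) := by
    simp only [← tensorHom_id, ← id_tensorHom, tensorHom_comp_tensorHom, Category.id_comp,
      Category.comp_id, id_tensorHom_id]
  simp only [eHomWhiskerRight, eHomEquiv_tensorHom]
  rw [leftUnitor_inv_naturality_assoc, reassoc_of% e, eTensor_comp, tensorμ_natural_assoc,
    reassoc_of% h]
  simp only [← tensorHom_id, tensorHom_comp_tensorHom_assoc]

lemma eHomWhiskerLeft_eTensor {x₁ x₂ y₁ y₂ z₁ z₂ : C} (f : y₁ ⟶ z₁) (g : y₂ ⟶ z₂) :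
    (eHomWhiskerLeft E x₁ f ⊗ₘ eHomWhiskerLeft E x₂ g) ≫ eTensor E x₁ z₁ x₂ z₂ =
      eTensor E x₁ y₁ x₂ y₂ ≫ eHomWhiskerLeft E (x₁ ⊗ x₂) (f ⊗ₘ g) := by
  have h : (ρ_ ((x₁ ⟶[E] y₁) ⊗ (x₂ ⟶[E] y₂))).inv ≫ (_ ◁ (λ_ (𝟙_ E)).inv) ≫
      tensorμ (x₁ ⟶[E] y₁) (x₂ ⟶[E] y₂) (𝟙_ E) (𝟙_ E) = (ρ_ _).inv ⊗ₘ (ρ_ _).inv := by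
    rw [Iso.inv_comp_eq, tensor_right_unitality]
    simp [tensorHom_comp_tensorHom]
  have e : (eTensor E x₁ y₁ x₂ y₂ ▷ _) ≫ (_ ◁ ((λ_ (𝟙_ E)).inv ≫
        (eHomEquiv E f ⊗ₘ eHomEquiv E g) ≫ eTensor E y₁ z₁ y₂ z₂)) =
      (_ ◁ (λ_ (𝟙_ E)).inv) ≫ ((𝟙 _ ⊗ₘ 𝟙 _) ⊗ₘ (eHomEquiv E f ⊗ₘ eHomEquiv E g)) ≫
        (eTensor E x₁ y₁ x₂ y₂ ⊗ₘ eTensor E y₁ z₁ y₂ z₂) := by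
    simp only [← tensorHom_id, ← id_tensorHom, tensorHom_comp_tensorHom, Category.id_comp,
      Category.comp_id, id_tensorHom_id]
  simp only [eHomWhiskerLeft, eHomEquiv_tensorHom]
  rw [rightUnitor_inv_naturality_assoc, reassoc_of% e, eTensor_comp, tensorμ_natural_assoc,
    reassoc_of% h]
  simp only [← id_tensorHom, tensorHom_comp_tensorHom_assoc]

namespace EnrichedSquare

/-- Squares can be tensored, by functoriality of the enriched tensor product. -/
lemma tensor {V W : E} {x x' y y' z z' t t' : C} {φ : V ⟶ (x ⟶[E] x')} {ψ : V ⟶ (y ⟶[E] y')}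
    {φ' : W ⟶ (z ⟶[E] z')} {ψ' : W ⟶ (t ⟶[E] t')} {a : x ⟶ y} {a' : x' ⟶ y'} {b : z ⟶ t}
    {b' : z' ⟶ t'} (H : EnrichedSquare φ ψ a a') (K : EnrichedSquare φ' ψ' b b') :
    EnrichedSquare (eTensorHom φ φ') (eTensorHom ψ ψ') (a ⊗ₘ b) (a' ⊗ₘ b') := by
  unfold EnrichedSquare at *
  rw [Category.assoc, Category.assoc, ← eHomWhiskerLeft_eTensor, ← eHomWhiskerRight_eTensor,
    tensorHom_comp_tensorHom_assoc, tensorHom_comp_tensorHom_assoc, H, K]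

lemma associator {U V W : E} {x x' y y' z z' : C} (f : U ⟶ (x ⟶[E] x')) (g : V ⟶ (y ⟶[E] y'))
    (h : W ⟶ (z ⟶[E] z')) :
    EnrichedSquare (eTensorHom (eTensorHom f g) h)
      ((α_ U V W).hom ≫ eTensorHom f (eTensorHom g h)) (α_ x y z).hom (α_ x' y' z').hom := by
  have H := associator_enatural (E := E) x x' y y' z z'
  have e₁ : eTensorHom (eTensorHom f g) h = ((f ⊗ₘ g) ⊗ₘ h) ≫ eTensor E x x' y y' ▷ _ ≫
      eTensor E _ _ _ _ := by
    rw [← tensorHom_id, tensorHom_comp_tensorHom_assoc, Category.comp_id]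
  have e₂ : eTensorHom f (eTensorHom g h) = (f ⊗ₘ (g ⊗ₘ h)) ≫ _ ◁ eTensor E y y' z z' ≫
      eTensor E _ _ _ _ := by
    rw [← id_tensorHom, tensorHom_comp_tensorHom_assoc, Category.comp_id]
  rw [EnrichedSquare, e₁, e₂, Category.assoc, Category.assoc, Category.assoc, Category.assoc,
    Category.assoc, H, associator_naturality_assoc]

lemma braiding {U V : E} {x x' y y' : C} (f : U ⟶ (x ⟶[E] x')) (g : V ⟶ (y ⟶[E] y')) :
    EnrichedSquare (eTensorHom f g) ((β_ U V).hom ≫ eTensorHom g f) (β_ x y).hom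
      (β_ x' y').hom := by
  rw [EnrichedSquare, Category.assoc, Category.assoc, Category.assoc,
    ← BraidedCategory.braiding_naturality_assoc, braiding_enatural]

lemma leftUnitor {U : E} {x x' : C} (f : U ⟶ (x ⟶[E] x')) :
    EnrichedSquare (eTensorHom (eId E (𝟙_ C)) f) ((λ_ U).hom ≫ f) (λ_ x).hom (λ_ x').hom := by
  have H := leftUnitor_enatural (E := E) x x'
  rw [EnrichedSquare, Category.assoc, Category.assoc, ← leftUnitor_naturality_assoc, ← H,
    MonoidalCategory.tensorHom_def', Category.assoc]

lemma rightUnitor {U : E} {x x' : C} (f : U ⟶ (x ⟶[E] x')) :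
    EnrichedSquare (eTensorHom f (eId E (𝟙_ C))) ((ρ_ U).hom ≫ f) (ρ_ x).hom (ρ_ x').hom := by
  have H := rightUnitor_enatural (E := E) x x'
  rw [EnrichedSquare, Category.assoc, Category.assoc, ← rightUnitor_naturality_assoc, ← H,
    MonoidalCategory.tensorHom_def, Category.assoc]

lemma associator_inv {U V W : E} {x x' y y' z z' : C} (f : U ⟶ (x ⟶[E] x'))
    (g : V ⟶ (y ⟶[E] y')) (h : W ⟶ (z ⟶[E] z')) :
    EnrichedSquare (eTensorHom f (eTensorHom g h))
      ((α_ U V W).inv ≫ eTensorHom (eTensorHom f g) h) (α_ x y z).inv (α_ x' y' z').inv := by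
  have H := (associator f g h).symm.precomp (α_ U V W).inv
  rwa [Iso.inv_hom_id_assoc] at H

/-- The middle interchange is natural for parametrised morphisms: it is built from the associator
and the braiding, and the same composite appears in `C` and in `E`. -/
lemma tensorμ {U₁ U₂ V₁ V₂ : E} {x₁ x₁' x₂ x₂' y₁ y₁' y₂ y₂' : C} (f₁ : U₁ ⟶ (x₁ ⟶[E] x₁'))
    (f₂ : U₂ ⟶ (x₂ ⟶[E] x₂')) (g₁ : V₁ ⟶ (y₁ ⟶[E] y₁')) (g₂ : V₂ ⟶ (y₂ ⟶[E] y₂')) :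
    EnrichedSquare (eTensorHom (eTensorHom f₁ f₂) (eTensorHom g₁ g₂))
      (MonoidalCategory.tensorμ U₁ U₂ V₁ V₂ ≫
        eTensorHom (eTensorHom f₁ g₁) (eTensorHom f₂ g₂))
      (MonoidalCategory.tensorμ x₁ x₂ y₁ y₂) (MonoidalCategory.tensorμ x₁' x₂' y₁' y₂') := by
  -- The five squares follow the factorisation of `tensorμ` into
  -- associator, inverse associator, braiding, associator, inverse associator.
  have s₁ := associator f₁ f₂ (eTensorHom g₁ g₂)
  have s₂ := (refl f₁).tensor (associator_inv f₂ g₁ g₂)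
  have s₃ := (refl f₁).tensor (((braiding f₂ g₁).tensor (refl g₂)).precomp (α_ U₂ V₁ V₂).inv)
  have s₄ := (refl f₁).tensor ((associator g₁ f₂ g₂).precomp
    ((α_ U₂ V₁ V₂).inv ≫ (β_ U₂ V₁).hom ▷ V₂))
  have s₅ := associator_inv f₁ g₁ (eTensorHom f₂ g₂)
  have e₃ : (α_ U₂ V₁ V₂).inv ≫ eTensorHom ((β_ U₂ V₁).hom ≫ eTensorHom g₁ f₂) g₂ =
      ((α_ U₂ V₁ V₂).inv ≫ (β_ U₂ V₁).hom ▷ V₂) ≫ eTensorHom (eTensorHom g₁ f₂) g₂ := by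
    rw [← tensorHom_id, Category.assoc, tensorHom_comp_tensorHom_assoc, Category.id_comp]
  rw [e₃] at s₃
  have e₄ : eTensorHom f₁ (((α_ U₂ V₁ V₂).inv ≫ (β_ U₂ V₁).hom ▷ V₂) ≫
      (α_ V₁ U₂ V₂).hom ≫ eTensorHom g₁ (eTensorHom f₂ g₂)) =
      (U₁ ◁ ((α_ U₂ V₁ V₂).inv ≫ (β_ U₂ V₁).hom ▷ V₂ ≫ (α_ V₁ U₂ V₂).hom)) ≫
        eTensorHom f₁ (eTensorHom g₁ (eTensorHom f₂ g₂)) := by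
    rw [← id_tensorHom, tensorHom_comp_tensorHom_assoc, Category.id_comp]
    simp only [Category.assoc]
  rw [e₄] at s₄
  have s := s₁.trans (((s₂.trans s₃).trans (s₄.trans (s₅.precomp _))).precomp (α_ U₁ U₂ _).hom)
  refine s.of_eq rfl ?_ ?_ ?_ <;> simp [MonoidalCategory.tensorμ]

end EnrichedSquare

lemma comp_eWhiskerRight {W : E} {x x' : C} (φ : W ⟶ (x ⟶[E] x')) (z : C) :
    φ ≫ eWhiskerRight E x x' z = (ρ_ W).inv ≫ eTensorHom φ (eId E z) := by
  dsimp only [eTensorHom]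
  rw [eWhiskerRight, rightUnitor_inv_naturality_assoc, MonoidalCategory.tensorHom_def,
    Category.assoc]

lemma comp_eWhiskerLeft {W : E} {x x' : C} (φ : W ⟶ (x ⟶[E] x')) (z : C) :
    φ ≫ eWhiskerLeft E z x x' = (λ_ W).inv ≫ eTensorHom (eId E z) φ := by
  dsimp only [eTensorHom]
  rw [eWhiskerLeft, leftUnitor_inv_naturality_assoc, MonoidalCategory.tensorHom_def',
    Category.assoc]

lemma eWhiskerRight_square {W : E} {x x' y y' : C} {φ : W ⟶ (x ⟶[E] x')} {ψ : W ⟶ (y ⟶[E] y')}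
    {t : x ⟶ y} {t' : x' ⟶ y'} (H : EnrichedSquare φ ψ t t') (z : C) :
    EnrichedSquare (φ ≫ eWhiskerRight E x x' z) (ψ ≫ eWhiskerRight E y y' z) (t ▷ z) (t' ▷ z) := by
  refine ((H.tensor (EnrichedSquare.refl (eId E z))).precomp (ρ_ W).inv).of_eq ?_ ?_
    (tensorHom_id _ _).symm (tensorHom_id _ _).symm
  all_goals exact comp_eWhiskerRight _ _

lemma eWhiskerLeft_square {W : E} {x x' y y' : C} {φ : W ⟶ (x ⟶[E] x')} {ψ : W ⟶ (y ⟶[E] y')}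
    {t : x ⟶ y} {t' : x' ⟶ y'} (H : EnrichedSquare φ ψ t t') (z : C) :
    EnrichedSquare (φ ≫ eWhiskerLeft E z x x') (ψ ≫ eWhiskerLeft E z y y') (z ◁ t) (z ◁ t') := by
  refine (((EnrichedSquare.refl (eId E z)).tensor H).precomp (λ_ W).inv).of_eq ?_ ?_
    (id_tensorHom _ _).symm (id_tensorHom _ _).symm
  all_goals exact comp_eWhiskerLeft _ _

/-- Parametrised morphisms tensored with an identity may also be transported along a morphism of
the fixed factor. -/
lemma eWhiskerRight_exchange {W : E} {x x' z z' : C} (φ : W ⟶ (x ⟶[E] x')) (f : z ⟶ z') :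
    EnrichedSquare (φ ≫ eWhiskerRight E x x' z) (φ ≫ eWhiskerRight E x x' z') (x ◁ f)
      (x' ◁ f) := by
  have h : EnrichedSquare (eId E z) (eId E z') f f := by
    rw [← eHomEquiv_id, ← eHomEquiv_id]
    exact EnrichedSquare.homEquiv (by simp)
  refine (((EnrichedSquare.refl φ).tensor h).precomp (ρ_ W).inv).of_eq ?_ ?_
    (id_tensorHom _ _).symm (id_tensorHom _ _).symm
  all_goals exact comp_eWhiskerRight _ _

/-- Tensoring `f ⊗ g` on the right with an identity of `z ⊗ z'` is, up to middle interchange,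
tensoring `f` with an identity of `z` and `g` with an identity of `z'`. -/
lemma eTensor_eWhiskerRight (x x' y y' z z' : C) :
    EnrichedSquare (eTensor E x x' y y' ≫ eWhiskerRight E (x ⊗ y) (x' ⊗ y') (z ⊗ z'))
      (eTensorHom (eWhiskerRight E x x' z) (eWhiskerRight E y y' z'))
      (tensorμ x y z z') (tensorμ x' y' z z') := by
  have h : (ρ_ ((x ⟶[E] x') ⊗ (y ⟶[E] y'))).inv ≫ (_ ◁ (λ_ (𝟙_ E)).inv) ≫
      tensorμ (x ⟶[E] x') (y ⟶[E] y') (𝟙_ E) (𝟙_ E) = (ρ_ _).inv ⊗ₘ (ρ_ _).inv := by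
    rw [Iso.inv_comp_eq, tensor_right_unitality]
    simp [tensorHom_comp_tensorHom]
  refine ((EnrichedSquare.tensorμ (𝟙 (x ⟶[E] x')) (𝟙 (y ⟶[E] y')) (eId E z) (eId E z')).precomp
    ((ρ_ _).inv ≫ (_ ◁ (λ_ (𝟙_ E)).inv))).of_eq ?_ ?_ rfl rfl
  · rw [comp_eWhiskerRight, ← eTensor_id]
    simp only [eTensorHom, ← id_tensorHom, tensorHom_comp_tensorHom_assoc, Category.id_comp,
      id_tensorHom_id, Category.assoc]
  · rw [Category.assoc, reassoc_of% h, tensorHom_comp_tensorHom_assoc, eWhiskerRight, eWhiskerRight]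
    simp only [eTensorHom, id_tensorHom]

lemma eTensor_eWhiskerLeft (x x' y y' z z' : C) :
    EnrichedSquare (eTensor E x x' y y' ≫ eWhiskerLeft E (z ⊗ z') (x ⊗ y) (x' ⊗ y'))
      (eTensorHom (eWhiskerLeft E z x x') (eWhiskerLeft E z' y y'))
      (tensorμ z z' x y) (tensorμ z z' x' y') := by
  have h : (λ_ ((x ⟶[E] x') ⊗ (y ⟶[E] y'))).inv ≫ ((λ_ (𝟙_ E)).inv ▷ _) ≫
      tensorμ (𝟙_ E) (𝟙_ E) (x ⟶[E] x') (y ⟶[E] y') = (λ_ _).inv ⊗ₘ (λ_ _).inv := by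
    rw [Iso.inv_comp_eq, tensor_left_unitality]
    simp [tensorHom_comp_tensorHom]
  refine ((EnrichedSquare.tensorμ (eId E z) (eId E z') (𝟙 (x ⟶[E] x')) (𝟙 (y ⟶[E] y'))).precomp
    ((λ_ _).inv ≫ ((λ_ (𝟙_ E)).inv ▷ _))).of_eq ?_ ?_ rfl rfl
  · rw [comp_eWhiskerLeft, ← eTensor_id]
    simp only [eTensorHom, ← tensorHom_id, tensorHom_comp_tensorHom_assoc, Category.id_comp,
      id_tensorHom_id, Category.assoc]
  · rw [Category.assoc, reassoc_of% h, tensorHom_comp_tensorHom_assoc, eWhiskerLeft, eWhiskerLeft]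
    simp only [eTensorHom, tensorHom_id]

lemma eHomEquiv_eWhiskerRight {x y : C} (f : x ⟶ y) (z : C) :
    eHomEquiv E f ≫ eWhiskerRight E x y z = eHomEquiv E (f ▷ z) := by
  rw [← tensorHom_id, eHomEquiv_tensorHom, eHomEquiv_id, eWhiskerRight,
    rightUnitor_inv_naturality_assoc, MonoidalCategory.tensorHom_def, unitors_inv_equal,
    Category.assoc]

lemma eHomEquiv_eWhiskerLeft {x y : C} (f : x ⟶ y) (z : C) :
    eHomEquiv E f ≫ eWhiskerLeft E z x y = eHomEquiv E (z ◁ f) := by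
  rw [← id_tensorHom, eHomEquiv_tensorHom, eHomEquiv_id, eWhiskerLeft,
    leftUnitor_inv_naturality_assoc, MonoidalCategory.tensorHom_def', Category.assoc]

/-! ### Insertion of an operation at one place -/

/-- Inserting an operation at the first place means tensoring it with the identity of the other
factors, up to splitting its inputs off from the tuple `r`. -/
lemma tevalAt_zero {W : E} {n m k : ℕ} (c : Fin (n + 1) → C) (h₀ : 0 < n + 1) (x : C)
    (c' : Fin m → C) (r : Fin k → C) (h : IsInsertion c ⟨0, h₀⟩ x c' r)
    (φ : W ⟶ (tpow c' ⟶[E] x)) :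
    EnrichedSquare (φ ≫ eWhiskerRight E (tpow c') x (tpow fun j => c j.succ))
      (φ ≫ tevalAt E c ⟨0, h₀⟩ x c' r h)
      (tappend c' (fun j => c j.succ) r (by have := h.length; omega)
        (fun l p e => h.inner l p (by simpa using e))
        (fun l p e => h.outer l.succ p (Or.inr ⟨by simp, by simp [e]; omega⟩))).hom
      ((eqToIso h.colour.symm ⊗ᵢ Iso.refl _) ≪≫ tcons c).hom := by
  have e : tevalAt E c ⟨0, h₀⟩ x c' r h =
      eWhiskerRight E (tpow c') x (tpow fun j => c j.succ) ≫
        eHomWhiskerLeft E _ (eqToHom h.colour.symm ▷ (tpow fun j => c j.succ) ≫ (tcons c).hom) ≫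
        eHomWhiskerRight E
          (tappend c' (fun j => c j.succ) r (by have := h.length; omega)
            (fun l p e => h.inner l p (by simpa using e))
            (fun l p e => h.outer l.succ p (Or.inr ⟨by simp, by simp [e]; omega⟩))).inv _ := by
    cases k <;> rfl
  rw [EnrichedSquare, e, Category.assoc, Category.assoc, Category.assoc, Category.assoc,
    ← eHomWhiskerRight_comp, Iso.hom_inv_id, eHomWhiskerRight_id, Category.comp_id]
  simp
  rfl

/-- Inserting an operation at a later place means inserting it among the factors after the first
one, and tensoring with the identity of the first factor. -/
lemma tevalAt_succ {W : E} {n m k i : ℕ} (c : Fin (n + 1) → C) (hi : i + 1 < n + 1) (x : C)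
    (c' : Fin m → C) (r : Fin (k + 1) → C) (h : IsInsertion c ⟨i + 1, hi⟩ x c' r)
    (φ : W ⟶ (tpow c' ⟶[E] x)) :
    EnrichedSquare
      (φ ≫ tevalAt E (fun j => c j.succ) ⟨i, by omega⟩ x c' (fun j => r j.succ) h.tail ≫
        eWhiskerLeft E (c 0) _ _)
      (φ ≫ tevalAt E c ⟨i + 1, hi⟩ x c' r h)
      ((eqToIso (h.outer 0 0 (Or.inl ⟨by simp, rfl⟩)).symm ⊗ᵢ Iso.refl _) ≪≫ tcons r).hom
      (tcons c).hom := by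
  have e : tevalAt E c ⟨i + 1, hi⟩ x c' r h =
      tevalAt E (fun j => c j.succ) ⟨i, by omega⟩ x c' (fun j => r j.succ) h.tail ≫
        eWhiskerLeft E (c 0) _ _ ≫ eHomWhiskerLeft E _ (tcons c).hom ≫
        eHomWhiskerRight E
          ((tcons r).inv ≫ eqToHom (h.outer 0 0 (Or.inl ⟨by simp, rfl⟩)) ▷ _) _ := rfl
  rw [EnrichedSquare, e]
  simp only [Category.assoc]
  rw [← eHomWhiskerRight_comp]
  simp

end EnrichedSquares

/-! ### The tensor product and the unit of `C` as morphisms of operads -/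

section EndOperad

set_option linter.unusedSectionVars false

open SymmetricMonoidalEnriched

variable {E : Type w} [Category.{v} E] [MonoidalCategory E] [SymmetricCategory E]
  {C : Type w'} [Category.{v'} C] [MonoidalCategory C] [SymmetricCategory C]
  [EnrichedOrdinaryCategory E C] [SymmetricMonoidalEnriched E C]

lemma eqToIso_tcons_tshuffle {n : ℕ} (x y : Fin (n + 1) → C) {a b : C} (ha : a = x 0)
    (hb : b = y 0) (hab : a ⊗ b = x 0 ⊗ y 0) :
    ((eqToIso hab ⊗ᵢ Iso.refl _) ≪≫ tcons fun j => x j ⊗ y j).hom ≫ tshuffle x y =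
      (𝟙 _ ⊗ₘ tshuffle (fun j => x j.succ) fun j => y j.succ) ≫ tensorμ _ _ _ _ ≫
        (((eqToIso ha ⊗ᵢ Iso.refl _) ≪≫ tcons x).hom ⊗ₘ
          ((eqToIso hb ⊗ᵢ Iso.refl _) ≪≫ tcons y).hom) := by
  subst ha hb
  simpa using tcons_tshuffle x y

/-- Inserting a tensor product of two operations is the tensor product of the insertions, up to
reordering the factors. -/
lemma tevalAt_tshuffle : ∀ {n m k : ℕ} (c₁ c₂ : Fin n → C) (i : Fin n) (x₁ x₂ : C)
    (c₁' c₂' : Fin m → C) (r₁ r₂ : Fin k → C) (h₁ : IsInsertion c₁ i x₁ c₁' r₁)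
    (h₂ : IsInsertion c₂ i x₂ c₂' r₂)
    (h : IsInsertion (fun j => c₁ j ⊗ c₂ j) i (x₁ ⊗ x₂) (fun j => c₁' j ⊗ c₂' j)
      (fun j => r₁ j ⊗ r₂ j)),
    EnrichedSquare ((eTensor E (tpow c₁') x₁ (tpow c₂') x₂ ≫
        eHomWhiskerRight E (tshuffle c₁' c₂') (x₁ ⊗ x₂)) ≫ tevalAt E _ i _ _ _ h)
      (eTensorHom (tevalAt E c₁ i x₁ c₁' r₁ h₁) (tevalAt E c₂ i x₂ c₂' r₂ h₂))
      (tshuffle r₁ r₂) (tshuffle c₁ c₂)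
  | 0, _, _, _, _, i, _, _, _, _, _, _, _, _, _ => i.elim0
  | n + 1, m, k, c₁, c₂, ⟨0, h₀⟩, x₁, x₂, c₁', c₂', r₁, r₂, h₁, h₂, h => by
    -- The inserted operation is unshuffled, then the other factors are, and the two halves are
    -- separated by a middle interchange.
    have s₁ := (tevalAt_zero (E := E) _ h₀ _ _ _ h (eTensor E (tpow c₁') x₁ (tpow c₂') x₂ ≫
      eHomWhiskerRight E (tshuffle c₁' c₂') (x₁ ⊗ x₂))).symm
    have s₂ := eWhiskerRight_square (EnrichedSquare.whiskerRight
      (eTensor E (tpow c₁') x₁ (tpow c₂') x₂) (tshuffle c₁' c₂'))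
      (tpow fun j => c₁ j.succ ⊗ c₂ j.succ)
    have s₃ := eWhiskerRight_exchange (eTensor E (tpow c₁') x₁ (tpow c₂') x₂)
      (tshuffle (fun j => c₁ j.succ) (fun j => c₂ j.succ))
    have s₄ := eTensor_eWhiskerRight (E := E) (tpow c₁') x₁ (tpow c₂') x₂
      (tpow fun j => c₁ j.succ) (tpow fun j => c₂ j.succ)
    have s₅ := (tevalAt_zero (E := E) _ h₀ _ _ _ h₁ (𝟙 _)).tensor
      (tevalAt_zero (E := E) _ h₀ _ _ _ h₂ (𝟙 _))
    simp only [Category.id_comp] at s₅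
    refine (s₁.trans (s₂.trans (s₃.trans (s₄.trans s₅)))).of_eq rfl rfl ?_ ?_
    · have ht := tappend_tshuffle c₁' c₂' (fun j => c₁ j.succ) (fun j => c₂ j.succ) r₁ r₂
        (by have := h.length; omega)
        (fun l p e => h₁.inner l p (by simpa using e))
        (fun l p e => h₁.outer l.succ p (Or.inr ⟨by simp, by simp [e]; omega⟩))
        (fun l p e => h₂.inner l p (by simpa using e))
        (fun l p e => h₂.outer l.succ p (Or.inr ⟨by simp, by simp [e]; omega⟩))
        (fun l p e => h.inner l p (by simpa using e))
        (fun l p e => h.outer l.succ p (Or.inr ⟨by simp, by simp [e]; omega⟩))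
      rw [Iso.eq_inv_comp, ht, MonoidalCategory.tensorHom_def]
      simp only [Category.assoc]
    · rw [Iso.eq_inv_comp, id_whiskerRight, Category.id_comp, ← id_tensorHom]
      exact eqToIso_tcons_tshuffle c₁ c₂ h₁.colour.symm h₂.colour.symm h.colour.symm
  | n + 1, m, 0, _, _, ⟨_ + 1, _⟩, _, _, _, _, _, _, h, _, _ => absurd h.length (by omega)
  | n + 1, m, k + 1, c₁, c₂, ⟨i + 1, hi⟩, x₁, x₂, c₁', c₂', r₁, r₂, h₁, h₂, h => by
    have ih := tevalAt_tshuffle (fun j => c₁ j.succ) (fun j => c₂ j.succ) ⟨i, by omega⟩ x₁ x₂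
      c₁' c₂' (fun j => r₁ j.succ) (fun j => r₂ j.succ) h₁.tail h₂.tail h.tail
    have s₁ := (tevalAt_succ (E := E) _ hi _ _ _ h (eTensor E (tpow c₁') x₁ (tpow c₂') x₂ ≫
      eHomWhiskerRight E (tshuffle c₁' c₂') (x₁ ⊗ x₂))).symm
    have s₂ := eWhiskerLeft_square ih (c₁ 0 ⊗ c₂ 0)
    have s₃ := (eTensor_eWhiskerLeft (E := E) (tpow fun j => r₁ j.succ) (tpow fun j => c₁ j.succ)
      (tpow fun j => r₂ j.succ) (tpow fun j => c₂ j.succ) (c₁ 0) (c₂ 0)).precomp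
      (tevalAt E (fun j => c₁ j.succ) ⟨i, by omega⟩ x₁ c₁' (fun j => r₁ j.succ) h₁.tail ⊗ₘ
        tevalAt E (fun j => c₂ j.succ) ⟨i, by omega⟩ x₂ c₂' (fun j => r₂ j.succ) h₂.tail)
    have s₄ := (tevalAt_succ (E := E) _ hi _ _ _ h₁ (𝟙 _)).tensor
      (tevalAt_succ (E := E) _ hi _ _ _ h₂ (𝟙 _))
    simp only [Category.id_comp, eTensorHom] at s₄
    simp only [eTensorHom, tensorHom_comp_tensorHom_assoc, Category.assoc] at s₁ s₂ s₃
    refine (s₁.trans (s₂.trans (s₃.trans s₄))).of_eq (Category.assoc _ _ _) rfl ?_ ?_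
    · rw [Iso.eq_inv_comp, ← id_tensorHom]
      exact eqToIso_tcons_tshuffle r₁ r₂ _ _ _
    · rw [Iso.eq_inv_comp, tcons_tshuffle, id_tensorHom]

/-- Inserting the canonical map `𝟙 ⊗ ⋯ ⊗ 𝟙 ⟶ 𝟙` at one place and then multiplying the remaining
units is the canonical map. -/
lemma tevalAt_tunit : ∀ {n m k : ℕ} (i : Fin n)
    (h : IsInsertion (fun _ : Fin n => 𝟙_ C) i (𝟙_ C) (fun _ : Fin m => 𝟙_ C)
      (fun _ : Fin k => 𝟙_ C)),
    EnrichedSquare (eHomEquiv E (tunit C m) ≫ tevalAt E _ i _ _ _ h) (eHomEquiv E (𝟙 (𝟙_ C)))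
      (tunit C k) (tunit C n)
  | 0, _, _, i, _ => i.elim0
  | n + 1, m, k, ⟨0, h₀⟩, h => by
    have s₁ := (tevalAt_zero (E := E) _ h₀ _ _ _ h (eHomEquiv E (tunit C m))).symm
    rw [eHomEquiv_eWhiskerRight] at s₁
    have s₂ : EnrichedSquare (eHomEquiv E (tunit C m ▷ tpow fun _ : Fin n => 𝟙_ C))
        (eHomEquiv E (𝟙 (𝟙_ C))) ((tunit C m ⊗ₘ tunit C n) ≫ (λ_ _).hom)
        ((𝟙 _ ⊗ₘ tunit C n) ≫ (λ_ _).hom) := EnrichedSquare.homEquiv (by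
      rw [← tensorHom_id, tensorHom_comp_tensorHom_assoc]
      simp only [Category.id_comp, Category.comp_id])
    refine (s₁.trans s₂).of_eq rfl rfl ?_ ?_
    · rw [Iso.eq_inv_comp, tappend_tunit]
    · rw [Iso.eq_inv_comp, ← tcons_tunit]
      simp
  | n + 1, m, 0, ⟨_ + 1, _⟩, h => absurd h.length (by omega)
  | n + 1, m, k + 1, ⟨i + 1, hi⟩, h => by
    have ih := tevalAt_tunit (n := n) (m := m) (k := k) ⟨i, by omega⟩ h.tail
    have s₁ := (tevalAt_succ (E := E) _ hi _ _ _ h (eHomEquiv E (tunit C m))).symm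
    have s₂ := eWhiskerLeft_square ih (𝟙_ C)
    rw [eHomEquiv_eWhiskerLeft] at s₂
    have s₃ : EnrichedSquare (eHomEquiv E (𝟙_ C ◁ 𝟙 (𝟙_ C))) (eHomEquiv E (𝟙 (𝟙_ C)))
        (λ_ _).hom (λ_ _).hom := EnrichedSquare.homEquiv (by simp)
    rw [Category.assoc] at s₂
    refine (s₁.trans (s₂.trans s₃)).of_eq rfl rfl ?_ ?_
    · rw [Iso.eq_inv_comp, ← id_tensorHom, ← tcons_tunit]
      simp
    · rw [Iso.eq_inv_comp, ← id_tensorHom, ← tcons_tunit]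

lemma tensorHom_eHomWhiskerRight_eComp {A B : E} {x y y' z : C} (f : A ⟶ (x ⟶[E] y))
    (g : B ⟶ (y' ⟶[E] z)) (t : y ⟶ y') :
    (f ⊗ₘ g ≫ eHomWhiskerRight E t z) ≫ eComp E x y z =
      (f ≫ eHomWhiskerLeft E x t ⊗ₘ g) ≫ eComp E x y' z := by
  rw [← Category.comp_id f, ← tensorHom_comp_tensorHom, id_tensorHom, Category.assoc,
    eHomWhiskerRight_eComp, ← tensorHom_id, tensorHom_comp_tensorHom_assoc, Category.comp_id,
    Category.comp_id]

lemma eHomWhiskerRight_tensorHom_eComp {A B : E} {x x' y z : C} (f : A ⟶ (x' ⟶[E] y))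
    (g : B ⟶ (y ⟶[E] z)) (t : x ⟶ x') :
    (f ≫ eHomWhiskerRight E t y ⊗ₘ g) ≫ eComp E x y z =
      (f ⊗ₘ g) ≫ eComp E x' y z ≫ eHomWhiskerRight E t z := by
  rw [eComp_eHomWhiskerRight, ← tensorHom_id, tensorHom_comp_tensorHom_assoc, Category.comp_id]

lemma eTensorHom_tensorHom_eTensor {A B Z : E} {x x' x'' y y' y'' : C} (f : A ⟶ (x ⟶[E] x'))
    (g : B ⟶ (y ⟶[E] y')) (k : ((x ⊗ y : C) ⟶[E] (x'' ⊗ y'' : C)) ⟶ Z) :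
    (eTensorHom f g ⊗ₘ eTensor E x' x'' y' y'') ≫ eComp E _ _ _ ≫ k =
      tensorμ _ _ _ _ ≫ (((f ⊗ₘ 𝟙 _) ≫ eComp E x x' x'') ⊗ₘ ((g ⊗ₘ 𝟙 _) ≫ eComp E y y' y'')) ≫
        eTensor E x x'' y y'' ≫ k := by
  have e : eTensorHom f g ⊗ₘ eTensor E x' x'' y' y'' =
      ((f ⊗ₘ g) ⊗ₘ (𝟙 _ ⊗ₘ 𝟙 _)) ≫ (eTensor E x x' y y' ⊗ₘ eTensor E x' x'' y' y'') := by
    rw [tensorHom_comp_tensorHom, id_tensorHom_id, Category.id_comp]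
  have h := eTensor_comp (E := E) x x' x'' y y' y''
  rw [e, Category.assoc, reassoc_of% h, tensorμ_natural_assoc, tensorHom_comp_tensorHom_assoc]

variable (E C)

/-- The tensor product of `C` induces a morphism `End(C) ⊗ End(C) ⟶ End(C)`. -/
lemma endTensor_isMorphism : (endTensor E C).IsMorphism where
  act_map {m n c c'} e h d := by
    dsimp only
    rw [reassoc_of% eHomWhiskerRight_eTensor, ← eHomWhiskerRight_comp, Category.assoc,
      ← eHomWhiskerRight_comp, tpermute_tshuffle]
  unit_map x := by
    dsimp only
    -- the shuffle of a single pair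
    have h : tshuffle (fun _ : Fin 1 => x.1) (fun _ : Fin 1 => x.2) = 𝟙 _ := rfl
    rw [h]
    refine (congrArg (_ ≫ ·) ((congrArg (_ ≫ ·) (eHomWhiskerRight_id E _ _)).trans
      (Category.comp_id _))).trans ((Category.assoc _ _ _).trans (eTensor_id _ _))
  comp_map {n m k c i x c' r} h d := by
    dsimp only
    have s := tevalAt_tshuffle (E := E) _ _ _ _ _ _ _ _ _ (h.map Prod.fst) (h.map Prod.snd)
      (h.map fun x => x.1 ⊗ x.2)
    unfold EnrichedSquare at s
    rw [BraidedCategory.braiding_naturality_assoc, ← tensorHom_id, ← tensorHom_id, ← tensorHom_id,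
      tensorHom_comp_tensorHom_assoc, Category.comp_id, tensorHom_eHomWhiskerRight_eComp, s,
      eHomWhiskerRight_tensorHom_eComp, eTensorHom_tensorHom_eTensor,
      ← tensorμ_braiding_assoc]
    simp only [tensorHom_comp_tensorHom_assoc, Category.assoc]

/-- The unit of `C` defines a morphism `uCom ⟶ End(C)`. -/
lemma endUnit_isMorphism : (endUnit.{u} E C).IsMorphism where
  act_map e _ _ := by
    dsimp only
    rw [Category.id_comp, eHomEquiv_eHomWhiskerRight, tpermute_tunit]
  unit_map _ := (Category.id_comp _).trans (eHomEquiv_id _ _)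
  comp_map {n m k c i x c' r} h d := by
    dsimp only
    have s := tevalAt_tunit (E := E) _ (h.map fun _ => 𝟙_ C)
    unfold EnrichedSquare at s
    rw [eHomEquiv_eHomWhiskerRight, Category.comp_id] at s
    rw [BraidedCategory.braiding_naturality_assoc, ← tensorHom_id, tensorHom_comp_tensorHom_assoc,
      Category.comp_id, ← s, eHomWhiskerLeft,
      rightUnitor_inv_naturality_assoc, MonoidalCategory.tensorHom_def, braiding_tensorUnit_left]
    simp only [Category.assoc]

end EndOperad

/-! ### External tensor products of algebras -/

section Algebras

open SymmetricMonoidalEnriched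

set_option linter.unusedSectionVars false

variable {E : Type w} [Category.{v} E] [MonoidalCategory E] [SymmetricCategory E]
  {C : Type w'} [Category.{v'} C] [MonoidalCategory C] [SymmetricCategory C]
  [EnrichedOrdinaryCategory E C] [SymmetricMonoidalEnriched E C]

/-- The external tensor product `A ◇ B` as an algebra. -/
abbrev Algebra.diamond {P Q : Operad.{u} E} (A : Algebra C P) (B : Algebra C Q) :
    Algebra C (P.hadamard Q) where
  toMap := ColouredOperads.diamond A B
  isMorphism := (A.isMorphism.hadamard B.isMorphism).comp (endTensor_isMorphism E C)

variable (E C) in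
/-- The unit of `C` as an algebra over `uCom`. -/
abbrev Algebra.unit : Algebra C (Operad.uCom.{u} E) where
  toMap := endUnit E C
  isMorphism := endUnit_isMorphism E C

/-- The iterated tensor product of isomorphisms. -/
abbrev tpowIso {n : ℕ} {x y : Fin n → C} (f : ∀ j, x j ≅ y j) : tpow x ≅ tpow y where
  hom := tpowMap fun j => (f j).hom
  inv := tpowMap fun j => (f j).inv
  hom_inv_id := by
    rw [← tpowMap_comp]
    simp only [Iso.hom_inv_id, tpowMap_id]
  inv_hom_id := by
    rw [← tpowMap_comp]
    simp only [Iso.inv_hom_id, tpowMap_id]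

namespace EnrichedSquare

/-- A precomposition of the left vertical side can be absorbed in the parametrised side. -/
lemma comp_whiskerRight {W : E} {g g' h h' h'' : C} {φ : W ⟶ (g ⟶[E] g')} {ψ : W ⟶ (h' ⟶[E] h'')}
    {s : h ⟶ h'} {t : g ⟶ h} {t' : g' ⟶ h''} (H : EnrichedSquare φ ψ (t ≫ s) t') :
    EnrichedSquare φ (ψ ≫ eHomWhiskerRight E s h'') t t' := by
  unfold EnrichedSquare at *
  rw [H, Category.assoc, ← eHomWhiskerRight_comp]

/-- The external tensor product of two squares. This makes `A ◇ B` functorial in `A` and `B`. -/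
lemma diamond {V W : E} {n : ℕ} {x y x' y' : Fin n → C} {a b a' b' : C}
    {φ : V ⟶ (tpow x ⟶[E] a)} {ψ : V ⟶ (tpow y ⟶[E] b)} {φ' : W ⟶ (tpow x' ⟶[E] a')}
    {ψ' : W ⟶ (tpow y' ⟶[E] b')} {f : ∀ j, x j ⟶ y j} {f' : ∀ j, x' j ⟶ y' j} {s : a ⟶ b}
    {s' : a' ⟶ b'} (H : EnrichedSquare φ ψ (tpowMap f) s)
    (H' : EnrichedSquare φ' ψ' (tpowMap f') s') :
    EnrichedSquare
      ((φ ⊗ₘ φ') ≫ eTensor E (tpow x) a (tpow x') a' ≫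
        eHomWhiskerRight E (tshuffle x x') (a ⊗ a'))
      ((ψ ⊗ₘ ψ') ≫ eTensor E (tpow y) b (tpow y') b' ≫
        eHomWhiskerRight E (tshuffle y y') (b ⊗ b'))
      (tpowMap fun j => f j ⊗ₘ f' j) (s ⊗ₘ s') := by
  rw [← Category.assoc, ← Category.assoc]
  refine comp_whiskerRight ?_
  rw [tpowMap_tshuffle]
  exact ((whiskerRight _ _).trans (H.tensor H')).of_eq rfl rfl rfl (Category.id_comp _).symm

/-! For a family of isomorphisms in `C` over an isomorphism `e` of `E`, one square yields the
squares for the inverse family, for the inverse of `e`, and for both. -/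

section Iso

variable {V W : E} {n : ℕ} {x y : Fin n → C} {a b : C} {φ : V ⟶ (tpow x ⟶[E] a)}
  {ψ : W ⟶ (tpow y ⟶[E] b)} {e : V ≅ W} {f : ∀ j, x j ≅ y j} {g : a ≅ b}

lemma reverse (H : EnrichedSquare φ (e.hom ≫ ψ) (tpowMap fun j => (f j).hom) g.hom) :
    EnrichedSquare (e.hom ≫ ψ) φ (tpowMap fun j => (f j).inv) g.inv :=
  symm (t := tpowIso f) H

lemma inv_precomp (H : EnrichedSquare φ (e.hom ≫ ψ) (tpowMap fun j => (f j).hom) g.hom) :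
    EnrichedSquare (e.inv ≫ φ) ψ (tpowMap fun j => (f j).hom) g.hom := by
  simpa using H.precomp e.inv

lemma inv_reverse (H : EnrichedSquare φ (e.hom ≫ ψ) (tpowMap fun j => (f j).hom) g.hom) :
    EnrichedSquare ψ (e.inv ≫ φ) (tpowMap fun j => (f j).inv) g.inv :=
  symm (t := tpowIso f) H.inv_precomp

end Iso

end EnrichedSquare

/-- The external tensor product of two operations with inputs indexed by the same set. -/
abbrev eDiamond {V W : E} {n : ℕ} {x y : Fin n → C} {a b : C} (φ : V ⟶ (tpow x ⟶[E] a))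
    (ψ : W ⟶ (tpow y ⟶[E] b)) : V ⊗ W ⟶ (tpow (fun j => x j ⊗ y j) ⟶[E] a ⊗ b) :=
  (φ ⊗ₘ ψ) ≫ eTensor E (tpow x) a (tpow y) b ≫ eHomWhiskerRight E (tshuffle x y) (a ⊗ b)

lemma eTensorHom_comp_eHomWhiskerRight {V W : E} {x x' y y' z : C} (φ : V ⟶ (x ⟶[E] x'))
    (ψ : W ⟶ (y ⟶[E] y')) (t : z ⟶ y) :
    eTensorHom φ (ψ ≫ eHomWhiskerRight E t y') =
      eTensorHom φ ψ ≫ eHomWhiskerRight E (𝟙 x ⊗ₘ t) (x' ⊗ y') := by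
  rw [eTensorHom, eTensorHom, Category.assoc, ← eHomWhiskerRight_eTensor, eHomWhiskerRight_id,
    tensorHom_comp_tensorHom_assoc, Category.comp_id]

namespace EnrichedSquare

variable {U V W : E} {n : ℕ} {x y z : Fin n → C} {a b d : C}

lemma eDiamond_eTensorHom (φ : U ⟶ (tpow x ⟶[E] a)) (ψ : V ⟶ (tpow y ⟶[E] b)) :
    EnrichedSquare (eDiamond φ ψ) (eTensorHom φ ψ) (tshuffle x y) (𝟙 (a ⊗ b)) :=
  (whiskerRight _ _).of_eq (Category.assoc _ _ _).symm rfl rfl rfl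

lemma comp_eDiamond {T : E} {g g' : C} {χ : T ⟶ (g ⟶[E] g')} {e : T ⟶ U ⊗ V}
    {φ : U ⟶ (tpow x ⟶[E] a)} {ψ : V ⟶ (tpow y ⟶[E] b)}
    {t : g ⟶ tpow fun j => x j ⊗ y j} {t' : g' ⟶ a ⊗ b}
    (H : EnrichedSquare χ (e ≫ eTensorHom φ ψ) (t ≫ tshuffle x y) t') :
    EnrichedSquare χ (e ≫ eDiamond φ ψ) t t' :=
  H.comp_whiskerRight.of_eq rfl (by simp only [eTensorHom, Category.assoc]) rfl rfl

/-- External tensor products are associative. -/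
lemma eDiamond_associator (φ : U ⟶ (tpow x ⟶[E] a)) (ψ : V ⟶ (tpow y ⟶[E] b))
    (χ : W ⟶ (tpow z ⟶[E] d)) :
    EnrichedSquare (eDiamond (eDiamond φ ψ) χ) ((α_ U V W).hom ≫ eDiamond φ (eDiamond ψ χ))
      (tpowMap fun j => (α_ (x j) (y j) (z j)).hom) (α_ a b d).hom := by
  refine comp_eDiamond ?_
  have h : eTensorHom φ (eDiamond ψ χ) =
      eTensorHom φ (eTensorHom ψ χ) ≫ eHomWhiskerRight E (𝟙 (tpow x) ⊗ₘ tshuffle y z) _ := by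
    rw [← eTensorHom_comp_eHomWhiskerRight, eTensorHom, eTensorHom, Category.assoc]
  -- Both shuffles of the target are absorbed in the vertical side, where the coherence of the
  -- shuffle with the associator applies.
  rw [h, ← Category.assoc]
  refine comp_whiskerRight ?_
  refine ((eDiamond_eTensorHom (eDiamond φ ψ) χ).trans
    (((eDiamond_eTensorHom φ ψ).tensor (refl χ)).trans (associator φ ψ χ))).of_eq rfl rfl
      ((Category.assoc _ _ _).trans (tshuffle_associator x y z).symm) (by simp)

lemma eDiamond_leftUnitor (φ : U ⟶ (tpow x ⟶[E] a)) :
    EnrichedSquare (eDiamond (eHomEquiv E (tunit C n)) φ) ((λ_ U).hom ≫ φ)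
      (tpowMap fun j => (λ_ (x j)).hom) (λ_ a).hom := by
  have h : EnrichedSquare (eHomEquiv E (tunit C n)) (eId E (𝟙_ C)) (tunit C n) (𝟙 (𝟙_ C)) :=
    (homEquiv (t := tunit C n) (t' := 𝟙 _) (f' := 𝟙 _) rfl).of_eq rfl
      (eHomEquiv_id E _).symm rfl rfl
  exact ((eDiamond_eTensorHom _ φ).trans ((h.tensor (refl φ)).trans (leftUnitor φ))).of_eq rfl rfl
    (tshuffle_leftUnitor x).symm (by simp)

lemma eDiamond_rightUnitor (φ : U ⟶ (tpow x ⟶[E] a)) :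
    EnrichedSquare (eDiamond φ (eHomEquiv E (tunit C n))) ((ρ_ U).hom ≫ φ)
      (tpowMap fun j => (ρ_ (x j)).hom) (ρ_ a).hom := by
  have h : EnrichedSquare (eHomEquiv E (tunit C n)) (eId E (𝟙_ C)) (tunit C n) (𝟙 (𝟙_ C)) :=
    (homEquiv (t := tunit C n) (t' := 𝟙 _) (f' := 𝟙 _) rfl).of_eq rfl
      (eHomEquiv_id E _).symm rfl rfl
  exact ((eDiamond_eTensorHom φ _).trans (((refl φ).tensor h).trans (rightUnitor φ))).of_eq rfl rfl
    (tshuffle_rightUnitor x).symm (by simp)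

/-- External tensor products are commutative. -/
lemma eDiamond_braiding (φ : U ⟶ (tpow x ⟶[E] a)) (ψ : V ⟶ (tpow y ⟶[E] b)) :
    EnrichedSquare (eDiamond φ ψ) ((β_ U V).hom ≫ eDiamond ψ φ)
      (tpowMap fun j => (β_ (x j) (y j)).hom) (β_ a b).hom :=
  comp_eDiamond (((eDiamond_eTensorHom φ ψ).trans (braiding φ ψ)).of_eq rfl rfl
    (tshuffle_braiding x y).symm (Category.id_comp _).symm)

end EnrichedSquare

namespace Algebra

variable {P Q R : Operad.{u} E} (A : Algebra C P) (B : Algebra C Q) (D : Algebra C R)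

/-- The associator of `C` is a morphism of algebras `(A ◇ B) ◇ D ⟶ A ◇ (B ◇ D)` over the associator
of the category of operads. -/
lemma associator_square {n : ℕ} (c : Fin n → (P.Ob × Q.Ob) × R.Ob) (d : (P.Ob × Q.Ob) × R.Ob) :
    EnrichedSquare (((A.diamond B).diamond D).map c d)
      ((α_ (P.ops (fun j => (c j).1.1) d.1.1) (Q.ops (fun j => (c j).1.2) d.1.2)
        (R.ops (fun j => (c j).2) d.2)).hom ≫ (A.diamond (B.diamond D)).map
        (fun j => ((c j).1.1, (c j).1.2, (c j).2)) (d.1.1, d.1.2, d.2))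
      (tpowMap fun j => (α_ (A.obj (c j).1.1) (B.obj (c j).1.2) (D.obj (c j).2)).hom)
      (α_ (A.obj d.1.1) (B.obj d.1.2) (D.obj d.2)).hom :=
  EnrichedSquare.eDiamond_associator _ _ _

lemma leftUnitor_square {n : ℕ} (c : Fin n → PUnit.{u + 1} × P.Ob) (d : PUnit.{u + 1} × P.Ob) :
    EnrichedSquare (((Algebra.unit E C).diamond A).map c d)
      ((λ_ (P.ops (fun j => (c j).2) d.2)).hom ≫ A.map (fun j => (c j).2) d.2)
      (tpowMap fun j => (λ_ (A.obj (c j).2)).hom) (λ_ (A.obj d.2)).hom :=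
  EnrichedSquare.eDiamond_leftUnitor _

lemma rightUnitor_square {n : ℕ} (c : Fin n → P.Ob × PUnit.{u + 1}) (d : P.Ob × PUnit.{u + 1}) :
    EnrichedSquare ((A.diamond (Algebra.unit E C)).map c d)
      ((ρ_ (P.ops (fun j => (c j).1) d.1)).hom ≫ A.map (fun j => (c j).1) d.1)
      (tpowMap fun j => (ρ_ (A.obj (c j).1)).hom) (ρ_ (A.obj d.1)).hom :=
  EnrichedSquare.eDiamond_rightUnitor _

lemma braiding_square {n : ℕ} (c : Fin n → P.Ob × Q.Ob) (d : P.Ob × Q.Ob) :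
    EnrichedSquare ((A.diamond B).map c d)
      ((β_ (P.ops (fun j => (c j).1) d.1) (Q.ops (fun j => (c j).2) d.2)).hom ≫
        (B.diamond A).map (fun j => ((c j).2, (c j).1)) (d.2, d.1))
      (tpowMap fun j => (β_ (A.obj (c j).1) (B.obj (c j).2)).hom)
      (β_ (A.obj d.1) (B.obj d.2)).hom :=
  EnrichedSquare.eDiamond_braiding _ _

end Algebra

end Algebras

/-! ### The symmetric monoidal category of operads with an algebra -/

section OpAlg

set_option linter.unusedSectionVars false

variable {E : Type w} [Category.{v} E] [MonoidalCategory E] [SymmetricCategory E]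
  {C : Type w'} [Category.{v'} C] [MonoidalCategory C] [SymmetricCategory C]
  [EnrichedOrdinaryCategory E C] [SymmetricMonoidalEnriched E C]

namespace OpAlg

/-- The tensor product `(P, A) ⊗ (Q, B) = (P ⊗ Q, A ◇ B)`. -/
abbrev tensorObj (X Y : OpAlg.{u} E C) : OpAlg.{u} E C :=
  ⟨X.operad.hadamard Y.operad, X.alg.diamond Y.alg⟩

/-- The tensor product of morphisms. -/
abbrev tensorHom {X X' Y Y' : OpAlg.{u} E C} (φ : X.Hom X') (ψ : Y.Hom Y') :
    (X.tensorObj Y).Hom (X'.tensorObj Y') where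
  base := φ.base ⊗ₘ ψ.base
  fiber :=
    { app := fun x => φ.app x.1 ⊗ₘ ψ.app x.2
      naturality := fun c d =>
        (EnrichedSquare.diamond
          (Algebra.Hom.naturality φ.fiber (fun j => (c j).1) d.1)
          (Algebra.Hom.naturality ψ.fiber (fun j => (c j).2) d.2)).of_eq rfl
          (tensorHom_comp_tensorHom_assoc _ _ _ _ _) rfl rfl }

/-- The structure morphisms are those of the category of operads and, on underlying objects, those
of `C`. The instance is scoped, like the next ones, since the monoidal structure is not part of the
definition of the category. -/
scoped instance monoidalCategoryStruct : MonoidalCategoryStruct (OpAlg.{u} E C) where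
  tensorObj X Y := X.tensorObj Y
  tensorUnit := ⟨Operad.uCom E, Algebra.unit E C⟩
  tensorHom φ ψ := tensorHom φ ψ
  whiskerLeft X _ _ ψ := tensorHom (𝟙 X) ψ
  whiskerRight φ Y := tensorHom φ (𝟙 Y)
  associator X Y Z :=
    { hom :=
        { base := (α_ X.operad Y.operad Z.operad).hom
          fiber :=
            { app := fun x => (α_ (X.carrier x.1.1) (Y.carrier x.1.2) (Z.carrier x.2)).hom
              naturality := fun c d => Algebra.associator_square X.alg Y.alg Z.alg c d } }
      inv :=
        { base := (α_ X.operad Y.operad Z.operad).inv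
          fiber :=
            { app := fun x => (α_ (X.carrier x.1) (Y.carrier x.2.1) (Z.carrier x.2.2)).inv
              naturality := fun c d => (Algebra.associator_square X.alg Y.alg Z.alg
                (fun j => (((c j).1, (c j).2.1), (c j).2.2)) ((d.1, d.2.1), d.2.2)).inv_reverse } }
      hom_inv_id := OpAlg.Hom.ext (α_ X.operad Y.operad Z.operad).hom_inv_id fun _ =>
        (Category.comp_id _).trans (Iso.hom_inv_id _)
      inv_hom_id := OpAlg.Hom.ext (α_ X.operad Y.operad Z.operad).inv_hom_id fun _ =>
        (Category.comp_id _).trans (Iso.inv_hom_id _) }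
  leftUnitor X :=
    { hom :=
        { base := (λ_ X.operad).hom
          fiber :=
            { app := fun x => (λ_ (X.carrier x.2)).hom
              naturality := fun c d => Algebra.leftUnitor_square X.alg c d } }
      inv :=
        { base := (λ_ X.operad).inv
          fiber :=
            { app := fun x => (λ_ (X.carrier x)).inv
              naturality := fun c d => (Algebra.leftUnitor_square X.alg
                (fun j => (⟨⟩, c j)) (⟨⟩, d)).inv_reverse } }
      hom_inv_id := OpAlg.Hom.ext (λ_ X.operad).hom_inv_id fun _ =>
        (Category.comp_id _).trans (Iso.hom_inv_id _)
      inv_hom_id := OpAlg.Hom.ext (λ_ X.operad).inv_hom_id fun _ =>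
        (Category.comp_id _).trans (Iso.inv_hom_id _) }
  rightUnitor X :=
    { hom :=
        { base := (ρ_ X.operad).hom
          fiber :=
            { app := fun x => (ρ_ (X.carrier x.1)).hom
              naturality := fun c d => Algebra.rightUnitor_square X.alg c d } }
      inv :=
        { base := (ρ_ X.operad).inv
          fiber :=
            { app := fun x => (ρ_ (X.carrier x)).inv
              naturality := fun c d => (Algebra.rightUnitor_square X.alg
                (fun j => (c j, ⟨⟩)) (d, ⟨⟩)).inv_reverse } }
      hom_inv_id := OpAlg.Hom.ext (ρ_ X.operad).hom_inv_id fun _ =>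
        (Category.comp_id _).trans (Iso.hom_inv_id _)
      inv_hom_id := OpAlg.Hom.ext (ρ_ X.operad).inv_hom_id fun _ =>
        (Category.comp_id _).trans (Iso.inv_hom_id _) }

scoped instance monoidalCategory : MonoidalCategory (OpAlg.{u} E C) := MonoidalCategory.ofTensorHom
  (id_tensorHom_id := fun X Y => OpAlg.Hom.ext (id_tensorHom_id X.operad Y.operad) fun _ =>
    (Category.comp_id _).trans (id_tensorHom_id _ _))
  (id_tensorHom := fun _ _ _ _ => rfl)
  (tensorHom_id := fun _ _ => rfl)
  (tensorHom_comp_tensorHom := fun φ ψ φ' ψ' => OpAlg.Hom.ext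
    (tensorHom_comp_tensorHom (Hom.base φ) (Hom.base ψ) (Hom.base φ') (Hom.base ψ')) fun _ =>
      (Category.comp_id _).trans (tensorHom_comp_tensorHom _ _ _ _))
  (associator_naturality := fun φ ψ χ => OpAlg.Hom.ext
    (associator_naturality (Hom.base φ) (Hom.base ψ) (Hom.base χ)) fun _ =>
      (Category.comp_id _).trans (associator_naturality _ _ _))
  (leftUnitor_naturality := fun φ => OpAlg.Hom.ext
    ((congrArg (· ≫ _) (id_tensorHom _ _)).trans (leftUnitor_naturality (Hom.base φ))) fun _ =>
      (Category.comp_id _).trans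
        ((congrArg (· ≫ _) (id_tensorHom _ _)).trans (leftUnitor_naturality _)))
  (rightUnitor_naturality := fun φ => OpAlg.Hom.ext
    ((congrArg (· ≫ _) (tensorHom_id _ _)).trans (rightUnitor_naturality (Hom.base φ))) fun _ =>
      (Category.comp_id _).trans
        ((congrArg (· ≫ _) (tensorHom_id _ _)).trans (rightUnitor_naturality _)))
  (pentagon := fun X Y Z W => OpAlg.Hom.ext
    (pentagon_tensorHom X.operad Y.operad Z.operad W.operad) fun _ =>
      (Category.comp_id _).trans (pentagon_tensorHom (E := C) _ _ _ _))
  (triangle := fun X Y => OpAlg.Hom.ext (triangle_tensorHom X.operad Y.operad) fun _ =>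
    (Category.comp_id _).trans (triangle_tensorHom (E := C) _ _))

/-- The symmetry. -/
abbrev braiding (X Y : OpAlg.{u} E C) : (X.tensorObj Y).Hom (Y.tensorObj X) where
  base := (β_ X.operad Y.operad).hom
  fiber :=
    { app := fun x => (β_ (X.carrier x.1) (Y.carrier x.2)).hom
      naturality := fun c d => Algebra.braiding_square X.alg Y.alg c d }

lemma symmetry (X Y : OpAlg.{u} E C) :
    (braiding X Y : X ⊗ Y ⟶ Y ⊗ X) ≫ (braiding Y X : Y ⊗ X ⟶ X ⊗ Y) = 𝟙 (X ⊗ Y) :=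
  OpAlg.Hom.ext (SymmetricCategory.symmetry X.operad Y.operad) fun _ =>
    (Category.comp_id _).trans (SymmetricCategory.symmetry _ _)

scoped instance symmetricCategory : SymmetricCategory (OpAlg.{u} E C) where
  braiding X Y :=
    { hom := braiding X Y
      inv := braiding Y X
      hom_inv_id := symmetry X Y
      inv_hom_id := symmetry Y X }
  braiding_naturality_right X _ _ φ := OpAlg.Hom.ext
    (BraidedCategory.braiding_naturality (𝟙 X.operad) (Hom.base φ)) fun _ =>
      (Category.comp_id _).trans (BraidedCategory.braiding_naturality _ _)
  braiding_naturality_left φ X := OpAlg.Hom.ext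
    (BraidedCategory.braiding_naturality (Hom.base φ) (𝟙 X.operad)) fun _ =>
      (Category.comp_id _).trans (BraidedCategory.braiding_naturality _ _)
  hexagon_forward X Y Z := OpAlg.Hom.ext
    (hexagon_forward_tensorHom X.operad Y.operad Z.operad) fun _ =>
      (Category.comp_id _).trans (hexagon_forward_tensorHom (E := C) _ _ _)
  hexagon_reverse X Y Z := OpAlg.Hom.ext
    (hexagon_reverse_tensorHom X.operad Y.operad Z.operad) fun _ =>
      (Category.comp_id _).trans (hexagon_reverse_tensorHom (E := C) _ _ _)
  symmetry := symmetry

end OpAlg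

end OpAlg

/-! ### The symmetric monoidal category of operads with a coalgebra -/

section OpCog

set_option linter.unusedSectionVars false

variable {E : Type w} [Category.{v} E] [MonoidalCategory E] [SymmetricCategory E]
  {C : Type w'} [Category.{v'} C] [MonoidalCategory C] [SymmetricCategory C]
  [EnrichedOrdinaryCategory E C] [SymmetricMonoidalEnriched E C]

namespace OpCog

/-- A morphism given by a morphism of operads and a family of morphisms of `C`. The compatibility
with the operations is a family of squares in `Cᵒᵖ`. -/
abbrev mkHom {X Y : OpCog.{u} E C} (f : X.operad ⟶ Y.operad)
    (g : ∀ x, X.carrier x ⟶ Y.carrier ((OperadData.Hom.toMap f).obj x))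
    (H : ∀ {n : ℕ} (c : Fin n → X.Ob) (d : X.Ob),
      EnrichedSquare ((OperadData.Hom.toMap f).map c d ≫ Y.cog.unop.map _ _) (X.cog.unop.map c d)
        (tpowMap fun j => (g (c j)).op) (g d).op) : X.Hom Y where
  base := f
  fiber := Quiver.Hom.op
    { app := fun x => (g x).op
      naturality := H }

/-- The tensor product `(P, V) ⊗ (Q, W) = (P ⊗ Q, V ◇ W)`. -/
abbrev tensorObj (X Y : OpCog.{u} E C) : OpCog.{u} E C :=
  ⟨X.operad.hadamard Y.operad, op (X.cog.unop.diamond Y.cog.unop)⟩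

/-- The tensor product of morphisms. -/
abbrev tensorHom {X X' Y Y' : OpCog.{u} E C} (φ : X.Hom X') (ψ : Y.Hom Y') :
    (X.tensorObj Y).Hom (X'.tensorObj Y') :=
  mkHom (φ.base ⊗ₘ ψ.base) (fun x => φ.app x.1 ⊗ₘ ψ.app x.2)
    fun c d =>
      (EnrichedSquare.diamond
        (Algebra.Hom.naturality φ.fiber.unop (fun j => (c j).1) d.1)
        (Algebra.Hom.naturality ψ.fiber.unop (fun j => (c j).2) d.2)).of_eq
          (tensorHom_comp_tensorHom_assoc _ _ _ _ _) rfl rfl rfl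

/-- The structure morphisms are those of the category of operads and, on underlying objects, those
of `C`. In `Cᵒᵖ` they are the inverses of the associator and the unitors, so the squares are used in
the reverse direction. -/
scoped instance monoidalCategoryStruct : MonoidalCategoryStruct (OpCog.{u} E C) where
  tensorObj X Y := X.tensorObj Y
  tensorUnit := ⟨Operad.uCom E, op (Algebra.unit E Cᵒᵖ)⟩
  tensorHom φ ψ := tensorHom φ ψ
  whiskerLeft X _ _ ψ := tensorHom (𝟙 X) ψ
  whiskerRight φ Y := tensorHom φ (𝟙 Y)
  associator X Y Z :=
    { hom :=
        mkHom (α_ X.operad Y.operad Z.operad).hom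
          (fun x => (α_ (X.carrier x.1.1) (Y.carrier x.1.2) (Z.carrier x.2)).hom)
          fun c d => (Algebra.associator_square X.cog.unop Y.cog.unop Z.cog.unop c d).reverse
      inv :=
        mkHom (α_ X.operad Y.operad Z.operad).inv
          (fun x => (α_ (X.carrier x.1) (Y.carrier x.2.1) (Z.carrier x.2.2)).inv)
          fun c d => (Algebra.associator_square X.cog.unop Y.cog.unop Z.cog.unop
            (fun j => (((c j).1, (c j).2.1), (c j).2.2)) ((d.1, d.2.1), d.2.2)).inv_precomp
      hom_inv_id := OpCog.Hom.ext (α_ X.operad Y.operad Z.operad).hom_inv_id fun _ =>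
        (Category.comp_id _).trans (Iso.hom_inv_id _)
      inv_hom_id := OpCog.Hom.ext (α_ X.operad Y.operad Z.operad).inv_hom_id fun _ =>
        (Category.comp_id _).trans (Iso.inv_hom_id _) }
  leftUnitor X :=
    { hom :=
        mkHom (λ_ X.operad).hom (fun x => (λ_ (X.carrier x.2)).hom)
          fun c d => (Algebra.leftUnitor_square X.cog.unop c d).reverse
      inv :=
        mkHom (λ_ X.operad).inv (fun x => (λ_ (X.carrier x)).inv)
          fun c d => (Algebra.leftUnitor_square X.cog.unop
            (fun j => (⟨⟩, c j)) (⟨⟩, d)).inv_precomp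
      hom_inv_id := OpCog.Hom.ext (λ_ X.operad).hom_inv_id fun _ =>
        (Category.comp_id _).trans (Iso.hom_inv_id _)
      inv_hom_id := OpCog.Hom.ext (λ_ X.operad).inv_hom_id fun _ =>
        (Category.comp_id _).trans (Iso.inv_hom_id _) }
  rightUnitor X :=
    { hom :=
        mkHom (ρ_ X.operad).hom (fun x => (ρ_ (X.carrier x.1)).hom)
          fun c d => (Algebra.rightUnitor_square X.cog.unop c d).reverse
      inv :=
        mkHom (ρ_ X.operad).inv (fun x => (ρ_ (X.carrier x)).inv)
          fun c d => (Algebra.rightUnitor_square X.cog.unop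
            (fun j => (c j, ⟨⟩)) (d, ⟨⟩)).inv_precomp
      hom_inv_id := OpCog.Hom.ext (ρ_ X.operad).hom_inv_id fun _ =>
        (Category.comp_id _).trans (Iso.hom_inv_id _)
      inv_hom_id := OpCog.Hom.ext (ρ_ X.operad).inv_hom_id fun _ =>
        (Category.comp_id _).trans (Iso.inv_hom_id _) }

scoped instance monoidalCategory : MonoidalCategory (OpCog.{u} E C) := MonoidalCategory.ofTensorHom
  (id_tensorHom_id := fun X Y => OpCog.Hom.ext (id_tensorHom_id X.operad Y.operad) fun _ =>
    (Category.comp_id _).trans (id_tensorHom_id _ _))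
  (id_tensorHom := fun _ _ _ _ => rfl)
  (tensorHom_id := fun _ _ => rfl)
  (tensorHom_comp_tensorHom := fun φ ψ φ' ψ' => OpCog.Hom.ext
    (tensorHom_comp_tensorHom (Hom.base φ) (Hom.base ψ) (Hom.base φ') (Hom.base ψ')) fun _ =>
      (Category.comp_id _).trans (tensorHom_comp_tensorHom _ _ _ _))
  (associator_naturality := fun φ ψ χ => OpCog.Hom.ext
    (associator_naturality (Hom.base φ) (Hom.base ψ) (Hom.base χ)) fun _ =>
      (Category.comp_id _).trans (associator_naturality _ _ _))
  (leftUnitor_naturality := fun φ => OpCog.Hom.ext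
    ((congrArg (· ≫ _) (id_tensorHom _ _)).trans (leftUnitor_naturality (Hom.base φ))) fun _ =>
      (Category.comp_id _).trans
        ((congrArg (· ≫ _) (id_tensorHom _ _)).trans (leftUnitor_naturality _)))
  (rightUnitor_naturality := fun φ => OpCog.Hom.ext
    ((congrArg (· ≫ _) (tensorHom_id _ _)).trans (rightUnitor_naturality (Hom.base φ))) fun _ =>
      (Category.comp_id _).trans
        ((congrArg (· ≫ _) (tensorHom_id _ _)).trans (rightUnitor_naturality _)))
  (pentagon := fun X Y Z W => OpCog.Hom.ext
    (pentagon_tensorHom X.operad Y.operad Z.operad W.operad) fun _ =>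
      (Category.comp_id _).trans (pentagon_tensorHom (E := C) _ _ _ _))
  (triangle := fun X Y => OpCog.Hom.ext (triangle_tensorHom X.operad Y.operad) fun _ =>
    (Category.comp_id _).trans (triangle_tensorHom (E := C) _ _))

/-- The symmetry. Its square is that of the symmetry `W ◇ V ⟶ V ◇ W` of algebras in `Cᵒᵖ`, composed
with the symmetry of `E`. -/
abbrev braiding (X Y : OpCog.{u} E C) : (X.tensorObj Y).Hom (Y.tensorObj X) :=
  mkHom ((β_ X.operad Y.operad).hom) (fun x => (β_ (X.carrier x.1) (Y.carrier x.2)).hom)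
      fun c d =>
        ((Algebra.braiding_square Y.cog.unop X.cog.unop (fun j => ((c j).2, (c j).1))
          (d.2, d.1)).precomp (β_ (X.operad.ops _ _) (Y.operad.ops _ _)).hom).of_eq rfl
            (SymmetricCategory.symmetry_assoc _ _ _).symm rfl rfl

lemma symmetry (X Y : OpCog.{u} E C) :
    (braiding X Y : X ⊗ Y ⟶ Y ⊗ X) ≫ (braiding Y X : Y ⊗ X ⟶ X ⊗ Y) = 𝟙 (X ⊗ Y) :=
  OpCog.Hom.ext (SymmetricCategory.symmetry X.operad Y.operad) fun _ =>
    (Category.comp_id _).trans (SymmetricCategory.symmetry _ _)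

scoped instance symmetricCategory : SymmetricCategory (OpCog.{u} E C) where
  braiding X Y :=
    { hom := braiding X Y
      inv := braiding Y X
      hom_inv_id := symmetry X Y
      inv_hom_id := symmetry Y X }
  braiding_naturality_right X _ _ φ := OpCog.Hom.ext
    (BraidedCategory.braiding_naturality (𝟙 X.operad) (Hom.base φ)) fun _ =>
      (Category.comp_id _).trans (BraidedCategory.braiding_naturality _ _)
  braiding_naturality_left φ X := OpCog.Hom.ext
    (BraidedCategory.braiding_naturality (Hom.base φ) (𝟙 X.operad)) fun _ =>
      (Category.comp_id _).trans (BraidedCategory.braiding_naturality _ _)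
  hexagon_forward X Y Z := OpCog.Hom.ext
    (hexagon_forward_tensorHom X.operad Y.operad Z.operad) fun _ =>
      (Category.comp_id _).trans (hexagon_forward_tensorHom (E := C) _ _ _)
  hexagon_reverse X Y Z := OpCog.Hom.ext
    (hexagon_reverse_tensorHom X.operad Y.operad Z.operad) fun _ =>
      (Category.comp_id _).trans (hexagon_reverse_tensorHom (E := C) _ _ _)
  symmetry := symmetry

end OpCog

end OpCog

/-! ### Coherence conditions for strict monoidal functors -/

section StrictFunctors

variable {D : Type w} [Category.{v} D] [MonoidalCategory D]

/-! The associativity and unitality conditions of a strict monoidal functor, whose structure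
morphisms are identities. -/

lemma id_whiskerRight_comp_eq {X Y Z W : D} (e : (X ⊗ Y) ⊗ Z ⟶ W ⊗ (Y ⊗ Z)) :
    𝟙 (X ⊗ Y) ▷ Z ≫ 𝟙 _ ≫ e = e ≫ W ◁ 𝟙 (Y ⊗ Z) ≫ 𝟙 _ := by
  simp

lemma eq_id_whiskerRight_comp {X U Y : D} (e : U ⊗ X ⟶ Y) : e = 𝟙 U ▷ X ≫ 𝟙 _ ≫ e := by
  simp

lemma eq_whiskerLeft_id_comp {X U Y : D} (e : X ⊗ U ⟶ Y) : e = X ◁ 𝟙 U ≫ 𝟙 _ ≫ e := by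
  simp

end StrictFunctors

/-! ### The fibration of algebras over operads -/

section AlgebraFibration

set_option linter.unusedSectionVars false

variable {E : Type w} [Category.{v} E] [MonoidalCategory E] [SymmetricCategory E]
  {C : Type w'} [Category.{v'} C] [MonoidalCategory C] [SymmetricCategory C]
  [EnrichedOrdinaryCategory E C] [SymmetricMonoidalEnriched E C]

namespace OpAlg

lemma Hom.app_congr {X Y : OpAlg.{u} E C} {φ ψ : X.Hom Y} (h : φ = ψ) (x : X.Ob) :
    φ.app x ≫ eqToHom (by rw [h]) = ψ.app x := by
  subst h
  exact Category.comp_id _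

/-- A factorisation through a morphism with invertible components is determined by its base. -/
lemma comp_right_cancel {X Y Z : OpAlg.{u} E C} {φ : X ⟶ Y} (hφ : ∀ x, IsIso (Hom.app φ x))
    {χ χ' : Z ⟶ X} (h : Hom.base χ = Hom.base χ') (h' : χ ≫ φ = χ' ≫ φ) : χ = χ' := by
  obtain ⟨g, k⟩ := χ
  obtain ⟨g', k'⟩ := χ'
  obtain rfl : g = g' := h
  refine OpAlg.Hom.ext rfl fun x => (Category.comp_id _).trans ?_
  have := hφ ((OperadData.Hom.toMap g).obj x)
  exact (cancel_mono (Hom.app φ ((OperadData.Hom.toMap g).obj x))).1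
    ((Category.comp_id _).symm.trans (Hom.app_congr h' x))

/-- If the components of `φ` are invertible, a morphism to its target factors through `φ` as soon as
its base does. -/
lemma exists_lift {X Y Z : OpAlg.{u} E C} (φ : X.Hom Y) (hφ : ∀ x, IsIso (φ.app x))
    (ψ : Z.Hom Y) (g : Z.operad ⟶ X.operad) (h : g ≫ φ.base = ψ.base) :
    ∃ χ : Z.Hom X, χ.base = g ∧ CategoryStruct.comp (obj := OpAlg.{u} E C) χ φ = ψ := by
  obtain ⟨f, k⟩ := ψ
  obtain rfl : g ≫ φ.base = f := h
  let χ : Z.Hom X :=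
    { base := g
      fiber :=
        { app := fun x => k.app x ≫ inv (φ.app ((OperadData.Hom.toMap g).obj x))
          naturality := fun c d => by
            have s : EnrichedSquare _ _ _ _ := k.naturality c d
            have s' : EnrichedSquare _ _ _ _ := φ.fiber.naturality
              (fun j => (OperadData.Hom.toMap g).obj (c j)) ((OperadData.Hom.toMap g).obj d)
            have t := (EnrichedSquare.symm
              (t := tpowIso fun j => asIso (φ.app ((OperadData.Hom.toMap g).obj (c j))))
              (t' := asIso (φ.app ((OperadData.Hom.toMap g).obj d))) s').precomp
              ((OperadData.Hom.toMap g).map c d)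
            exact (s.trans (t.of_eq (Category.assoc _ _ _) rfl rfl rfl)).of_eq rfl rfl
                (tpowMap_comp _ _) rfl } }
  refine ⟨χ, rfl, OpAlg.Hom.ext rfl fun x => (Category.comp_id _).trans ?_⟩
  exact (Category.assoc _ _ _).trans ((congrArg _ (IsIso.inv_hom_id _)).trans (Category.comp_id _))

lemma isStronglyCartesian_of_isIso {X Y : OpAlg.{u} E C} (φ : X ⟶ Y)
    (hφ : ∀ x, IsIso (Hom.app φ x)) :
    (OpAlg.forget E C).IsStronglyCartesian ((OpAlg.forget E C).map φ) φ where
  toIsHomLift := IsHomLift.map (p := OpAlg.forget E C) φ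
  universal_property' {Z} g ψ hψ := by
    obtain ⟨χ, h, h'⟩ := exists_lift φ hφ ψ g
      (IsHomLift.eq_of_isHomLift (OpAlg.forget E C) (g ≫ Hom.base φ) ψ)
    subst h
    refine ⟨χ, ⟨IsHomLift.map (p := OpAlg.forget E C) χ, h'⟩, fun χ' hχ' => ?_⟩
    have := hχ'.1
    exact comp_right_cancel hφ
      (IsHomLift.eq_of_isHomLift (OpAlg.forget E C) (Hom.base χ) χ').symm (hχ'.2.trans h'.symm)

/-- The restriction of an algebra along a morphism of operads. -/
abbrev restrict {P : Operad.{u} E} (Y : OpAlg.{u} E C) (f : P ⟶ Y.operad) : OpAlg.{u} E C :=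
  ⟨P, (Algebra.pullback C f).obj Y.alg⟩

/-- The canonical cartesian lift of `f`, with identity components. -/
abbrev restrictHom {P : Operad.{u} E} (Y : OpAlg.{u} E C) (f : P ⟶ Y.operad) :
    Y.restrict f ⟶ Y :=
  { base := f
    fiber := 𝟙 _ : Hom _ _ }

lemma restrictHom_isStronglyCartesian {P : Operad.{u} E} (Y : OpAlg.{u} E C) (f : P ⟶ Y.operad) :
    (OpAlg.forget E C).IsStronglyCartesian f (Y.restrictHom f) :=
  isStronglyCartesian_of_isIso (Y.restrictHom f) fun _ => inferInstanceAs (IsIso (𝟙 (Y.carrier _)))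

lemma isIso_of_isStronglyCartesian {X Y : OpAlg.{u} E C} (φ : X ⟶ Y)
    (hφ : (OpAlg.forget E C).IsStronglyCartesian ((OpAlg.forget E C).map φ) φ) (x : X.Ob) :
    IsIso (Hom.app φ x) := by
  -- `χ` compares `φ` with the canonical lift of its base; the universal property of `φ` provides an
  -- inverse `σ` of `χ`, whose components are inverse to those of `φ`.
  let χ : X.Hom (Y.restrict (Hom.base φ)) :=
    { base := 𝟙 X.operad
      fiber :=
        { app := fun x => Hom.app φ x
          naturality := fun c d => (show EnrichedSquare _ _ _ _ from
            φ.fiber.naturality c d).of_eq rfl (Category.id_comp _) rfl rfl } }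
  have hχ : CategoryStruct.comp (obj := OpAlg.{u} E C) χ (Y.restrictHom (Hom.base φ)) = φ :=
    OpAlg.Hom.ext (Category.id_comp _) fun _ => (Category.comp_id _).trans (Category.comp_id _)
  have := IsHomLift.map (p := OpAlg.forget E C) (Y.restrictHom (Hom.base φ))
  obtain ⟨σ, ⟨hσ, h⟩, -⟩ := Functor.IsStronglyCartesian.universal_property (OpAlg.forget E C)
    (Hom.base φ) φ (𝟙 X.operad) (Hom.base φ) (Category.id_comp _).symm (Y.restrictHom (Hom.base φ))
  have hσ' := IsHomLift.eq_of_isHomLift (a := Y.restrict (Hom.base φ))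
    (OpAlg.forget E C) (𝟙 X.operad) σ
  have h' : CategoryStruct.comp (obj := OpAlg.{u} E C) χ σ = 𝟙 X := by
    have : (OpAlg.forget E C).IsHomLift (𝟙 X.operad) (𝟙 X) :=
      IsHomLift.map (p := OpAlg.forget E C) (𝟙 X)
    have : (OpAlg.forget E C).IsHomLift (𝟙 X.operad)
        (CategoryStruct.comp (obj := OpAlg.{u} E C) χ σ) := by
      convert IsHomLift.map (p := OpAlg.forget E C)
        (CategoryStruct.comp (obj := OpAlg.{u} E C) χ σ)
      exact hσ'.trans (Category.id_comp _).symm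
    refine Functor.IsStronglyCartesian.ext (OpAlg.forget E C) (Hom.base φ) φ (𝟙 X.operad) ?_
    rw [Category.assoc, h, Category.id_comp]
    exact hχ
  obtain ⟨b, s⟩ := σ
  obtain rfl : 𝟙 X.operad = b := hσ'
  exact ⟨s.app x, (Category.comp_id _).symm.trans (Hom.app_congr h' x),
    (Category.comp_id _).symm.trans (Hom.app_congr h x)⟩

instance : (OpAlg.forget.{u} E C).IsFibered :=
  Functor.IsFibered.of_exists_isStronglyCartesian fun Y _ f =>
    ⟨Y.restrict f, Y.restrictHom f, Y.restrictHom_isStronglyCartesian f⟩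

lemma forget_isStrictSymmetricMonoidal : IsStrictSymmetricMonoidal (OpAlg.forget.{u} E C) := by
  let M : (OpAlg.forget.{u} E C).CoreMonoidal :=
    { εIso := Iso.refl _
      μIso := fun _ _ => Iso.refl _
      μIso_hom_natural_left := fun _ _ => (Category.comp_id _).trans (Category.id_comp _).symm
      μIso_hom_natural_right := fun _ _ => (Category.comp_id _).trans (Category.id_comp _).symm
      associativity := fun X Y Z => id_whiskerRight_comp_eq _
      left_unitality := fun X => eq_id_whiskerRight_comp _
      right_unitality := fun X => eq_whiskerLeft_id_comp _ }
  let _ : (OpAlg.forget.{u} E C).Monoidal := M.toMonoidal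
  let _ : (OpAlg.forget.{u} E C).Braided :=
    { braided := fun X Y => (Category.id_comp _).trans (Category.comp_id _).symm }
  exact ⟨inferInstance, ⟨rfl, rfl⟩, fun _ _ => ⟨rfl, rfl⟩⟩

lemma family_isStrictSymmetricMonoidal : IsStrictSymmetricMonoidal (OpAlg.family.{u} E C) := by
  have map_whiskerRight {X X' : OpAlg.{u} E C} (φ : X ⟶ X') (Y : OpAlg.{u} E C) :
      (OpAlg.family E C).map (φ ▷ Y) = (OpAlg.family E C).map φ ▷ (OpAlg.family E C).obj Y :=
    FormalCoproduct.hom_ext rfl fun _ => (Category.comp_id _).trans (tensorHom_id _ _)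
  have map_whiskerLeft (X : OpAlg.{u} E C) {Y Y' : OpAlg.{u} E C} (ψ : Y ⟶ Y') :
      (OpAlg.family E C).map (X ◁ ψ) = (OpAlg.family E C).obj X ◁ (OpAlg.family E C).map ψ :=
    FormalCoproduct.hom_ext rfl fun _ => (Category.comp_id _).trans (id_tensorHom _ _)
  let M : (OpAlg.family.{u} E C).CoreMonoidal :=
    { εIso := Iso.refl _
      μIso := fun _ _ => Iso.refl _
      μIso_hom_natural_left := fun φ Y => (Category.comp_id _).trans
        ((map_whiskerRight φ Y).symm.trans (Category.id_comp _).symm)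
      μIso_hom_natural_right := fun X ψ => (Category.comp_id _).trans
        ((map_whiskerLeft X ψ).symm.trans (Category.id_comp _).symm)
      associativity := fun X Y Z => id_whiskerRight_comp_eq
        (α_ ((OpAlg.family E C).obj X) ((OpAlg.family E C).obj Y) ((OpAlg.family E C).obj Z)).hom
      left_unitality := fun X => eq_id_whiskerRight_comp _
      right_unitality := fun X => eq_whiskerLeft_id_comp _ }
  let _ : (OpAlg.family.{u} E C).Monoidal := M.toMonoidal
  let _ : (OpAlg.family.{u} E C).Braided :=
    { braided := fun X Y => (Category.id_comp _).trans (Category.comp_id _).symm }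
  exact ⟨inferInstance, ⟨rfl, rfl⟩, fun _ _ => ⟨rfl, rfl⟩⟩

lemma isSymmetricMonoidalFibration : IsSymmetricMonoidalFibration (OpAlg.forget.{u} E C) where
  isFibered := inferInstance
  isStrict := forget_isStrictSymmetricMonoidal
  tensor_cartesian φ ψ hφ hψ := isStronglyCartesian_of_isIso _ fun x => by
    have := isIso_of_isStronglyCartesian φ hφ x.1
    have := isIso_of_isStronglyCartesian ψ hψ x.2
    exact inferInstanceAs (IsIso (Hom.app φ x.1 ⊗ₘ Hom.app ψ x.2))

end OpAlg

end AlgebraFibration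

/-! ### The fibration of coalgebras over operads -/

section CoalgebraFibration

set_option linter.unusedSectionVars false

variable {E : Type w} [Category.{v} E] [MonoidalCategory E] [SymmetricCategory E]
  {C : Type w'} [Category.{v'} C] [MonoidalCategory C] [SymmetricCategory C]
  [EnrichedOrdinaryCategory E C] [SymmetricMonoidalEnriched E C]

namespace OpCog

lemma Hom.app_congr {X Y : OpCog.{u} E C} {φ ψ : X.Hom Y} (h : φ = ψ) (x : X.Ob) :
    φ.app x ≫ eqToHom (by rw [h]) = ψ.app x := by
  subst h
  exact Category.comp_id _

/-- A factorisation through a morphism with invertible components is determined by its base. -/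
lemma comp_right_cancel {X Y Z : OpCog.{u} E C} {φ : X ⟶ Y} (hφ : ∀ x, IsIso (Hom.app φ x))
    {χ χ' : Z ⟶ X} (h : Hom.base χ = Hom.base χ') (h' : χ ≫ φ = χ' ≫ φ) : χ = χ' := by
  obtain ⟨g, k⟩ := χ
  obtain ⟨g', k'⟩ := χ'
  obtain rfl : g = g' := h
  refine OpCog.Hom.ext rfl fun x => (Category.comp_id _).trans ?_
  have := hφ ((OperadData.Hom.toMap g).obj x)
  exact (cancel_mono (Hom.app φ ((OperadData.Hom.toMap g).obj x))).1
    ((Category.comp_id _).symm.trans (Hom.app_congr h' x))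

/-- If the components of `φ` are invertible, a morphism to its target factors through `φ` as soon as
its base does. -/
lemma exists_lift {X Y Z : OpCog.{u} E C} (φ : X.Hom Y) (hφ : ∀ x, IsIso (φ.app x))
    (ψ : Z.Hom Y) (g : Z.operad ⟶ X.operad) (h : g ≫ φ.base = ψ.base) :
    ∃ χ : Z.Hom X, χ.base = g ∧ CategoryStruct.comp (obj := OpCog.{u} E C) χ φ = ψ := by
  obtain ⟨f, k⟩ := ψ
  obtain rfl : g ≫ φ.base = f := h
  let χ : Z.Hom X := mkHom g
    (fun x => (k.unop.app x).unop ≫ inv (φ.app ((OperadData.Hom.toMap g).obj x))) fun c d => by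
      have s : EnrichedSquare _ _ _ _ := k.unop.naturality c d
      have s' : EnrichedSquare _ _ _ _ := φ.fiber.unop.naturality
        (fun j => (OperadData.Hom.toMap g).obj (c j)) ((OperadData.Hom.toMap g).obj d)
      have t := (EnrichedSquare.symm
        (t := tpowIso fun j => (asIso (φ.app ((OperadData.Hom.toMap g).obj (c j)))).op)
        (t' := (asIso (φ.app ((OperadData.Hom.toMap g).obj d))).op) s').precomp
        ((OperadData.Hom.toMap g).map c d)
      exact ((t.of_eq rfl (Category.assoc _ _ _) rfl rfl).trans s).of_eq rfl rfl
        (tpowMap_comp (fun j => (inv (φ.app ((OperadData.Hom.toMap g).obj (c j)))).op)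
          (fun j => k.unop.app (c j))) rfl
  refine ⟨χ, rfl, OpCog.Hom.ext rfl fun x => (Category.comp_id _).trans ?_⟩
  exact (Category.assoc _ _ _).trans ((congrArg _ (IsIso.inv_hom_id _)).trans (Category.comp_id _))

lemma isStronglyCartesian_of_isIso {X Y : OpCog.{u} E C} (φ : X ⟶ Y)
    (hφ : ∀ x, IsIso (Hom.app φ x)) :
    (OpCog.forget E C).IsStronglyCartesian ((OpCog.forget E C).map φ) φ where
  toIsHomLift := IsHomLift.map (p := OpCog.forget E C) φ
  universal_property' {Z} g ψ hψ := by
    obtain ⟨χ, h, h'⟩ := exists_lift φ hφ ψ g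
      (IsHomLift.eq_of_isHomLift (OpCog.forget E C) (g ≫ Hom.base φ) ψ)
    subst h
    refine ⟨χ, ⟨IsHomLift.map (p := OpCog.forget E C) χ, h'⟩, fun χ' hχ' => ?_⟩
    have := hχ'.1
    exact comp_right_cancel hφ
      (IsHomLift.eq_of_isHomLift (OpCog.forget E C) (Hom.base χ) χ').symm (hχ'.2.trans h'.symm)

/-- The restriction of a coalgebra along a morphism of operads. -/
abbrev restrict {P : Operad.{u} E} (Y : OpCog.{u} E C) (f : P ⟶ Y.operad) : OpCog.{u} E C :=
  ⟨P, (Coalgebra.pullback C f).obj Y.cog⟩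

/-- The canonical cartesian lift of `f`, with identity components. -/
abbrev restrictHom {P : Operad.{u} E} (Y : OpCog.{u} E C) (f : P ⟶ Y.operad) :
    Y.restrict f ⟶ Y :=
  { base := f
    fiber := 𝟙 _ : Hom _ _ }

lemma restrictHom_isStronglyCartesian {P : Operad.{u} E} (Y : OpCog.{u} E C) (f : P ⟶ Y.operad) :
    (OpCog.forget E C).IsStronglyCartesian f (Y.restrictHom f) :=
  isStronglyCartesian_of_isIso (Y.restrictHom f) fun _ => inferInstanceAs (IsIso (𝟙 (Y.carrier _)))

lemma isIso_of_isStronglyCartesian {X Y : OpCog.{u} E C} (φ : X ⟶ Y)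
    (hφ : (OpCog.forget E C).IsStronglyCartesian ((OpCog.forget E C).map φ) φ) (x : X.Ob) :
    IsIso (Hom.app φ x) := by
  -- `χ` compares `φ` with the canonical lift of its base; the universal property of `φ` provides an
  -- inverse `σ` of `χ`, whose components are inverse to those of `φ`.
  let χ : X.Hom (Y.restrict (Hom.base φ)) := mkHom (𝟙 X.operad) (fun x => Hom.app φ x)
    fun c d => (show EnrichedSquare _ _ _ _ from φ.fiber.unop.naturality c d).of_eq
      (Category.id_comp _) rfl rfl rfl
  have hχ : CategoryStruct.comp (obj := OpCog.{u} E C) χ (Y.restrictHom (Hom.base φ)) = φ :=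
    OpCog.Hom.ext (Category.id_comp _) fun _ => (Category.comp_id _).trans (Category.comp_id _)
  have := IsHomLift.map (p := OpCog.forget E C) (Y.restrictHom (Hom.base φ))
  obtain ⟨σ, ⟨hσ, h⟩, -⟩ := Functor.IsStronglyCartesian.universal_property (OpCog.forget E C)
    (Hom.base φ) φ (𝟙 X.operad) (Hom.base φ) (Category.id_comp _).symm (Y.restrictHom (Hom.base φ))
  have hσ' := IsHomLift.eq_of_isHomLift (a := Y.restrict (Hom.base φ))
    (OpCog.forget E C) (𝟙 X.operad) σ
  have h' : CategoryStruct.comp (obj := OpCog.{u} E C) χ σ = 𝟙 X := by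
    have : (OpCog.forget E C).IsHomLift (𝟙 X.operad) (𝟙 X) :=
      IsHomLift.map (p := OpCog.forget E C) (𝟙 X)
    have : (OpCog.forget E C).IsHomLift (𝟙 X.operad)
        (CategoryStruct.comp (obj := OpCog.{u} E C) χ σ) := by
      convert IsHomLift.map (p := OpCog.forget E C)
        (CategoryStruct.comp (obj := OpCog.{u} E C) χ σ)
      exact hσ'.trans (Category.id_comp _).symm
    refine Functor.IsStronglyCartesian.ext (OpCog.forget E C) (Hom.base φ) φ (𝟙 X.operad) ?_
    rw [Category.assoc, h, Category.id_comp]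
    exact hχ
  obtain ⟨b, s⟩ := σ
  obtain rfl : 𝟙 X.operad = b := hσ'
  exact ⟨(s.unop.app x).unop, (Category.comp_id _).symm.trans (Hom.app_congr h' x),
    (Category.comp_id _).symm.trans (Hom.app_congr h x)⟩

instance : (OpCog.forget.{u} E C).IsFibered :=
  Functor.IsFibered.of_exists_isStronglyCartesian fun Y _ f =>
    ⟨Y.restrict f, Y.restrictHom f, Y.restrictHom_isStronglyCartesian f⟩

lemma forget_isStrictSymmetricMonoidal : IsStrictSymmetricMonoidal (OpCog.forget.{u} E C) := by
  let M : (OpCog.forget.{u} E C).CoreMonoidal :=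
    { εIso := Iso.refl _
      μIso := fun _ _ => Iso.refl _
      μIso_hom_natural_left := fun _ _ => (Category.comp_id _).trans (Category.id_comp _).symm
      μIso_hom_natural_right := fun _ _ => (Category.comp_id _).trans (Category.id_comp _).symm
      associativity := fun X Y Z => id_whiskerRight_comp_eq _
      left_unitality := fun X => eq_id_whiskerRight_comp _
      right_unitality := fun X => eq_whiskerLeft_id_comp _ }
  let _ : (OpCog.forget.{u} E C).Monoidal := M.toMonoidal
  let _ : (OpCog.forget.{u} E C).Braided :=
    { braided := fun X Y => (Category.id_comp _).trans (Category.comp_id _).symm }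
  exact ⟨inferInstance, ⟨rfl, rfl⟩, fun _ _ => ⟨rfl, rfl⟩⟩

lemma family_isStrictSymmetricMonoidal : IsStrictSymmetricMonoidal (OpCog.family.{u} E C) := by
  have map_whiskerRight {X X' : OpCog.{u} E C} (φ : X ⟶ X') (Y : OpCog.{u} E C) :
      (OpCog.family E C).map (φ ▷ Y) = (OpCog.family E C).map φ ▷ (OpCog.family E C).obj Y :=
    FormalCoproduct.hom_ext rfl fun _ => (Category.comp_id _).trans (tensorHom_id _ _)
  have map_whiskerLeft (X : OpCog.{u} E C) {Y Y' : OpCog.{u} E C} (ψ : Y ⟶ Y') :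
      (OpCog.family E C).map (X ◁ ψ) = (OpCog.family E C).obj X ◁ (OpCog.family E C).map ψ :=
    FormalCoproduct.hom_ext rfl fun _ => (Category.comp_id _).trans (id_tensorHom _ _)
  let M : (OpCog.family.{u} E C).CoreMonoidal :=
    { εIso := Iso.refl _
      μIso := fun _ _ => Iso.refl _
      μIso_hom_natural_left := fun φ Y => (Category.comp_id _).trans
        ((map_whiskerRight φ Y).symm.trans (Category.id_comp _).symm)
      μIso_hom_natural_right := fun X ψ => (Category.comp_id _).trans
        ((map_whiskerLeft X ψ).symm.trans (Category.id_comp _).symm)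
      associativity := fun X Y Z => id_whiskerRight_comp_eq
        (α_ ((OpCog.family E C).obj X) ((OpCog.family E C).obj Y) ((OpCog.family E C).obj Z)).hom
      left_unitality := fun X => eq_id_whiskerRight_comp _
      right_unitality := fun X => eq_whiskerLeft_id_comp _ }
  let _ : (OpCog.family.{u} E C).Monoidal := M.toMonoidal
  let _ : (OpCog.family.{u} E C).Braided :=
    { braided := fun X Y => (Category.id_comp _).trans (Category.comp_id _).symm }
  exact ⟨inferInstance, ⟨rfl, rfl⟩, fun _ _ => ⟨rfl, rfl⟩⟩

lemma isSymmetricMonoidalFibration : IsSymmetricMonoidalFibration (OpCog.forget.{u} E C) where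
  isFibered := inferInstance
  isStrict := forget_isStrictSymmetricMonoidal
  tensor_cartesian φ ψ hφ hψ := isStronglyCartesian_of_isIso _ fun x => by
    have := isIso_of_isStronglyCartesian φ hφ x.1
    have := isIso_of_isStronglyCartesian ψ hψ x.2
    exact inferInstanceAs (IsIso (Hom.app φ x.1 ⊗ₘ Hom.app ψ x.2))

end OpCog

end CoalgebraFibration

end ColouredOperads

end

theorem mainTheorem7 {E : Type w} [Category.{v} E] [MonoidalCategory E] [SymmetricCategory E]
    {C : Type w'} [Category.{v'} C] [MonoidalCategory C] [SymmetricCategory C]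
    [EnrichedOrdinaryCategory E C] [SymmetricMonoidalEnriched E C] :
    (∃ (_ : MonoidalCategory (OpAlg.{u} E C)) (_ : SymmetricCategory (OpAlg.{u} E C)),
      (∀ X Y : OpAlg.{u} E C, ∃ A : Algebra C (X.operad.hadamard Y.operad),
        A.toMap = diamond X.alg Y.alg ∧ X ⊗ Y = ⟨X.operad.hadamard Y.operad, A⟩) ∧
      (∃ A : Algebra C (Operad.uCom.{u} E),
        A.toMap = endUnit E C ∧ 𝟙_ (OpAlg.{u} E C) = ⟨Operad.uCom E, A⟩) ∧
      IsStrictSymmetricMonoidal (OpAlg.family.{u} E C) ∧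
      IsSymmetricMonoidalFibration (OpAlg.forget.{u} E C)) ∧
    (∃ (_ : MonoidalCategory (OpCog.{u} E C)) (_ : SymmetricCategory (OpCog.{u} E C)),
      (∀ X Y : OpCog.{u} E C, ∃ V : Coalgebra C (X.operad.hadamard Y.operad),
        V.unop.toMap = diamond X.cog.unop Y.cog.unop ∧
          X ⊗ Y = ⟨X.operad.hadamard Y.operad, V⟩) ∧
      (∃ V : Coalgebra C (Operad.uCom.{u} E),
        V.unop.toMap = endUnit E Cᵒᵖ ∧ 𝟙_ (OpCog.{u} E C) = ⟨Operad.uCom E, V⟩) ∧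
      IsStrictSymmetricMonoidal (OpCog.family.{u} E C) ∧
      IsSymmetricMonoidalFibration (OpCog.forget.{u} E C)) := by
  exact
    ⟨⟨OpAlg.monoidalCategory, OpAlg.symmetricCategory, fun X Y => ⟨X.alg.diamond Y.alg, rfl, rfl⟩,
        ⟨Algebra.unit E C, rfl, rfl⟩, OpAlg.family_isStrictSymmetricMonoidal,
        OpAlg.isSymmetricMonoidalFibration⟩,
      ⟨OpCog.monoidalCategory, OpCog.symmetricCategory,
        fun X Y => ⟨op (X.cog.unop.diamond Y.cog.unop), rfl, rfl⟩,
        ⟨op (Algebra.unit E Cᵒᵖ), rfl, rfl⟩, OpCog.family_isStrictSymmetricMonoidal,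
        OpCog.isSymmetricMonoidalFibration⟩⟩
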